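/- Let $(Q,h)$ be a closed (compact, without boundary), connected, smooth Riemannian manifold of dimension $n\ge 2$, with universal covering $\mu\colon\widetilde Q\to Q$ and lifted metric $\tilde h=\mu^*h$. Let $\tau\colon T^*Q\to Q$ and $\tilde\tau\colon T^*\widetilde Q\to\widetilde Q$ be the cotangent bundles, with Liouville forms $\lambda_u=u\circ T\tau$ and $\tilde\lambda_{\tilde u}=\tilde u\circ T\tilde\tau$, and let $T^*\mu\colon T^*\widetilde Q\to T^*Q$, $\tilde u\mapsto \tilde u\circ (T\mu)^{-1}$, be the induced covering. For a smooth function $v\colon Q\to\mathbb R$ (the potential) put $H(u)=\frac12|u|^2_{h^\flat}+v(\tau(u))$ on $T^*Q$, where $h^\flat$ is the dual metric, and $\widetilde H=H\circ T^*\mu$ on $T^*\widetilde Q$. A $1$-form $\theta$ on $\widetilde Q$ is called bounded if $\sup_{\widetilde Q}|\theta|_{(\tilde h)^\flat}<\infty$. Terminology. An odd-dimensional symplectic form on a manifold $M$ of dimension $2n-1$ is a closed $2$-form with $1$-dimensional kernel at every point. A virtually contact structure on a closed manifold $M$ of dimension $2n-1$ is a tuple $(\pi\colon M'\to M,\alpha,\omega,g)$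 of a smooth covering $\pi$, a contact form $\alpha$ on $M'$, an odd-dimensional symplectic form $\omega$ on $M$ and a Riemannian metric $g$ on $M$ such that $\pi^*\omega=\mathrm d\alpha$, $\sup_{M'}|\alpha|_{(\pi^*g)^\flat}<\infty$, and for some $c>0$ one has $|\alpha(w)|>c\,|w|_{\pi^*g}$ for all non-zero $w\in\ker\mathrm d\alpha$. It is somewhere contact if there are a non-empty open subset $O\subset M$ and a contact form $\alpha_O$ on $O$ with $\pi^*\alpha_O=\alpha$ on $\pi^{-1}(O)$. Let $\sigma$ be a smooth closed $2$-form on $Q$, let $V\subset Q$ be a non-empty open subset with $\sigma|_V=0$, and let $\theta$ be a smooth bounded $1$-form on $\widetilde Q$ with $\mathrm d\theta=\mu^*\sigma$. Then there exist a non-empty open subset $U\subset\overline U\subset V$ of $Q$ and a smooth bounded $1$-form $\hat\theta$ on $\widetilde Q$ with $\mathrm d\hat\theta=\mu^*\sigma$ that coincides with $\theta$ on the complement of $\mu^{-1}(V)$ and vanishes on $\mu^{-1}(U)$, such that $\sup_{\widetilde Q}\widetilde H(\hat\theta)<\infty$ and the following holds for every $k>\sup_{\widetilde Q}\widetilde H(\hat\theta)$.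 The sets $M=\{H=k\}\subset T^*Q$ and $M'=\{\widetilde H=k\}\subset T^*\widetilde Q$ are embedded smooth submanifolds of dimension $2n-1$. With $\pi=T^*\mu|_{M'}\colon M'\to M$, $\alpha=(\tilde\lambda+\tilde\tau^*\hat\theta)|_{TM'}$ and $\omega=(\mathrm d\lambda+\tau^*\sigma)|_{TM}$, the tuple $(\pi\colon M'\to M,\alpha,\omega,g)$ is, for every Riemannian metric $g$ on $M$, a virtually contact structure that is somewhere contact. If moreover $n\ge 3$ and $\sigma$ is not exact on $Q$, then $\omega$ is not exact on $M$. -/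

import Mathlib

open scoped Manifold ContDiff

noncomputable section

namespace Magnetic

/-! ### Differential forms on manifolds without boundary -/

section Forms

variable {E : Type*} [NormedAddCommGroup E] [NormedSpace ℝ E]
  {H : Type*} [TopologicalSpace H] (I : ModelWithCorners ℝ E H)
  (M : Type*) [TopologicalSpace M] [ChartedSpace H M]
  {E' : Type*} [NormedAddCommGroup E'] [NormedSpace ℝ E']
  {H' : Type*} [TopologicalSpace H'] (I' : ModelWithCorners ℝ E' H')
  {M' : Type*} [TopologicalSpace M'] [ChartedSpace H' M']

/-- A (not necessarily smooth) differential `k`-form on `M`. -/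
abbrev DiffForm (k : ℕ) : Type _ := ∀ x : M, TangentSpace I x [⋀^Fin k]→L[ℝ] ℝ

variable {M} {k : ℕ}

/-- The local representation of a form in the preferred chart at `x₀`, i.e. its pull-back along
the inverse of that chart. -/
def inChart (η : DiffForm I M k) (x₀ : M) (y : E) : E [⋀^Fin k]→L[ℝ] ℝ :=
  (η ((extChartAt I x₀).symm y)).compContinuousLinearMap
    (mfderiv 𝓘(ℝ, E) I (extChartAt I x₀).symm y : E →L[ℝ] _)

/-- The form `η` is smooth on the subset `U` (used for open `U`). -/
def IsSmoothFormOn (η : DiffForm I M k) (U : Set M) : Prop :=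
  ∀ x ∈ U, ContDiffAt ℝ ∞ (inChart I η x) (extChartAt I x x)

/-- The form `η` is smooth. -/
def IsSmoothForm (η : DiffForm I M k) : Prop := IsSmoothFormOn I η Set.univ

/-- The exterior derivative: `dη` at `x` is computed in the preferred chart at `x`. -/
def extD (η : DiffForm I M k) : DiffForm I M (k + 1) := fun x =>
  (extDeriv (inChart I η x) (extChartAt I x x)).compContinuousLinearMap
    (mfderiv I 𝓘(ℝ, E) (extChartAt I x) x : _ →L[ℝ] E)

/-- A form is exact if it is the exterior derivative of a smooth form. -/
def IsExactForm (η : DiffForm I M (k + 1)) : Prop :=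
  ∃ β : DiffForm I M k, IsSmoothForm I β ∧ extD I β = η

/-- The pull-back `f^*η`. -/
def pullbackForm (f : M → M') (η : DiffForm I' M' k) : DiffForm I M k := fun x =>
  (η (f x)).compContinuousLinearMap (mfderiv I I' f x)

/-- The covector given by a 1-form at a point. -/
def toCovector {x : M} (a : TangentSpace I x [⋀^Fin 1]→L[ℝ] ℝ) : TangentSpace I x →L[ℝ] ℝ :=
  (ContinuousAlternatingMap.ofSubsingleton ℝ (TangentSpace I x) ℝ (0 : Fin 1)).symm a

/-- The 1-form on a tangent space given by a covector. -/
def ofCovector {x : M} (u : TangentSpace I x →L[ℝ] ℝ) : TangentSpace I x [⋀^Fin 1]→L[ℝ] ℝ :=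
  ContinuousAlternatingMap.ofSubsingleton ℝ (TangentSpace I x) ℝ (0 : Fin 1) u

/-- `α` is a contact form on the open subset `U`: it is smooth on `U`, nowhere zero on `U`, and
`dα` is non-degenerate on `ker α` (equivalently, `α ∧ (dα)^(n-1)` is a volume form on `U` when
`dim M = 2n-1`). -/
def IsContactFormOn (α : DiffForm I M 1) (U : Set M) : Prop :=
  IsSmoothFormOn I α U ∧ ∀ x ∈ U, α x ≠ 0 ∧
    ∀ v : TangentSpace I x, α x ![v] = 0 →
      (∀ w : TangentSpace I x, α x ![w] = 0 → extD I α x ![v, w] = 0) → v = 0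

/-- An odd-dimensional symplectic form: a smooth closed 2-form whose kernel is a line at
every point. -/
def IsOddSymplectic (η : DiffForm I M 2) : Prop :=
  IsSmoothForm I η ∧ extD I η = 0 ∧
    ∀ x, ∃ e : TangentSpace I x, e ≠ 0 ∧
      ∀ v : TangentSpace I x, (∀ w, η x ![v, w] = 0) ↔ ∃ c : ℝ, v = c • e

end Forms

/-! ### Metrics -/

section Metrics

variable {E : Type*} [NormedAddCommGroup E] [NormedSpace ℝ E]
  {H : Type*} [TopologicalSpace H] (I : ModelWithCorners ℝ E H)
  (M : Type*) [TopologicalSpace M] [ChartedSpace H M]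
  {M' : Type*} [TopologicalSpace M'] [ChartedSpace H M']

/-- Smooth Riemannian metrics on the manifold `M`. -/
abbrev RiemMetric [IsManifold I ∞ M] : Type _ :=
  Bundle.ContMDiffRiemannianMetric I ∞ E (fun x : M => TangentSpace I x)

variable {M}

/-- The pull-back along `f` of a field of bilinear forms:
`(f^*b)_x (v, w) = b_{f x} (Tf v, Tf w)`. -/
def pullbackMetric (f : M' → M)
    (b : ∀ x : M, TangentSpace I x →L[ℝ] TangentSpace I x →L[ℝ] ℝ) (x : M') :
    TangentSpace I x →L[ℝ] TangentSpace I x →L[ℝ] ℝ :=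
  (ContinuousLinearMap.precomp ℝ (mfderiv I I f x)) ∘L (b (f x)) ∘L (mfderiv I I f x)

/-- The norm of a vector with respect to the scalar product `b`. -/
def vectorNorm {x : M} (b : TangentSpace I x →L[ℝ] TangentSpace I x →L[ℝ] ℝ)
    (v : TangentSpace I x) : ℝ := √(b v v)

/-- The square of the norm of the covector `u` with respect to the scalar product dual to `b`.
The scalar product `b` is an isomorphism from the tangent space onto its dual, and the square of
the norm of `u` is the value of `u` on the vector that corresponds to `u`. -/
def covectorNormSq {x : M} (b : TangentSpace I x →L[ℝ] TangentSpace I x →L[ℝ] ℝ)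
    (u : TangentSpace I x →L[ℝ] ℝ) : ℝ := u (b.inverse u)

/-- A Riemannian metric identifies each tangent space with its dual, so that the inverse in
`covectorNormSq` is a true inverse. -/
theorem inner_inverse_apply [FiniteDimensional ℝ E] [IsManifold I ∞ M] (h : RiemMetric I M) (x : M)
    (u : TangentSpace I x →L[ℝ] ℝ) : (h.inner x) ((h.inner x).inverse u) = u := by
  have hinj : Function.Injective (h.inner x) := by
    rw [injective_iff_map_eq_zero]
    intro v hv
    by_contra hne
    have := h.pos x v hne
    simp [hv] at this
  have hinv : (h.inner x).IsInvertible := by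
    let A : E →L[ℝ] (E →L[ℝ] ℝ) := h.inner x
    have hA : Function.Injective A := hinj
    have hfin : Module.finrank ℝ E = Module.finrank ℝ (E →L[ℝ] ℝ) := by
      rw [← LinearMap.toContinuousLinearMap.finrank_eq]
      exact (Subspace.dual_finrank_eq (K := ℝ) (V := E)).symm
    let e := (LinearEquiv.ofInjectiveOfFinrankEq A.toLinearMap hA hfin).toContinuousLinearEquiv
    exact ⟨e, by ext v; rfl⟩
  obtain ⟨e, he⟩ := hinv
  rw [← he]
  simp

/-- The norm of the covector `u` with respect to the scalar product dual to `b`. -/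
def covectorNorm {x : M} (b : TangentSpace I x →L[ℝ] TangentSpace I x →L[ℝ] ℝ)
    (u : TangentSpace I x →L[ℝ] ℝ) : ℝ := √(covectorNormSq I b u)

/-- The 1-form `θ` is bounded with respect to (the dual of) the metric `b`. -/
def IsBoundedForm (b : ∀ x : M, TangentSpace I x →L[ℝ] TangentSpace I x →L[ℝ] ℝ)
    (θ : DiffForm I M 1) : Prop :=
  ∃ C : ℝ, ∀ x, covectorNorm I (b x) (toCovector I (θ x)) ≤ C

end Metrics

/-! ### Virtually contact structures -/

section VirtuallyContact

variable {E : Type*} [NormedAddCommGroup E] [NormedSpace ℝ E]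
  {H : Type*} [TopologicalSpace H] (I : ModelWithCorners ℝ E H)
  {M : Type*} [TopologicalSpace M] [ChartedSpace H M]
  {M' : Type*} [TopologicalSpace M'] [ChartedSpace H M']

/-- A smooth covering. -/
structure IsSmoothCovering (p : M' → M) : Prop where
  isCoveringMap : IsCoveringMap p
  surjective : Function.Surjective p
  isLocalDiffeomorph : IsLocalDiffeomorph I I ∞ p

/-- `(p : M' → M, α, η, g)` is a virtually contact structure on the closed manifold `M`.
As `M` is closed, every metric `g` on `M` has bounded geometry. -/
structure IsVirtuallyContact [IsManifold I ∞ M] (p : M' → M) (α : DiffForm I M' 1)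
    (η : DiffForm I M 2) (g : RiemMetric I M) : Prop where
  closed_manifold : CompactSpace M
  oddSymplectic : IsOddSymplectic I η
  covering : IsSmoothCovering I p
  contact : IsContactFormOn I α Set.univ
  primitive : pullbackForm I I p η = extD I α
  bounded : IsBoundedForm I (pullbackMetric I p g.inner) α
  bounded_below : ∃ c : ℝ, 0 < c ∧ ∀ (x : M') (v : TangentSpace I x), v ≠ 0 →
    (∀ w, extD I α x ![v, w] = 0) →
      c * vectorNorm I (pullbackMetric I p g.inner x) v < |α x ![v]|

/-- Over some non-empty open subset `U` of `M` the form `α` is the lift of a contact form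
on `U`. -/
def IsSomewhereContact (p : M' → M) (α : DiffForm I M' 1) : Prop :=
  ∃ U : Set M, IsOpen U ∧ U.Nonempty ∧ ∃ αU : DiffForm I M 1,
    IsContactFormOn I αU U ∧ ∀ x : M', p x ∈ U → pullbackForm I I p αU x = α x

end VirtuallyContact

/-! ### Magnetic flows on cotangent bundles -/

section Cotangent

variable {E : Type*} [NormedAddCommGroup E] [NormedSpace ℝ E]
  {H : Type*} [TopologicalSpace H] (I : ModelWithCorners ℝ E H)
  (Q : Type*) [TopologicalSpace Q] [ChartedSpace H Q] [IsManifold I ∞ Q]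
  {Q' : Type*} [TopologicalSpace Q'] [ChartedSpace H Q'] [IsManifold I ∞ Q']

/-- The total space of the cotangent bundle, a manifold modelled on `I.prod 𝓘(ℝ, E →L[ℝ] ℝ)`. -/
abbrev Cotangent : Type _ :=
  Bundle.TotalSpace (E →L[ℝ] ℝ) (fun q : Q => TangentSpace I q →L[ℝ] Bundle.Trivial Q ℝ q)

variable {Q}

/-- The cotangent bundle projection `τ`. -/
def proj (u : Cotangent I Q) : Q := u.proj

/-- The covector in `T_{τ(u)}^*Q` that is the point `u` of `T^*Q`. -/
def fibre (u : Cotangent I Q) : TangentSpace I (proj I u) →L[ℝ] ℝ := u.snd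

/-- The Liouville form, `λ_u = u ∘ Tτ`. -/
def liouville : DiffForm (I.prod 𝓘(ℝ, E →L[ℝ] ℝ)) (Cotangent I Q) 1 := fun u =>
  ofCovector _ (fibre I u ∘L mfderiv (I.prod 𝓘(ℝ, E →L[ℝ] ℝ)) I (proj I (Q := Q)) u)

/-- The twisted symplectic form `dλ + τ^*σ`. -/
def twistedSymplectic (σ : DiffForm I Q 2) :
    DiffForm (I.prod 𝓘(ℝ, E →L[ℝ] ℝ)) (Cotangent I Q) 2 :=
  extD _ (liouville I) + pullbackForm _ I (proj I) σ

/-- The Hamiltonian of classical mechanics, `H(u) = |u|² / 2 + V(τ(u))`. -/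
def hamiltonian (h : RiemMetric I Q) (V : Q → ℝ) (u : Cotangent I Q) : ℝ :=
  1 / 2 * covectorNormSq I (h.inner (proj I u)) (fibre I u) + V (proj I u)

/-- The map `T^*μ : T^*Q' → T^*Q`, `u ↦ u ∘ (Tμ)⁻¹`, induced by a local diffeomorphism `μ`. -/
def cotangentMap (μ : Q' → Q) (u : Cotangent I Q') : Cotangent I Q :=
  ⟨μ (proj I u), fibre I u ∘L (mfderiv I I μ (proj I u)).inverse⟩

/-- A 1-form, viewed as a section of the cotangent bundle. -/
def toSection (θ : DiffForm I Q 1) (q : Q) : Cotangent I Q := ⟨q, toCovector I (θ q)⟩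

/-- The lifted Hamiltonian `H ∘ T^*μ`. -/
def liftedHamiltonian (μ : Q' → Q) (h : RiemMetric I Q) (V : Q → ℝ) (u : Cotangent I Q') : ℝ :=
  hamiltonian I h V (cotangentMap I μ u)

/-- The energy surface `M = {H = k}`. -/
def energySurface (h : RiemMetric I Q) (V : Q → ℝ) (k : ℝ) : Set (Cotangent I Q) :=
  {u | hamiltonian I h V u = k}

/-- The lifted energy surface `M' = {H ∘ T^*μ = k}`. -/
def liftedEnergySurface (μ : Q' → Q) (h : RiemMetric I Q) (V : Q → ℝ) (k : ℝ) :
    Set (Cotangent I Q') :=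
  {u | liftedHamiltonian I μ h V u = k}

/-- The restriction `p : M' → M` of `T^*μ`. -/
def energyProj (μ : Q' → Q) (h : RiemMetric I Q) (V : Q → ℝ) (k : ℝ)
    (u : liftedEnergySurface I μ h V k) : energySurface I h V k :=
  ⟨cotangentMap I μ u.1, u.2⟩

/-- The restriction of `dλ + τ^*σ` to a submanifold `S` of `T^*Q` (here an energy surface). -/
def restrictedTwisted (σ : DiffForm I Q 2) {d : ℕ} (S : Set (Cotangent I Q))
    [ChartedSpace (EuclideanSpace ℝ (Fin d)) S] : DiffForm (𝓡 d) S 2 :=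
  pullbackForm (𝓡 d) (I.prod 𝓘(ℝ, E →L[ℝ] ℝ)) (Subtype.val : S → Cotangent I Q)
    (twistedSymplectic I σ)

/-- The restriction of `λ + τ^*θ` to a submanifold `S` of `T^*Q` (here an energy surface). -/
def restrictedPrimitive (θ : DiffForm I Q 1) {d : ℕ} (S : Set (Cotangent I Q))
    [ChartedSpace (EuclideanSpace ℝ (Fin d)) S] : DiffForm (𝓡 d) S 1 :=
  pullbackForm (𝓡 d) (I.prod 𝓘(ℝ, E →L[ℝ] ℝ)) (Subtype.val : S → Cotangent I Q)
    (liouville I + pullbackForm _ I (proj I) θ)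

end Cotangent

section Submanifold

variable {E : Type*} [NormedAddCommGroup E] [NormedSpace ℝ E]
  {H : Type*} [TopologicalSpace H] (J : ModelWithCorners ℝ E H)
  {N : Type*} [TopologicalSpace N] [ChartedSpace H N]

/-- The given charts make `S`, with the subspace topology, a `d`-dimensional embedded smooth
submanifold of `N`. Such a smooth structure on `S` is unique if it exists. -/
structure IsSubmanifoldStructure (d : ℕ) (S : Set N)
    [ChartedSpace (EuclideanSpace ℝ (Fin d)) S] : Prop where
  isManifold : IsManifold (𝓡 d) ∞ S
  isSmoothEmbedding : Manifold.IsSmoothEmbedding (𝓡 d) J ∞ (Subtype.val : S → N)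

/-- `S` is a `d`-dimensional embedded smooth submanifold of `N`. -/
def IsSubmanifold (d : ℕ) (S : Set N) : Prop :=
  ∃ _ : ChartedSpace (EuclideanSpace ℝ (Fin d)) S, IsSubmanifoldStructure J d S

end Submanifold

end Magnetic

end

open Magnetic

set_option linter.unusedSectionVars false

noncomputable section

namespace Magnetic

open Filter Set
open scoped Topology

section VectorSpace

variable {E F G : Type*} [NormedAddCommGroup E] [NormedSpace ℝ E]
  [NormedAddCommGroup F] [NormedSpace ℝ F] [NormedAddCommGroup G] [NormedSpace ℝ G] {k : ℕ}

/-- The averaged alternatization, a left inverse of the inclusion of alternating maps. -/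
def alternatizationL (E : Type*) [NormedAddCommGroup E] [NormedSpace ℝ E] (k : ℕ) :
    ContinuousMultilinearMap ℝ (fun _ : Fin k => E) ℝ →L[ℝ] E [⋀^Fin k]→L[ℝ] ℝ where
  toFun f := ((k.factorial : ℝ)⁻¹) • ContinuousMultilinearMap.alternatization f
  map_add' f g := by simp
  map_smul' c f := by
    ext v
    simp only [ContinuousAlternatingMap.smul_apply, smul_eq_mul, RingHom.id_apply,
      ContinuousMultilinearMap.alternatization_apply_apply, _root_.smul_apply,
      ← mul_smul_comm, ← Finset.mul_sum]
    ring
  cont := by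
    refine (continuous_const_smul ((k.factorial : ℝ)⁻¹)).comp ?_
    rw [ContinuousAlternatingMap.isEmbedding_toContinuousMultilinearMap.continuous_iff]
    have : (ContinuousAlternatingMap.toContinuousMultilinearMap ∘
        (ContinuousMultilinearMap.alternatization :
          ContinuousMultilinearMap ℝ (fun _ : Fin k => E) ℝ →+ E [⋀^Fin k]→L[ℝ] ℝ)) = fun f =>
        ∑ σ : Equiv.Perm (Fin k), Equiv.Perm.sign σ • f.domDomCongr σ := by
      ext f v
      simp [ContinuousMultilinearMap.alternatization_apply_apply, Function.comp_def]
    rw [this]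
    refine continuous_finsetSum _ fun σ _ => (continuous_const_smul _).comp ?_
    exact (ContinuousMultilinearMap.domDomCongrₗᵢ ℝ E ℝ σ).continuous

theorem alternatizationL_apply (f : E [⋀^Fin k]→L[ℝ] ℝ) :
    alternatizationL E k f.toContinuousMultilinearMap = f := by
  ext v
  have : ∀ σ : Equiv.Perm (Fin k), Equiv.Perm.sign σ • f (v ∘ σ) = f v := fun σ => by
    have := f.toAlternatingMap.map_perm v σ
    rw [ContinuousAlternatingMap.coe_toAlternatingMap] at this
    rw [this, smul_smul]; simp
  simp [alternatizationL, ContinuousMultilinearMap.alternatization_apply_apply, this,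
    Fintype.card_perm, Nat.factorial_ne_zero]

theorem ContDiffAt.alternatingComp {f : G → F [⋀^Fin k]→L[ℝ] ℝ} {g : G → E →L[ℝ] F} {n : ℕ∞ω}
    {x : G} (hf : ContDiffAt ℝ n f x) (hg : ContDiffAt ℝ n g x) :
    ContDiffAt ℝ n (fun y => (f y).compContinuousLinearMap (g y)) x := by
  have h1 : ContDiffAt ℝ n (fun y =>
      ContinuousMultilinearMap.compContinuousLinearMapContinuousMultilinear ℝ
        (fun _ : Fin k => E) (fun _ => F) ℝ (fun _ => g y) (f y).toContinuousMultilinearMap) x := by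
    refine ContDiffAt.clm_apply ?_ ?_
    · exact (ContinuousMultilinearMap.contDiff _).contDiffAt.comp x
        (contDiffAt_pi.2 fun _ => hg)
    · exact (ContinuousAlternatingMap.toContinuousMultilinearMapCLM ℝ).contDiff.contDiffAt.comp x hf
  have h2 := (alternatizationL E k).contDiff.contDiffAt.comp x h1
  refine h2.congr_of_eventuallyEq (.of_forall fun y => ?_)
  exact (alternatizationL_apply ((f y).compContinuousLinearMap (g y))).symm

end VectorSpace

theorem two_le_infty : (2 : ℕ∞ω) ≤ ∞ := by
  have : ((2 : ℕ∞) : ℕ∞ω) ≤ ((⊤ : ℕ∞) : ℕ∞ω) := WithTop.coe_le_coe.2 le_top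
  exact this

section Charts

variable {E : Type*} [NormedAddCommGroup E] [NormedSpace ℝ E]
  {H : Type*} [TopologicalSpace H] {I : ModelWithCorners ℝ E H} [I.Boundaryless]
  {M : Type*} [TopologicalSpace M] [ChartedSpace H M] [IsManifold I ∞ M]

theorem contMDiffAt_chart {x q : M} (hq : q ∈ (extChartAt I x).source) :
    ContMDiffAt I 𝓘(ℝ, E) ∞ (extChartAt I x) q :=
  contMDiffAt_extChartAt' (by simpa using hq)

theorem contMDiffAt_chart_symm {x : M} {y : E} (hy : y ∈ (extChartAt I x).target) :
    ContMDiffAt 𝓘(ℝ, E) I ∞ (extChartAt I x).symm y :=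
  (contMDiffOn_extChartAt_symm x).contMDiffAt ((isOpen_extChartAt_target x).mem_nhds hy)

theorem mdifferentiableAt_chart {x q : M} (hq : q ∈ (extChartAt I x).source) :
    MDifferentiableAt I 𝓘(ℝ, E) (extChartAt I x) q :=
  (contMDiffAt_chart hq).mdifferentiableAt (by simp)

theorem mdifferentiableAt_chart_symm {x : M} {y : E} (hy : y ∈ (extChartAt I x).target) :
    MDifferentiableAt 𝓘(ℝ, E) I (extChartAt I x).symm y :=
  (contMDiffAt_chart_symm hy).mdifferentiableAt (by simp)

theorem mfderiv_chart_symm_apply {x q : M} (hq : q ∈ (extChartAt I x).source)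
    (v : TangentSpace I q) :
    (mfderiv 𝓘(ℝ, E) I (extChartAt I x).symm (extChartAt I x q) : E → E)
      ((mfderiv I 𝓘(ℝ, E) (extChartAt I x) q : E → E) v) = v := by
  have h := mfderivWithin_extChartAt_symm_comp_mfderiv_extChartAt' (I := I) hq
  rw [I.range_eq_univ, mfderivWithin_univ] at h
  exact congrArg (fun L : E →L[ℝ] E => L v) h

theorem mfderiv_chart_apply {x : M} {y : E} (hy : y ∈ (extChartAt I x).target) (v : E) :
    (mfderiv I 𝓘(ℝ, E) (extChartAt I x) ((extChartAt I x).symm y) : E → E)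
      ((mfderiv 𝓘(ℝ, E) I (extChartAt I x).symm y : E → E) v) = v := by
  have h := mfderiv_extChartAt_comp_mfderivWithin_extChartAt_symm (I := I) hy
  rw [I.range_eq_univ, mfderivWithin_univ] at h
  exact congrArg (fun L : E →L[ℝ] E => L v) h

theorem mfderiv_chart_symm_self (x : M) :
    (mfderiv 𝓘(ℝ, E) I (extChartAt I x).symm (extChartAt I x x) : E →L[ℝ] E) = .id ℝ E := by
  have h := mfderivWithin_range_extChartAt_symm (I := I) (x := x)
  rw [I.range_eq_univ, mfderivWithin_univ] at h
  exact h

end Charts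


section Forms

variable {E : Type*} [NormedAddCommGroup E] [NormedSpace ℝ E]
  {H : Type*} [TopologicalSpace H] {I : ModelWithCorners ℝ E H} [I.Boundaryless]
  {M : Type*} [TopologicalSpace M] [ChartedSpace H M] [IsManifold I ∞ M]
  {E' : Type*} [NormedAddCommGroup E'] [NormedSpace ℝ E']
  {H' : Type*} [TopologicalSpace H'] {I' : ModelWithCorners ℝ E' H'} [I'.Boundaryless]
  {M' : Type*} [TopologicalSpace M'] [ChartedSpace H' M'] [IsManifold I' ∞ M']
  {k : ℕ}

variable (I) in
/-- The form `η` is smooth at the point `x`. -/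
def SmoothFormAt (η : DiffForm I M k) (x : M) : Prop :=
  ContDiffAt ℝ ∞ (inChart I η x) (extChartAt I x x)

/-- The map `f` in the preferred charts at `x` and `f x`. -/
theorem contDiffAt_writtenInExtChartAt {f : M → M'} {x : M} (hf : ContMDiffAt I I' ∞ f x) :
    ContDiffAt ℝ ∞ (writtenInExtChartAt I I' x f) (extChartAt I x x) := by
  have := (contMDiffAt_iff.1 hf).2
  rwa [I.range_eq_univ, contDiffWithinAt_univ] at this

theorem form_congr_point (η : DiffForm I' M' k) {p q : M'} (hpq : p = q) {A B : E →L[ℝ] E'}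
    (hAB : A = B) :
    (ContinuousAlternatingMap.compContinuousLinearMap (η p : E' [⋀^Fin k]→L[ℝ] ℝ) A) =
      ContinuousAlternatingMap.compContinuousLinearMap (η q : E' [⋀^Fin k]→L[ℝ] ℝ) B := by
  subst hpq hAB; rfl

theorem eventually_mdifferentiableAt {f : M → M'} {x : M} (hf : ContMDiffAt I I' ∞ f x) :
    ∀ᶠ q in 𝓝 x, MDifferentiableAt I I' f q := by
  have h1 : ContMDiffAt I I' 1 f x := hf.of_le (by simp)
  filter_upwards [(contMDiffAt_iff_contMDiffAt_nhds (by simp)).1 h1] with q hq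
  exact hq.mdifferentiableAt (by simp)

/-- Naturality of the local representation. -/
theorem inChart_pullbackForm {f : M → M'} {x : M} (hf : ContMDiffAt I I' ∞ f x)
    (η : DiffForm I' M' k) :
    inChart I (pullbackForm I I' f η) x =ᶠ[𝓝 (extChartAt I x x)] fun y =>
      (inChart I' η (f x) (writtenInExtChartAt I I' x f y)).compContinuousLinearMap
        (fderiv ℝ (writtenInExtChartAt I I' x f) y) := by
  have hφ : ContinuousAt (extChartAt I x).symm (extChartAt I x x) := continuousAt_extChartAt_symm x
  have hφx : (extChartAt I x).symm (extChartAt I x x) = x := extChartAt_to_inv x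
  have e1 : ∀ᶠ y in 𝓝 (extChartAt I x x), MDifferentiableAt I I' f ((extChartAt I x).symm y) :=
    hφ.eventually (by rw [hφx]; exact eventually_mdifferentiableAt hf)
  have e2 : ∀ᶠ y in 𝓝 (extChartAt I x x),
      f ((extChartAt I x).symm y) ∈ (extChartAt I' (f x)).source := by
    refine hφ.eventually (p := fun q => f q ∈ (extChartAt I' (f x)).source) ?_
    rw [hφx]
    exact hf.continuousAt (extChartAt_source_mem_nhds (f x))
  have e3 : ∀ᶠ y in 𝓝 (extChartAt I x x), y ∈ (extChartAt I x).target :=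
    extChartAt_target_mem_nhds x
  filter_upwards [e1, e2, e3, e2.eventually_nhds] with y h1 h2 h3 h4
  set q := (extChartAt I x).symm y with hq
  have hpt : f q = (extChartAt I' (f x)).symm (writtenInExtChartAt I I' x f y) := by
    exact ((extChartAt I' (f x)).left_inv h2).symm
  have hF : MDifferentiableAt 𝓘(ℝ, E) 𝓘(ℝ, E') (writtenInExtChartAt I I' x f) y :=
    (mdifferentiableAt_chart h2).comp y (h1.comp y (mdifferentiableAt_chart_symm h3))
  have ht : writtenInExtChartAt I I' x f y ∈ (extChartAt I' (f x)).target :=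
    (extChartAt I' (f x)).map_source h2
  have hev : (extChartAt I' (f x)).symm ∘ writtenInExtChartAt I I' x f =ᶠ[𝓝 y]
      f ∘ (extChartAt I x).symm := by
    filter_upwards [h4] with z hz
    exact (extChartAt I' (f x)).left_inv hz
  have hd := hev.mfderiv_eq (I := 𝓘(ℝ, E)) (I' := I')
  have ha := mfderiv_comp y (mdifferentiableAt_chart_symm ht) hF
  have hb := mfderiv_comp y h1 (mdifferentiableAt_chart_symm h3)
  have hc : @Eq (E →L[ℝ] E') (mfderiv 𝓘(ℝ, E) 𝓘(ℝ, E') (writtenInExtChartAt I I' x f) y)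
    (fderiv ℝ (writtenInExtChartAt I I' x f) y) :=
    mfderiv_eq_fderiv (E := E) (f := writtenInExtChartAt I I' x f) (x := y)
  have he : ∀ B : E' →L[ℝ] E', _ := fun B => congrArg (fun A : E →L[ℝ] E' => B.comp A) hc
  exact form_congr_point (E := E) (E' := E') η hpt ((hb.symm.trans hd.symm).trans (ha.trans (he _)))

theorem SmoothFormAt.pullback {f : M → M'} {x : M} (hf : ContMDiffAt I I' ∞ f x)
    {η : DiffForm I' M' k} (hη : SmoothFormAt I' η (f x)) :
    SmoothFormAt I (pullbackForm I I' f η) x := by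
  refine ContDiffAt.congr_of_eventuallyEq ?_ (inChart_pullbackForm hf η)
  have hF := contDiffAt_writtenInExtChartAt hf
  refine ContDiffAt.alternatingComp (f := fun y => inChart I' η (f x)
    (writtenInExtChartAt I I' x f y)) ?_ (hF.fderiv_right (by simp))
  refine ContDiffAt.comp (g := inChart I' η (f x)) _ ?_ hF
  have hFx : writtenInExtChartAt I I' x f (extChartAt I x x) = extChartAt I' (f x) (f x) := by
    simp [writtenInExtChartAt]
  rw [hFx]; exact hη

theorem extD_pullbackForm {f : M → M'} {x : M} (hf : ContMDiffAt I I' ∞ f x)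
    {η : DiffForm I' M' k} (hη : SmoothFormAt I' η (f x)) :
    extD I (pullbackForm I I' f η) x = pullbackForm I I' f (extD I' η) x := by
  have hF := contDiffAt_writtenInExtChartAt hf
  have hFx : writtenInExtChartAt I I' x f (extChartAt I x x) = extChartAt I' (f x) (f x) := by
    simp [writtenInExtChartAt]
  have hη' : DifferentiableAt ℝ (inChart I' η (f x))
      (writtenInExtChartAt I I' x f (extChartAt I x x)) := by
    rw [hFx]; exact hη.differentiableAt (by simp)
  unfold extD
  rw [(inChart_pullbackForm hf η).extDeriv_eq, extDeriv_pullback hη' hF (by simpa using two_le_infty), hFx]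
  have hmf : MDifferentiableAt I I' f x := hf.mdifferentiableAt (by simp)
  have key : (fderiv ℝ (writtenInExtChartAt I I' x f) (extChartAt I x x)).comp
      (mfderiv I 𝓘(ℝ, E) (extChartAt I x) x : E →L[ℝ] E) =
      ((mfderiv I' 𝓘(ℝ, E') (extChartAt I' (f x)) (f x) : E' →L[ℝ] E')).comp
        (mfderiv I I' f x : E →L[ℝ] E') := by
    have h1 : (mfderiv I 𝓘(ℝ, E) (extChartAt I x) x : E →L[ℝ] E) = .id ℝ E :=
      mfderiv_extChartAt_self
    have h2 : (mfderiv I' 𝓘(ℝ, E') (extChartAt I' (f x)) (f x) : E' →L[ℝ] E') = .id ℝ E' :=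
      mfderiv_extChartAt_self
    have h3 : (mfderiv I I' f x : E →L[ℝ] E') =
        fderiv ℝ (writtenInExtChartAt I I' x f) (extChartAt I x x) := by
      simp only [mfderiv, I.range_eq_univ, fderivWithin_univ]
      exact if_pos hmf
    rw [h1, h2, h3]
    rfl
  have := congrArg (fun A : E →L[ℝ] E' => ContinuousAlternatingMap.compContinuousLinearMap
    (extDeriv (inChart I' η (f x)) (extChartAt I' (f x) (f x))) A) key
  exact this

theorem inChart_add (η ζ : DiffForm I M k) (x : M) :
    inChart I (η + ζ) x = inChart I η x + inChart I ζ x := rfl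

theorem SmoothFormAt.add {η ζ : DiffForm I M k} {x : M} (hη : SmoothFormAt I η x)
    (hζ : SmoothFormAt I ζ x) : SmoothFormAt I (η + ζ) x :=
  ContDiffAt.add hη hζ

theorem SmoothFormAt.sub {η ζ : DiffForm I M k} {x : M} (hη : SmoothFormAt I η x)
    (hζ : SmoothFormAt I ζ x) : SmoothFormAt I (η - ζ) x :=
  ContDiffAt.sub hη hζ

theorem extD_add {η ζ : DiffForm I M k} {x : M} (hη : SmoothFormAt I η x)
    (hζ : SmoothFormAt I ζ x) : extD I (η + ζ) x = extD I η x + extD I ζ x := by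
  unfold extD
  rw [inChart_add, extDeriv_add (hη.differentiableAt (by simp)) (hζ.differentiableAt (by simp))]
  rfl

theorem extD_sub {η ζ : DiffForm I M k} {x : M} (hη : SmoothFormAt I η x)
    (hζ : SmoothFormAt I ζ x) : extD I (η - ζ) x = extD I η x - extD I ζ x := by
  have h1 : η = (η - ζ) + ζ := by simp
  conv_rhs => rw [h1, extD_add (hη.sub hζ) hζ]
  simp

theorem inChart_congr {η ζ : DiffForm I M k} {x : M} (h : ∀ᶠ q in 𝓝 x, η q = ζ q) :
    inChart I η x =ᶠ[𝓝 (extChartAt I x x)] inChart I ζ x := by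
  have hφ : ContinuousAt (extChartAt I x).symm (extChartAt I x x) := continuousAt_extChartAt_symm x
  have := hφ.eventually (p := fun q => η q = ζ q) (by rwa [extChartAt_to_inv x])
  filter_upwards [this] with y hy
  simp only [inChart, hy]

theorem SmoothFormAt.congr {η ζ : DiffForm I M k} {x : M} (hη : SmoothFormAt I η x)
    (h : ∀ᶠ q in 𝓝 x, ζ q = η q) : SmoothFormAt I ζ x :=
  ContDiffAt.congr_of_eventuallyEq hη (inChart_congr h)

theorem extD_congr {η ζ : DiffForm I M k} {x : M} (h : ∀ᶠ q in 𝓝 x, η q = ζ q) :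
    extD I η x = extD I ζ x := by
  unfold extD
  rw [(inChart_congr h).extDeriv_eq]

theorem isSmoothForm_iff {η : DiffForm I M k} : IsSmoothForm I η ↔ ∀ x, SmoothFormAt I η x :=
  ⟨fun h x => h x trivial, fun h x _ => h x⟩

end Forms

section Cotangent

variable {E : Type*} [NormedAddCommGroup E] [NormedSpace ℝ E]
  {H : Type*} [TopologicalSpace H] {I : ModelWithCorners ℝ E H} [I.Boundaryless]
  {Q : Type*} [TopologicalSpace Q] [ChartedSpace H Q] [IsManifold I ∞ Q]

variable (I) in
/-- The coordinates of the covector `u` in the chart at `q₀`. -/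
def cotCoord (q₀ : Q) (u : Cotangent I Q) : E × (E →L[ℝ] ℝ) :=
  (extChartAt I q₀ (proj I u), (fibre I u : E →L[ℝ] ℝ) ∘L
    (mfderiv 𝓘(ℝ, E) I (extChartAt I q₀).symm (extChartAt I q₀ (proj I u)) : E →L[ℝ] E))

variable (I) in
/-- The covector with given coordinates in the chart at `q₀`. -/
def cotMk (q₀ : Q) (z : E × (E →L[ℝ] ℝ)) : Cotangent I Q :=
  ⟨(extChartAt I q₀).symm z.1, z.2 ∘L
    (mfderiv I 𝓘(ℝ, E) (extChartAt I q₀) ((extChartAt I q₀).symm z.1) : E →L[ℝ] E)⟩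

theorem fibre_cotMk (q₀ : Q) (z : E × (E →L[ℝ] ℝ)) (v : E) :
    (fibre I (cotMk I q₀ z) : E → ℝ) v =
      z.2 ((mfderiv I 𝓘(ℝ, E) (extChartAt I q₀) ((extChartAt I q₀).symm z.1) : E → E) v) := rfl

theorem cotangent_ext {u w : Cotangent I Q} (h : proj I u = proj I w)
    (h' : ∀ v : E, (fibre I u : E → ℝ) v = (fibre I w : E → ℝ) v) : u = w := by
  obtain ⟨q, a⟩ := u
  obtain ⟨q', b⟩ := w
  change q = q' at h
  subst h
  congr 1
  exact ContinuousLinearMap.ext h'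

theorem cotCoord_cotMk {q₀ : Q} {z : E × (E →L[ℝ] ℝ)} (hz : z.1 ∈ (extChartAt I q₀).target) :
    cotCoord I q₀ (cotMk I q₀ z) = z := by
  refine Prod.ext ((extChartAt I q₀).right_inv hz) (ContinuousLinearMap.ext fun v => ?_)
  have h : extChartAt I q₀ ((extChartAt I q₀).symm z.1) = z.1 := (extChartAt I q₀).right_inv hz
  change z.2 ((mfderiv I 𝓘(ℝ, E) (extChartAt I q₀) ((extChartAt I q₀).symm z.1) : E → E)
    ((mfderiv 𝓘(ℝ, E) I (extChartAt I q₀).symm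
      (extChartAt I q₀ ((extChartAt I q₀).symm z.1)) : E → E) v)) = z.2 v
  rw [h]
  exact congrArg z.2 (mfderiv_chart_apply hz v)

theorem cotMk_cotCoord {q₀ : Q} {u : Cotangent I Q} (hu : proj I u ∈ (extChartAt I q₀).source) :
    cotMk I q₀ (cotCoord I q₀ u) = u := by
  have h : (extChartAt I q₀).symm (extChartAt I q₀ (proj I u)) = proj I u :=
    (extChartAt I q₀).left_inv hu
  refine cotangent_ext h fun v => ?_
  change (fibre I u : E → ℝ) ((mfderiv 𝓘(ℝ, E) I (extChartAt I q₀).symm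
      (extChartAt I q₀ (proj I u)) : E → E) ((mfderiv I 𝓘(ℝ, E) (extChartAt I q₀)
        ((extChartAt I q₀).symm (extChartAt I q₀ (proj I u))) : E → E) v)) = _
  rw [h]
  exact congrArg (fibre I u : E → ℝ) (mfderiv_chart_symm_apply hu v)

theorem extChartAt_cotangent_source (u₀ : Cotangent I Q) :
    (extChartAt (I.prod 𝓘(ℝ, E →L[ℝ] ℝ)) u₀).source =
      proj I ⁻¹' (extChartAt I (proj I u₀)).source := by
  ext u
  simp only [FiberBundle.chartedSpace_chartAt, proj, extChartAt_source, mem_preimage]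
  simp
  exact fun h => h

theorem extChartAt_cotangent_target (u₀ : Cotangent I Q) :
    (extChartAt (I.prod 𝓘(ℝ, E →L[ℝ] ℝ)) u₀).target =
      (extChartAt I (proj I u₀)).target ×ˢ univ := by
  rw [FiberBundle.extChartAt_target]
  ext z
  simp [proj]
  exact fun _ _ h => (chartAt H u₀.proj).map_target h

theorem extChartAt_cotangent {u₀ u : Cotangent I Q}
    (hu : proj I u ∈ (extChartAt I (proj I u₀)).source) :
    extChartAt (I.prod 𝓘(ℝ, E →L[ℝ] ℝ)) u₀ u = cotCoord I (proj I u₀) u := by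
  have hu' : u.proj ∈ (chartAt H u₀.proj).source := by simpa [proj] using hu
  rw [FiberBundle.extChartAt]
  simp only [PartialEquiv.coe_trans, Function.comp_apply, PartialEquiv.prod_coe,
    PartialEquiv.refl_coe, id_eq]
  refine Prod.ext rfl (ContinuousLinearMap.ext fun v => ?_)
  have h := TangentBundle.symmL_trivializationAt (I := I) hu'
  rw [I.range_eq_univ, mfderivWithin_univ] at h
  have h2 : ∀ (q : Q) (x : ℝ), (trivializationAt ℝ (Bundle.Trivial Q ℝ) u₀.proj).continuousLinearMapAt ℝ q x = x := by
    intro q x; simp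
  have h3 := congrArg (fun A : E →L[ℝ] E => (fibre I u : E → ℝ) (A v)) h
  exact (h2 _ _).trans h3

theorem extChartAt_cotangent_symm {u₀ : Cotangent I Q} {z : E × (E →L[ℝ] ℝ)}
    (hz : z.1 ∈ (extChartAt I (proj I u₀)).target) :
    (extChartAt (I.prod 𝓘(ℝ, E →L[ℝ] ℝ)) u₀).symm z = cotMk I (proj I u₀) z := by
  have h1 : cotMk I (proj I u₀) z ∈ (extChartAt (I.prod 𝓘(ℝ, E →L[ℝ] ℝ)) u₀).source := by
    rw [extChartAt_cotangent_source]
    exact (extChartAt I (proj I u₀)).map_target hz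
  have h2 : extChartAt (I.prod 𝓘(ℝ, E →L[ℝ] ℝ)) u₀ (cotMk I (proj I u₀) z) = z := by
    rw [extChartAt_cotangent ((extChartAt I (proj I u₀)).map_target hz), cotCoord_cotMk hz]
  conv_lhs => rw [← h2]
  exact PartialEquiv.left_inv _ h1

theorem contMDiffAt_cotCoord {q₀ : Q} {u : Cotangent I Q}
    (hu : proj I u ∈ (extChartAt I q₀).source) :
    ContMDiffAt (I.prod 𝓘(ℝ, E →L[ℝ] ℝ)) 𝓘(ℝ, E × (E →L[ℝ] ℝ)) ∞ (cotCoord I q₀) u := by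
  let u₀ : Cotangent I Q := ⟨q₀, (0 : E →L[ℝ] ℝ)⟩
  have h1 : u ∈ (extChartAt (I.prod 𝓘(ℝ, E →L[ℝ] ℝ)) u₀).source := by
    rw [extChartAt_cotangent_source]; exact hu
  have h := contMDiffAt_chart (I := I.prod 𝓘(ℝ, E →L[ℝ] ℝ)) h1
  refine h.congr_of_eventuallyEq ?_
  filter_upwards [(isOpen_extChartAt_source u₀).mem_nhds h1] with w hw
  rw [extChartAt_cotangent_source] at hw
  exact (extChartAt_cotangent (u₀ := u₀) hw).symm

theorem contMDiffAt_cotMk {q₀ : Q} {z : E × (E →L[ℝ] ℝ)} (hz : z.1 ∈ (extChartAt I q₀).target) :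
    ContMDiffAt 𝓘(ℝ, E × (E →L[ℝ] ℝ)) (I.prod 𝓘(ℝ, E →L[ℝ] ℝ)) ∞ (cotMk I q₀) z := by
  let u₀ : Cotangent I Q := ⟨q₀, (0 : E →L[ℝ] ℝ)⟩
  have h1 : z ∈ (extChartAt (I.prod 𝓘(ℝ, E →L[ℝ] ℝ)) u₀).target := by
    rw [extChartAt_cotangent_target]; exact ⟨hz, trivial⟩
  have h := contMDiffAt_chart_symm (I := I.prod 𝓘(ℝ, E →L[ℝ] ℝ)) h1
  refine h.congr_of_eventuallyEq ?_
  filter_upwards [(isOpen_extChartAt_target u₀).mem_nhds h1] with w hw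
  rw [extChartAt_cotangent_target] at hw
  exact (extChartAt_cotangent_symm (u₀ := u₀) hw.1).symm

theorem contMDiff_proj : ContMDiff (I.prod 𝓘(ℝ, E →L[ℝ] ℝ)) I ∞ (proj I (Q := Q)) :=
  Bundle.contMDiff_proj _

theorem cotCoord_self (u : Cotangent I Q) :
    cotCoord I (proj I u) u = (extChartAt I (proj I u) (proj I u), fibre I u) := by
  refine Prod.ext rfl ?_
  have := congrArg (fun A : E →L[ℝ] E => (fibre I u : E →L[ℝ] ℝ) ∘L A)
    (mfderiv_chart_symm_self (I := I) (proj I u))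
  exact this.trans (ContinuousLinearMap.comp_id _)

theorem extChartAt_cotangent_self (u : Cotangent I Q) :
    extChartAt (I.prod 𝓘(ℝ, E →L[ℝ] ℝ)) u u = (extChartAt I (proj I u) (proj I u), fibre I u) := by
  rw [extChartAt_cotangent (mem_extChartAt_source _), cotCoord_self]

/-- A map into the cotangent bundle is smooth if its coordinates are. -/
theorem contMDiffAt_cotangent_iff {E₁ H₁ X : Type*} [NormedAddCommGroup E₁] [NormedSpace ℝ E₁]
    [TopologicalSpace H₁] {I₁ : ModelWithCorners ℝ E₁ H₁} [TopologicalSpace X] [ChartedSpace H₁ X]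
    {f : X → Cotangent I Q} {x : X} {q₀ : Q}
    (hx : ∀ᶠ y in 𝓝 x, proj I (f y) ∈ (extChartAt I q₀).source) :
    ContMDiffAt I₁ (I.prod 𝓘(ℝ, E →L[ℝ] ℝ)) ∞ f x ↔
      ContMDiffAt I₁ 𝓘(ℝ, E × (E →L[ℝ] ℝ)) ∞ (fun y => cotCoord I q₀ (f y)) x := by
  refine ⟨fun h => (contMDiffAt_cotCoord hx.self_of_nhds).comp x h, fun h => ?_⟩
  have h1 := (contMDiffAt_cotMk (I := I) (q₀ := q₀) (z := cotCoord I q₀ (f x))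
    ((extChartAt I q₀).map_source hx.self_of_nhds)).comp x h
  refine h1.congr_of_eventuallyEq ?_
  filter_upwards [hx] with y hy using (cotMk_cotCoord hy).symm

theorem mfderiv_proj_cotMk {q₀ : Q} {z : E × (E →L[ℝ] ℝ)} (hz : z.1 ∈ (extChartAt I q₀).target) 
    (w : E × (E →L[ℝ] ℝ)) :
    (mfderiv (I.prod 𝓘(ℝ, E →L[ℝ] ℝ)) I (proj I (Q := Q)) (cotMk I q₀ z) : E × (E →L[ℝ] ℝ) → E)
      ((mfderiv 𝓘(ℝ, E × (E →L[ℝ] ℝ)) (I.prod 𝓘(ℝ, E →L[ℝ] ℝ)) (cotMk I q₀) z :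
        E × (E →L[ℝ] ℝ) → E × (E →L[ℝ] ℝ)) w) =
      (mfderiv 𝓘(ℝ, E) I (extChartAt I q₀).symm z.1 : E → E) w.1 := by
  have h1 := mfderiv_comp z ((contMDiff_proj (I := I) (Q := Q)).contMDiffAt.mdifferentiableAt
    (by simp)) ((contMDiffAt_cotMk (I := I) hz).mdifferentiableAt (by simp))
  have h2 := mfderiv_comp (I := 𝓘(ℝ, E × (E →L[ℝ] ℝ))) (I' := 𝓘(ℝ, E)) (I'' := I) z
    (f := (Prod.fst : E × (E →L[ℝ] ℝ) → E)) (mdifferentiableAt_chart_symm hz)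
    (ContinuousLinearMap.fst ℝ E (E →L[ℝ] ℝ)).mdifferentiableAt
  have h3 : proj I ∘ cotMk I q₀ = (extChartAt I q₀).symm ∘ Prod.fst := rfl
  have h4 : @Eq (E × (E →L[ℝ] ℝ) →L[ℝ] E)
      (mfderiv 𝓘(ℝ, E × (E →L[ℝ] ℝ)) 𝓘(ℝ, E) (Prod.fst : E × (E →L[ℝ] ℝ) → E) z)
      (.fst ℝ E (E →L[ℝ] ℝ)) := (ContinuousLinearMap.fst ℝ E (E →L[ℝ] ℝ)).mfderiv_eq
  rw [h3] at h1
  have h5 := congrArg (fun A : E × (E →L[ℝ] ℝ) →L[ℝ] E => A w) (h1.symm.trans h2)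
  have h6 := congrArg (fun A : E × (E →L[ℝ] ℝ) →L[ℝ] E => 
    (mfderiv 𝓘(ℝ, E) I (extChartAt I q₀).symm z.1 : E → E) (A w)) h4
  exact h5.trans h6

/-- The Liouville form in coordinates. -/
theorem inChart_liouville (u : Cotangent I Q) :
    inChart (I.prod 𝓘(ℝ, E →L[ℝ] ℝ)) (liouville I) u
      =ᶠ[𝓝 (extChartAt (I.prod 𝓘(ℝ, E →L[ℝ] ℝ)) u u)] fun z =>
      ContinuousAlternatingMap.ofSubsingleton ℝ (E × (E →L[ℝ] ℝ)) ℝ (0 : Fin 1)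
        (z.2 ∘L .fst ℝ E (E →L[ℝ] ℝ)) := by
  have ho := extChartAt_target_mem_nhds (I := I.prod 𝓘(ℝ, E →L[ℝ] ℝ)) u
  have ho' := (isOpen_extChartAt_target (I := I.prod 𝓘(ℝ, E →L[ℝ] ℝ)) u)
  filter_upwards [ho] with z hz
  have hev : (extChartAt (I.prod 𝓘(ℝ, E →L[ℝ] ℝ)) u).symm =ᶠ[𝓝 z] cotMk I (proj I u) := by
    filter_upwards [ho'.mem_nhds hz] with y hy
    rw [extChartAt_cotangent_target] at hy
    exact extChartAt_cotangent_symm hy.1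
  have hz' := hz
  rw [extChartAt_cotangent_target] at hz'
  ext v
  have h1 : inChart (I.prod 𝓘(ℝ, E →L[ℝ] ℝ)) (liouville I) u z v =
      liouville I (cotMk I (proj I u) z) (fun i =>
        (mfderiv 𝓘(ℝ, E × (E →L[ℝ] ℝ)) (I.prod 𝓘(ℝ, E →L[ℝ] ℝ)) (cotMk I (proj I u)) z :
        E × (E →L[ℝ] ℝ) → E × (E →L[ℝ] ℝ)) (v i)) := by
    have := form_congr_point (E := E × (E →L[ℝ] ℝ)) (E' := E × (E →L[ℝ] ℝ))
      (liouville I) hev.self_of_nhds (hev.mfderiv_eq (I := 𝓘(ℝ, E × (E →L[ℝ] ℝ)))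
      (I' := I.prod 𝓘(ℝ, E →L[ℝ] ℝ)))
    exact congrArg (fun A : (E × (E →L[ℝ] ℝ)) [⋀^Fin 1]→L[ℝ] ℝ => A v) this
  rw [h1]
  have h2 := mfderiv_proj_cotMk (I := I) hz'.1 (v 0)
  change (fibre I (cotMk I (proj I u) z) : E → ℝ) _ = z.2 (v 0).1
  refine (fibre_cotMk _ _ _).trans ?_
  have h3 := congrArg (fun x : E => z.2 ((mfderiv I 𝓘(ℝ, E) (extChartAt I (proj I u))
    ((extChartAt I (proj I u)).symm z.1) : E → E) x)) h2
  exact h3.trans (congrArg z.2 (mfderiv_chart_apply hz'.1 _))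

theorem smoothFormAt_liouville (u : Cotangent I Q) :
    SmoothFormAt (I.prod 𝓘(ℝ, E →L[ℝ] ℝ)) (liouville I) u := by
  refine ContDiffAt.congr_of_eventuallyEq ?_ (inChart_liouville u)
  have h : ContDiff ℝ ∞ fun z : E × (E →L[ℝ] ℝ) => z.2 ∘L .fst ℝ E (E →L[ℝ] ℝ) := by fun_prop
  exact ((ContinuousAlternatingMap.ofSubsingletonLIE (𝕜 := ℝ) (E := E × (E →L[ℝ] ℝ)) (F := ℝ)
    (0 : Fin 1)).toContinuousLinearEquiv.contDiff.comp h).contDiffAt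

theorem mfderiv_proj_self (u : Cotangent I Q) (w : E × (E →L[ℝ] ℝ)) :
    (mfderiv (I.prod 𝓘(ℝ, E →L[ℝ] ℝ)) I (proj I (Q := Q)) u : E × (E →L[ℝ] ℝ) → E) w = w.1 := by
  have h1 : MDifferentiableAt (I.prod 𝓘(ℝ, E →L[ℝ] ℝ)) I (proj I (Q := Q)) u :=
    contMDiff_proj.contMDiffAt.mdifferentiableAt (by simp)
  have h2 : writtenInExtChartAt (I.prod 𝓘(ℝ, E →L[ℝ] ℝ)) I u (proj I (Q := Q))
      =ᶠ[𝓝 (extChartAt (I.prod 𝓘(ℝ, E →L[ℝ] ℝ)) u u)] Prod.fst := by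
    filter_upwards [extChartAt_target_mem_nhds (I := I.prod 𝓘(ℝ, E →L[ℝ] ℝ)) u] with z hz
    rw [extChartAt_cotangent_target] at hz
    change extChartAt I (proj I u) (proj I ((extChartAt (I.prod 𝓘(ℝ, E →L[ℝ] ℝ)) u).symm z)) = _
    rw [extChartAt_cotangent_symm hz.1]
    exact (extChartAt I (proj I u)).right_inv hz.1
  have h3 : @Eq (E × (E →L[ℝ] ℝ) →L[ℝ] E)
      (mfderiv (I.prod 𝓘(ℝ, E →L[ℝ] ℝ)) I (proj I (Q := Q)) u) (.fst ℝ E (E →L[ℝ] ℝ)) := by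
    unfold mfderiv
    refine (if_pos h1).trans ?_
    rw [ModelWithCorners.range_eq_univ, fderivWithin_univ, h2.fderiv_eq]
    exact fderiv_fst
  exact congrArg (fun A : E × (E →L[ℝ] ℝ) →L[ℝ] E => A w) h3

theorem extDeriv_two_apply {E : Type*} [NormedAddCommGroup E] [NormedSpace ℝ E]
    {ζ : E → E [⋀^Fin 1]→L[ℝ] ℝ} {x : E} (h : DifferentiableAt ℝ ζ x) (v w : E) :
    extDeriv ζ x ![v, w] = fderiv ℝ (fun y => ζ y ![w]) x v - fderiv ℝ (fun y => ζ y ![v]) x w := by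
  rw [extDeriv_apply h]
  have h0 : (0 : Fin 2).removeNth ![v, w] = ![w] := by ext i; fin_cases i; rfl
  have h1 : (1 : Fin 2).removeNth ![v, w] = ![v] := by ext i; fin_cases i; rfl
  simp [Fin.sum_univ_two, h0, h1, sub_eq_add_neg]

theorem extD_apply_self {H M : Type*} [TopologicalSpace H] {I : ModelWithCorners ℝ E H}
    [TopologicalSpace M] [ChartedSpace H M] [I.Boundaryless] [IsManifold I ∞ M] {k : ℕ}
    (η : DiffForm I M k) (x : M) :
    @Eq (E [⋀^Fin (k + 1)]→L[ℝ] ℝ) (extD I η x)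
      (extDeriv (inChart I η x) (extChartAt I x x)) := by
  have h1 : (mfderiv I 𝓘(ℝ, E) (extChartAt I x) x : E →L[ℝ] E) = .id ℝ E :=
    mfderiv_extChartAt_self
  exact congrArg (fun A : E →L[ℝ] E => ContinuousAlternatingMap.compContinuousLinearMap
    (extDeriv (inChart I η x) (extChartAt I x x)) A) h1

theorem extD_liouville (u : Cotangent I Q) (v w : E × (E →L[ℝ] ℝ)) :
    (extD (I.prod 𝓘(ℝ, E →L[ℝ] ℝ)) (liouville I) u : (E × (E →L[ℝ] ℝ)) [⋀^Fin 2]→L[ℝ] ℝ) ![v, w] =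
      v.2 w.1 - w.2 v.1 := by
  have h0 := (inChart_liouville u).extDeriv_eq
  have h := smoothFormAt_liouville u
  have hd := ((inChart_liouville u).differentiableAt_iff).1 (h.differentiableAt (by simp))
  have h1 := extDeriv_two_apply hd v w
  have h2 : ∀ v w : E × (E →L[ℝ] ℝ), fderiv ℝ (fun z : E × (E →L[ℝ] ℝ) =>
      ContinuousAlternatingMap.ofSubsingleton ℝ (E × (E →L[ℝ] ℝ)) ℝ (0 : Fin 1)
        (z.2 ∘L .fst ℝ E (E →L[ℝ] ℝ)) ![w])
        (extChartAt (I.prod 𝓘(ℝ, E →L[ℝ] ℝ)) u u) v = v.2 w.1 := fun v w => by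
    have : HasFDerivAt (fun z : E × (E →L[ℝ] ℝ) => z.2 w.1)
        ((ContinuousLinearMap.apply ℝ ℝ w.1) ∘L .snd ℝ E (E →L[ℝ] ℝ))
        (extChartAt (I.prod 𝓘(ℝ, E →L[ℝ] ℝ)) u u) :=
      ((ContinuousLinearMap.apply ℝ ℝ w.1) ∘L .snd ℝ E (E →L[ℝ] ℝ)).hasFDerivAt
    exact congrArg (fun A : E × (E →L[ℝ] ℝ) →L[ℝ] ℝ => A v) this.fderiv
  rw [h2, h2, ← h0] at h1
  rw [extD_apply_self]
  exact h1

theorem liouville_apply (u : Cotangent I Q) (v : E × (E →L[ℝ] ℝ)) :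
    (liouville I u : (E × (E →L[ℝ] ℝ)) [⋀^Fin 1]→L[ℝ] ℝ) ![v] = (fibre I u : E → ℝ) v.1 :=
  congrArg (fibre I u : E → ℝ) (mfderiv_proj_self u v)

end Cotangent

section Derivative

variable {E₁ E₂ E₃ H₁ H₂ H₃ X Y Z : Type*}
  [NormedAddCommGroup E₁] [NormedSpace ℝ E₁] [NormedAddCommGroup E₂] [NormedSpace ℝ E₂]
  [NormedAddCommGroup E₃] [NormedSpace ℝ E₃] [TopologicalSpace H₁] [TopologicalSpace H₂]
  [TopologicalSpace H₃] {I₁ : ModelWithCorners ℝ E₁ H₁} {I₂ : ModelWithCorners ℝ E₂ H₂}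
  {I₃ : ModelWithCorners ℝ E₃ H₃} [TopologicalSpace X] [ChartedSpace H₁ X]
  [TopologicalSpace Y] [ChartedSpace H₂ Y] [TopologicalSpace Z] [ChartedSpace H₃ Z]

variable (I₁ I₂) in
/-- The derivative, as a linear map between the model spaces. -/
def md (f : X → Y) (x : X) : E₁ →L[ℝ] E₂ := mfderiv I₁ I₂ f x

theorem md_comp {f : X → Y} {g : Y → Z} {x : X} (hg : MDifferentiableAt I₂ I₃ g (f x))
    (hf : MDifferentiableAt I₁ I₂ f x) :
    md I₁ I₃ (g ∘ f) x = (md I₂ I₃ g (f x)).comp (md I₁ I₂ f x) :=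
  mfderiv_comp x hg hf

theorem md_congr {f g : X → Y} {x : X} (h : f =ᶠ[𝓝 x] g) : md I₁ I₂ f x = md I₁ I₂ g x :=
  h.mfderiv_eq

theorem md_eq_fderiv (f : E₁ → E₂) (x : E₁) : md 𝓘(ℝ, E₁) 𝓘(ℝ, E₂) f x = fderiv ℝ f x :=
  mfderiv_eq_fderiv

theorem md_id (x : X) : md I₁ I₁ (id : X → X) x = .id ℝ E₁ := mfderiv_id

theorem md_chart_comp_symm [I₁.Boundaryless] [IsManifold I₁ ∞ X] {x : X} {y : E₁}
    (hy : y ∈ (extChartAt I₁ x).target) (v : E₁) :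
    md I₁ 𝓘(ℝ, E₁) (extChartAt I₁ x) ((extChartAt I₁ x).symm y)
      (md 𝓘(ℝ, E₁) I₁ (extChartAt I₁ x).symm y v) = v := mfderiv_chart_apply hy v

theorem md_symm_comp_chart [I₁.Boundaryless] [IsManifold I₁ ∞ X] {x q : X}
    (hq : q ∈ (extChartAt I₁ x).source) (v : E₁) :
    md 𝓘(ℝ, E₁) I₁ (extChartAt I₁ x).symm (extChartAt I₁ x q)
      (md I₁ 𝓘(ℝ, E₁) (extChartAt I₁ x) q v) = v := mfderiv_chart_symm_apply hq v

end Derivative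

section Bilinear

variable {E : Type*} [NormedAddCommGroup E] [NormedSpace ℝ E] [FiniteDimensional ℝ E]
  {B : E →L[ℝ] E →L[ℝ] ℝ}

theorem isInvertible_of_pos (hB : ∀ v, v ≠ 0 → 0 < B v v) : B.IsInvertible := by
  have hA : Function.Injective B := by
    rw [injective_iff_map_eq_zero]
    intro v hv
    by_contra hne
    have := hB v hne
    simp [hv] at this
  have hfin : Module.finrank ℝ E = Module.finrank ℝ (E →L[ℝ] ℝ) := by
    rw [← LinearMap.toContinuousLinearMap.finrank_eq]
    exact (Subspace.dual_finrank_eq (K := ℝ) (V := E)).symm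
  exact ⟨(LinearEquiv.ofInjectiveOfFinrankEq B.toLinearMap hA hfin).toContinuousLinearEquiv,
    by ext v; rfl⟩

theorem apply_inverse_apply (hB : ∀ v, v ≠ 0 → 0 < B v v) (u : E →L[ℝ] ℝ) :
    B (B.inverse u) = u := by
  obtain ⟨e, he⟩ := isInvertible_of_pos hB
  rw [← he]; simp

theorem inverse_apply_eq (hB : ∀ v, v ≠ 0 → 0 < B v v) {u : E →L[ℝ] ℝ} {v : E} (h : B v = u) :
    B.inverse u = v := by
  obtain ⟨e, he⟩ := isInvertible_of_pos hB
  rw [← h, ← he]; simp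

theorem bilin_nonneg (hB : ∀ v, v ≠ 0 → 0 < B v v) (v : E) : 0 ≤ B v v := by
  by_cases h : v = 0
  · simp [h]
  · exact (hB v h).le

theorem bilin_cauchy_schwarz (hB : ∀ v, v ≠ 0 → 0 < B v v) (hs : ∀ v w, B v w = B w v) (v w : E) :
    (B v w) ^ 2 ≤ B v v * B w w := by
  by_cases h : w = 0
  · simp [h]
  have hw := hB w h
  have h1 := bilin_nonneg hB (B w w • v - B v w • w)
  simp only [map_sub, map_smul, _root_.sub_apply, _root_.smul_apply,
    smul_eq_mul, hs w v] at h1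
  have h2 : 0 ≤ B w w * (B v v * B w w - (B v w) ^ 2) := by nlinarith
  have := nonneg_of_mul_nonneg_right h2 hw
  linarith

/-- The square of the dual norm. -/
theorem dual_nonneg (hB : ∀ v, v ≠ 0 → 0 < B v v) (u : E →L[ℝ] ℝ) : 0 ≤ u (B.inverse u) := by
  have h := bilin_nonneg hB (B.inverse u)
  rwa [apply_inverse_apply hB] at h

theorem dual_pos (hB : ∀ v, v ≠ 0 → 0 < B v v) {u : E →L[ℝ] ℝ} (hu : u ≠ 0) :
    0 < u (B.inverse u) := by
  have h1 := apply_inverse_apply hB u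
  have h := hB (B.inverse u) (by intro h0; rw [h0] at h1; simp at h1; exact hu h1.symm)
  rwa [h1] at h

theorem dual_apply_sq_le (hB : ∀ v, v ≠ 0 → 0 < B v v) (hs : ∀ v w, B v w = B w v)
    (u : E →L[ℝ] ℝ) (v : E) : (u v) ^ 2 ≤ u (B.inverse u) * B v v := by
  have h := bilin_cauchy_schwarz hB hs (B.inverse u) v
  rwa [apply_inverse_apply hB] at h

theorem dual_le_of_apply_le (hB : ∀ v, v ≠ 0 → 0 < B v v) {u : E →L[ℝ] ℝ} {C : ℝ} (hC : 0 ≤ C)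
    (h : ∀ v, (u v) ^ 2 ≤ C * B v v) : u (B.inverse u) ≤ C := by
  have h1 := h (B.inverse u)
  rw [apply_inverse_apply hB] at h1
  rcases (dual_nonneg hB u).eq_or_lt with h0 | h0
  · rwa [← h0]
  · nlinarith

end Bilinear

theorem contDiff_precomp {E E₁ : Type*} [NormedAddCommGroup E] [NormedSpace ℝ E]
    [NormedAddCommGroup E₁] [NormedSpace ℝ E₁] : ContDiff ℝ ∞ fun A : E₁ →L[ℝ] E =>
      (ContinuousLinearMap.precomp ℝ A : (E →L[ℝ] ℝ) →L[ℝ] (E₁ →L[ℝ] ℝ)) := by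
  have h : IsBoundedLinearMap ℝ fun A : E₁ →L[ℝ] E =>
      (ContinuousLinearMap.precomp ℝ A : (E →L[ℝ] ℝ) →L[ℝ] (E₁ →L[ℝ] ℝ)) :=
    ⟨⟨fun A B => by ext; simp, fun c A => by ext; simp⟩, 1, one_pos, fun A => by
      rw [one_mul]
      refine ContinuousLinearMap.opNorm_le_bound _ (norm_nonneg _) fun u => ?_
      rw [mul_comm]
      exact u.opNorm_comp_le A⟩
  exact h.contDiff

section Metric

variable {E : Type*} [NormedAddCommGroup E] [NormedSpace ℝ E] [FiniteDimensional ℝ E]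
  {H : Type*} [TopologicalSpace H] {I : ModelWithCorners ℝ E H} [I.Boundaryless]
  {Q : Type*} [TopologicalSpace Q] [ChartedSpace H Q] [IsManifold I ∞ Q]
  {Q' : Type*} [TopologicalSpace Q'] [ChartedSpace H Q'] [IsManifold I ∞ Q']
  {E₁ : Type*} [NormedAddCommGroup E₁] [NormedSpace ℝ E₁]

/-- The bilinear form at a point, on the model space. -/
def bil (b : ∀ x : Q, TangentSpace I x →L[ℝ] TangentSpace I x →L[ℝ] ℝ) (x : Q) :
    E →L[ℝ] E →L[ℝ] ℝ := b x

variable (I) in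
/-- The pull-back of a field of bilinear forms to a vector space. -/
def gram (b : ∀ x : Q, TangentSpace I x →L[ℝ] TangentSpace I x →L[ℝ] ℝ) (F : E₁ → Q) (y : E₁) :
    E₁ →L[ℝ] E₁ →L[ℝ] ℝ :=
  (ContinuousLinearMap.precomp ℝ (md 𝓘(ℝ, E₁) I F y)) ∘L (bil b (F y)) ∘L
    (md 𝓘(ℝ, E₁) I F y)

theorem gram_apply (b : ∀ x : Q, TangentSpace I x →L[ℝ] TangentSpace I x →L[ℝ] ℝ) (F : E₁ → Q)
    (y v w : E₁) : gram I b F y v w =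
      bil b (F y) (md 𝓘(ℝ, E₁) I F y v) (md 𝓘(ℝ, E₁) I F y w) := rfl

variable (I) in
/-- A smooth field of scalar products. -/
structure IsMetric (b : ∀ x : Q, TangentSpace I x →L[ℝ] TangentSpace I x →L[ℝ] ℝ) : Prop where
  symm : ∀ x v w, bil b x v w = bil b x w v
  pos : ∀ x v, v ≠ 0 → 0 < bil b x v v
  smooth : ∀ x : Q, ContDiffOn ℝ ∞ (gram I b (extChartAt I x).symm) (extChartAt I x).target

theorem ContMDiffAt.eventually_mdiff {E₂ H₂ X : Type*} [NormedAddCommGroup E₂] [NormedSpace ℝ E₂]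
    [TopologicalSpace H₂] {I₂ : ModelWithCorners ℝ E₂ H₂} [TopologicalSpace X]
    [ChartedSpace H₂ X] [IsManifold I₂ ∞ X] {f : X → Q} {x : X} [I₂.Boundaryless]
    (h : ContMDiffAt I₂ I ∞ f x) :
    ∀ᶠ y in 𝓝 x, MDifferentiableAt I₂ I f y := eventually_mdifferentiableAt h

theorem contDiffAt_gram {b : ∀ x : Q, TangentSpace I x →L[ℝ] TangentSpace I x →L[ℝ] ℝ}
    (hb : IsMetric I b) {F : E₁ → Q} {y : E₁} (hF : ContMDiffAt 𝓘(ℝ, E₁) I ∞ F y) :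
    ContDiffAt ℝ ∞ (gram I b F) y := by
  let φ := extChartAt I (F y)
  have hsrc : ∀ᶠ z in 𝓝 y, F z ∈ φ.source :=
    hF.continuousAt (extChartAt_source_mem_nhds (F y))
  have hG : ContDiffAt ℝ ∞ (φ ∘ F) y :=
    ((contMDiffAt_chart (mem_extChartAt_source (F y))).comp y hF).contDiffAt
  have hev : gram I b F =ᶠ[𝓝 y] fun z =>
      (ContinuousLinearMap.precomp ℝ (fderiv ℝ (φ ∘ F) z)) ∘L
        (gram I b φ.symm ((φ ∘ F) z)) ∘L (fderiv ℝ (φ ∘ F) z) := by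
    filter_upwards [hsrc, hF.eventually_mdiff] with z hz hd
    have h1 : fderiv ℝ (φ ∘ F) z = (md I 𝓘(ℝ, E) φ (F z)).comp (md 𝓘(ℝ, E₁) I F z) := by
      rw [← md_eq_fderiv, md_comp (mdifferentiableAt_chart hz) hd]
    ext v w
    rw [h1]
    change _ = bil b (φ.symm (φ (F z))) (md 𝓘(ℝ, E) I φ.symm (φ (F z)) (md I 𝓘(ℝ, E) φ (F z) _))
      (md 𝓘(ℝ, E) I φ.symm (φ (F z)) (md I 𝓘(ℝ, E) φ (F z) _))
    rw [md_symm_comp_chart hz, md_symm_comp_chart hz, φ.left_inv hz, gram_apply]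
    rfl
  refine ContDiffAt.congr_of_eventuallyEq ?_ hev
  have hG' : ContDiffAt ℝ ∞ (fderiv ℝ (φ ∘ F)) y := hG.fderiv_right (by simp)
  have h2 : ContDiffAt ℝ ∞ (fun z => gram I b φ.symm ((φ ∘ F) z)) y := by
    refine ContDiffAt.comp (g := gram I b φ.symm) y ?_ hG
    exact (hb.smooth (F y)).contDiffAt ((isOpen_extChartAt_target _).mem_nhds
      (φ.map_source (mem_extChartAt_source (F y))))
  exact ContDiffAt.clm_comp (contDiff_precomp.contDiffAt.comp y hG')
    (h2.clm_comp hG')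

theorem isMetric_inner (h : RiemMetric I Q) : IsMetric I h.inner where
  symm := h.symm
  pos := h.pos
  smooth q₀ := by
    rw [contDiffOn_clm_apply]
    intro v
    rw [contDiffOn_clm_apply]
    intro w y hy
    have hφ := contMDiffAt_chart_symm (I := I) hy
    have hs : ∀ v : E, ContMDiffAt 𝓘(ℝ, E) I.tangent ∞ (fun z => (Bundle.TotalSpace.mk' E
        ((extChartAt I q₀).symm z) (md 𝓘(ℝ, E) I (extChartAt I q₀).symm z v :
          TangentSpace I ((extChartAt I q₀).symm z)) : TangentBundle I Q)) y := by
      intro v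
      have hmem : ∀ z ∈ (extChartAt I q₀).target,
          (extChartAt I q₀).symm z ∈ (chartAt H q₀).source := fun z hz => by
        simpa using (extChartAt I q₀).map_target hz
      rw [Bundle.Trivialization.contMDiffAt_iff (e := trivializationAt E (TangentSpace I) q₀)
        (by rw [Bundle.Trivialization.mem_source]; exact hmem y hy)]
      refine ⟨hφ, ?_⟩
      refine (contMDiffAt_const (c := v)).congr_of_eventuallyEq ?_
      filter_upwards [(isOpen_extChartAt_target q₀).mem_nhds hy] with z hz
      have h1 := TangentBundle.continuousLinearMapAt_trivializationAt (I := I) (hmem z hz)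
      have h2 := congrArg (fun A : E →L[ℝ] E => A (md 𝓘(ℝ, E) I (extChartAt I q₀).symm z v)) h1
      refine Eq.trans ?_ (h2.trans (md_chart_comp_symm hz v))
      exact (Bundle.Trivialization.continuousLinearMapAt_apply_of_mem ℝ _ (hmem z hz) _).symm
    have hg : ContMDiffAt 𝓘(ℝ, E) (I.prod 𝓘(ℝ, E →L[ℝ] E →L[ℝ] ℝ)) ∞
        (fun z => Bundle.TotalSpace.mk' (E →L[ℝ] E →L[ℝ] ℝ)
          (E := fun x : Q => TangentSpace I x →L[ℝ] TangentSpace I x →L[ℝ] ℝ)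
          ((extChartAt I q₀).symm z) (h.inner ((extChartAt I q₀).symm z))) y :=
      (h.contMDiff _).comp y hφ
    have := ContMDiffAt.clm_bundle_apply₂ (E₃ := fun (_ : Q) => ℝ) (F₃ := ℝ) hg (hs v) (hs w)
    rw [Bundle.contMDiffAt_totalSpace] at this
    exact this.2.contDiffAt.contDiffWithinAt

theorem isMetric_pullback {b : ∀ x : Q, TangentSpace I x →L[ℝ] TangentSpace I x →L[ℝ] ℝ}
    (hb : IsMetric I b) {μ : Q' → Q} (hμ : IsLocalDiffeomorph I I ∞ μ) :
    IsMetric I (pullbackMetric I μ b) where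
  symm x v w := hb.symm _ _ _
  pos x v hv := by
    refine hb.pos _ _ fun h0 => hv ?_
    have := (hμ.mfderivToContinuousLinearEquiv (by simp) x).injective
    exact this (h0.trans (map_zero _).symm)
  smooth q₀ := by
    intro y hy
    refine ContDiffAt.contDiffWithinAt ?_
    have hc := contMDiffAt_chart_symm (I := I) hy
    refine (contDiffAt_gram hb ((hμ.contMDiff _).comp y hc)).congr_of_eventuallyEq ?_
    filter_upwards [(isOpen_extChartAt_target q₀).mem_nhds hy] with z hz
    ext v w
    rw [gram_apply, gram_apply, md_comp ((hμ.contMDiff _).mdifferentiableAt (by simp))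
      (mdifferentiableAt_chart_symm hz)]
    rfl

end Metric

section Bilinear

variable {E E₁ : Type*} [NormedAddCommGroup E] [NormedSpace ℝ E] [FiniteDimensional ℝ E]
  [NormedAddCommGroup E₁] [NormedSpace ℝ E₁] [FiniteDimensional ℝ E₁]
  {B : E →L[ℝ] E →L[ℝ] ℝ}

theorem dual_symm (hB : ∀ v, v ≠ 0 → 0 < B v v) (hs : ∀ v w, B v w = B w v) (u w : E →L[ℝ] ℝ) :
    u (B.inverse w) = w (B.inverse u) := by
  have h := hs (B.inverse u) (B.inverse w)
  rwa [apply_inverse_apply hB, apply_inverse_apply hB] at h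

theorem dual_pullback (hB : ∀ v, v ≠ 0 → 0 < B v v) {A : E₁ →L[ℝ] E} {A' : E →L[ℝ] E₁}
    (hA : ∀ v, A (A' v) = v) (hA' : ∀ v, A' (A v) = v) {p : E₁ →L[ℝ] ℝ} :
    p (((ContinuousLinearMap.precomp ℝ A) ∘L B ∘L A).inverse p) =
      (p ∘L A') (B.inverse (p ∘L A')) := by
  have h1 : ((ContinuousLinearMap.precomp ℝ A) ∘L B ∘L A).inverse p =
      A' (B.inverse (p ∘L A')) := by
    refine inverse_apply_eq (B := (ContinuousLinearMap.precomp ℝ A) ∘L B ∘L A) ?_ ?_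
    · intro v hv
      refine hB (A v) fun h => hv ?_
      rw [← hA' v, h, map_zero]
    · ext v
      change B (A (A' (B.inverse (p ∘L A')))) (A v) = p v
      rw [hA, apply_inverse_apply hB]
      change p (A' (A v)) = _
      rw [hA']
  rw [h1]; rfl

end Bilinear

section Energy

variable {E : Type*} [NormedAddCommGroup E] [NormedSpace ℝ E] [FiniteDimensional ℝ E]
  {H : Type*} [TopologicalSpace H] {I : ModelWithCorners ℝ E H} [I.Boundaryless]
  {Q : Type*} [TopologicalSpace Q] [ChartedSpace H Q] [IsManifold I ∞ Q]
  {Q' : Type*} [TopologicalSpace Q'] [ChartedSpace H Q'] [IsManifold I ∞ Q']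

variable (I) in
/-- The Hamiltonian belonging to a field of scalar products and a potential. -/
def energy (b : ∀ x : Q, TangentSpace I x →L[ℝ] TangentSpace I x →L[ℝ] ℝ) (V : Q → ℝ)
    (u : Cotangent I Q) : ℝ :=
  1 / 2 * covectorNormSq I (b (proj I u)) (fibre I u) + V (proj I u)

/-- The fibre of a covector, on the model space. -/
def fib (u : Cotangent I Q) : E →L[ℝ] ℝ := fibre I u

theorem energy_eq (b : ∀ x : Q, TangentSpace I x →L[ℝ] TangentSpace I x →L[ℝ] ℝ) (V : Q → ℝ)
    (u : Cotangent I Q) : energy I b V u =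
      1 / 2 * fib u ((bil b (proj I u)).inverse (fib u)) + V (proj I u) := rfl

variable {b : ∀ x : Q, TangentSpace I x →L[ℝ] TangentSpace I x →L[ℝ] ℝ}

theorem md_inverse_apply {μ : Q' → Q} (hμ : IsLocalDiffeomorph I I ∞ μ) (x : Q') (v : E) :
    md I I μ x ((md I I μ x).inverse v) = v ∧ (md I I μ x).inverse (md I I μ x v) = v := by
  have h : (md I I μ x).IsInvertible := ⟨hμ.mfderivToContinuousLinearEquiv (by simp) x, rfl⟩
  obtain ⟨e, he⟩ := h
  rw [← he]; simp

theorem liftedHamiltonian_eq_energy (h : RiemMetric I Q) (V : Q → ℝ) {μ : Q' → Q}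
    (hμ : IsLocalDiffeomorph I I ∞ μ) :
    liftedHamiltonian I μ h V = energy I (pullbackMetric I μ h.inner) (V ∘ μ) := by
  funext u
  have h1 := dual_pullback (E := E) (E₁ := E) (B := bil h.inner (μ (proj I u))) (h.pos _)
    (fun v => (md_inverse_apply hμ (proj I u) v).1) (fun v => (md_inverse_apply hμ (proj I u) v).2)
    (p := fib u)
  have h2 : liftedHamiltonian I μ h V u = 1 / 2 * ((fib u ∘L (md I I μ (proj I u)).inverse)
    ((bil h.inner (μ (proj I u))).inverse (fib u ∘L (md I I μ (proj I u)).inverse))) +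
      V (μ (proj I u)) := rfl
  rw [h2, ← h1]
  rfl

theorem gram_pos (hb : IsMetric I b) {q₀ : Q} {x : E} (hx : x ∈ (extChartAt I q₀).target)
    (v : E) (hv : v ≠ 0) : 0 < gram I b (extChartAt I q₀).symm x v v := by
  refine hb.pos _ _ fun h => hv ?_
  rw [← md_chart_comp_symm (I₁ := I) hx v]
  exact (congrArg _ h).trans (map_zero _)

theorem energy_cotMk (hb : IsMetric I b) (V : Q → ℝ) {q₀ : Q} {z : E × (E →L[ℝ] ℝ)}
    (hz : z.1 ∈ (extChartAt I q₀).target) :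
    energy I b V (cotMk I q₀ z) =
      1 / 2 * z.2 ((gram I b (extChartAt I q₀).symm z.1).inverse z.2) +
        V ((extChartAt I q₀).symm z.1) := by
  have h1 := dual_pullback (E := E) (E₁ := E) (B := bil b ((extChartAt I q₀).symm z.1)) (hb.pos _)
    (A := md 𝓘(ℝ, E) I (extChartAt I q₀).symm z.1)
    (A' := md I 𝓘(ℝ, E) (extChartAt I q₀) ((extChartAt I q₀).symm z.1))
    (fun v => by
      have := md_symm_comp_chart ((extChartAt I q₀).map_target hz) v
      rwa [(extChartAt I q₀).right_inv hz] at this)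
    (fun v => md_chart_comp_symm hz v) (p := z.2)
  have h2 : gram I b (extChartAt I q₀).symm z.1 = _ := rfl
  rw [gram, h1]
  rfl

/-- The Hamiltonian in coordinates. -/
theorem contDiffAt_energy_coord (hb : IsMetric I b) {V : Q → ℝ}
    (hV : ContMDiff I 𝓘(ℝ, ℝ) ∞ V) {q₀ : Q} {z : E × (E →L[ℝ] ℝ)}
    (hz : z.1 ∈ (extChartAt I q₀).target) :
    ContDiffAt ℝ ∞ (fun z : E × (E →L[ℝ] ℝ) =>
      1 / 2 * z.2 ((gram I b (extChartAt I q₀).symm z.1).inverse z.2) +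
        V ((extChartAt I q₀).symm z.1)) z := by
  have hG : ContDiffAt ℝ ∞ (fun z : E × (E →L[ℝ] ℝ) =>
      (gram I b (extChartAt I q₀).symm z.1).inverse) z := by
    have h1 := isInvertible_of_pos (gram_pos hb hz)
    refine ContDiffAt.comp (g := ContinuousLinearMap.inverse) z h1.contDiffAt_map_inverse ?_
    refine ContDiffAt.comp (g := gram I b (extChartAt I q₀).symm) z ?_ contDiffAt_fst
    exact (hb.smooth q₀).contDiffAt ((isOpen_extChartAt_target _).mem_nhds hz)
  have hV' : ContDiffAt ℝ ∞ (fun z : E × (E →L[ℝ] ℝ) => V ((extChartAt I q₀).symm z.1)) z := by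
    refine ContDiffAt.comp (g := V ∘ (extChartAt I q₀).symm) z ?_ contDiffAt_fst
    exact ((hV _).comp _ (contMDiffAt_chart_symm hz)).contDiffAt
  exact (contDiffAt_const.mul (contDiffAt_snd.clm_apply (hG.clm_apply contDiffAt_snd))).add hV'

theorem contMDiff_energy (hb : IsMetric I b) {V : Q → ℝ} (hV : ContMDiff I 𝓘(ℝ, ℝ) ∞ V) :
    ContMDiff (I.prod 𝓘(ℝ, E →L[ℝ] ℝ)) 𝓘(ℝ, ℝ) ∞ (energy I b V) := by
  intro u
  have hu : proj I u ∈ (extChartAt I (proj I u)).source := mem_extChartAt_source _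
  have h1 := (contDiffAt_energy_coord hb hV (z := cotCoord I (proj I u) u)
    ((extChartAt I (proj I u)).map_source hu)).contMDiffAt.comp u (contMDiffAt_cotCoord hu)
  refine h1.congr_of_eventuallyEq ?_
  have hs : ∀ᶠ w in 𝓝 u, proj I w ∈ (extChartAt I (proj I u)).source :=
    (contMDiff_proj (I := I) u).continuousAt (extChartAt_source_mem_nhds _)
  filter_upwards [hs] with w hw
  conv_lhs => rw [← cotMk_cotCoord hw]
  exact energy_cotMk hb V ((extChartAt I (proj I u)).map_source hw)

theorem gram_self (x : Q) :
    gram I b (extChartAt I x).symm (extChartAt I x x) = bil b x := by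
  ext v w
  have h : md 𝓘(ℝ, E) I (extChartAt I x).symm (extChartAt I x x) = .id ℝ E :=
    mfderiv_chart_symm_self x
  rw [gram_apply, h, extChartAt_to_inv x]
  rfl

/-- The derivative of the Hamiltonian in vertical direction. -/
theorem md_energy_vertical (hb : IsMetric I b) {V : Q → ℝ} (hV : ContMDiff I 𝓘(ℝ, ℝ) ∞ V)
    (u : Cotangent I Q) (w : E →L[ℝ] ℝ) :
    md (I.prod 𝓘(ℝ, E →L[ℝ] ℝ)) 𝓘(ℝ, ℝ) (energy I b V) u (0, w) =
      w ((bil b (proj I u)).inverse (fib u)) := by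
  have hz : extChartAt I (proj I u) (proj I u) ∈ (extChartAt I (proj I u)).target :=
    mem_extChartAt_target _
  have h0 : md (I.prod 𝓘(ℝ, E →L[ℝ] ℝ)) 𝓘(ℝ, ℝ) (energy I b V) u =
      fderiv ℝ (fun z : E × (E →L[ℝ] ℝ) =>
      1 / 2 * z.2 ((gram I b (extChartAt I (proj I u)).symm z.1).inverse z.2) +
        V ((extChartAt I (proj I u)).symm z.1)) (extChartAt I (proj I u) (proj I u), fib u) := by
    unfold md mfderiv
    refine (if_pos ((contMDiff_energy hb hV u).mdifferentiableAt (by simp))).trans ?_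
    rw [ModelWithCorners.range_eq_univ, fderivWithin_univ]
    have he := extChartAt_cotangent_self u
    rw [show (extChartAt I (proj I u) (proj I u), fib u) =
      extChartAt (I.prod 𝓘(ℝ, E →L[ℝ] ℝ)) u u from he.symm]
    refine Filter.EventuallyEq.fderiv_eq ?_
    filter_upwards [extChartAt_target_mem_nhds (I := I.prod 𝓘(ℝ, E →L[ℝ] ℝ)) u] with z hz
    rw [extChartAt_cotangent_target] at hz
    refine Eq.trans ?_ (energy_cotMk hb V hz.1)
    exact congrArg (energy I b V) (extChartAt_cotangent_symm hz.1)
  rw [h0]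
  have hd := (contDiffAt_energy_coord hb hV (q₀ := proj I u)
    (z := (extChartAt I (proj I u) (proj I u), fib u)) hz).differentiableAt (by simp)
  have hl := hd.hasFDerivAt.comp_hasDerivAt_of_eq (0 : ℝ)
    (f := fun t : ℝ => (extChartAt I (proj I u) (proj I u), fib u + t • w)) (f' := (0, w))
    ((hasDerivAt_const _ _).prodMk (by
      simpa using ((hasDerivAt_id (0 : ℝ)).smul_const w).const_add (fib u))) (by simp)
  refine hl.unique ?_
  have hp := hb.pos (proj I u)
  have hs := hb.symm (proj I u)
  simp only [Function.comp_def, gram_self, map_add, map_smul, _root_.add_apply,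
    _root_.smul_apply, smul_eq_mul, dual_symm hp hs (fib u) w]
  have h2 : HasDerivAt (fun t : ℝ => t) 1 0 := hasDerivAt_id 0
  set a := fib u ((bil b (proj I u)).inverse (fib u))
  set c := w ((bil b (proj I u)).inverse (fib u))
  set d := w ((bil b (proj I u)).inverse w)
  set e := V ((extChartAt I (proj I u)).symm (extChartAt I (proj I u) (proj I u)))
  have h3 := ((((h2.mul_const c).const_add a).add
    (h2.mul ((h2.mul_const d).const_add c))).const_mul (1 / 2)).add_const e
  convert h3 using 1
  · ext t; simp
  · ring

end Energy

section InverseFunction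

variable {E E₂ : Type*} [NormedAddCommGroup E] [NormedSpace ℝ E] [CompleteSpace E]
  [NormedAddCommGroup E₂] [NormedSpace ℝ E₂]

/-- The inverse function theorem. -/
theorem exists_partialDiffeomorph {G : E → E₂} {U : Set E} {a : E} (hU : IsOpen U) (ha : a ∈ U)
    (hG : ContDiffOn ℝ ∞ G U) (hinv : (fderiv ℝ G a).IsInvertible) :
    ∃ Φ : PartialDiffeomorph 𝓘(ℝ, E) 𝓘(ℝ, E₂) E E₂ ∞, a ∈ Φ.source ∧ Φ.source ⊆ U ∧
      ∀ y, Φ y = G y := by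
  have hGa : ContDiffAt ℝ ∞ G a := hG.contDiffAt (hU.mem_nhds ha)
  obtain ⟨e, he⟩ := hinv
  have hd : HasFDerivAt G (e : E →L[ℝ] E₂) a := by
    rw [he]; exact (hGa.differentiableAt (by simp)).hasFDerivAt
  let P := hGa.toOpenPartialHomeomorph G hd (by simp)
  let W := U ∩ fderiv ℝ G ⁻¹' range ((↑) : (E ≃L[ℝ] E₂) → E →L[ℝ] E₂)
  have hW : IsOpen W := (hG.continuousOn_fderiv_of_isOpen hU (by simp)).isOpen_inter_preimage hU
    ContinuousLinearEquiv.isOpen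
  have haW : a ∈ W := ⟨ha, e, he⟩
  let P' := P.restrOpen W hW
  have hsub : P'.source ⊆ W := fun y hy => hy.2
  refine ⟨⟨P'.toPartialEquiv, P'.open_source, P'.open_target, ?_, ?_⟩, ?_, ?_, fun y => rfl⟩
  · exact contMDiffOn_iff_contDiffOn.2 (hG.mono (hsub.trans inter_subset_left))
  · refine contMDiffOn_iff_contDiffOn.2 fun z hz => ?_
    have hw := hsub (P'.map_target hz)
    obtain ⟨e', he'⟩ := hw.2
    have h1 := hG.contDiffAt (hU.mem_nhds hw.1)
    refine (P'.contDiffAt_symm hz (f₀' := e') ?_ h1).contDiffWithinAt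
    rw [he']; exact (h1.differentiableAt (by simp)).hasFDerivAt
  · exact ⟨hGa.mem_toOpenPartialHomeomorph_source hd (by simp), haW⟩
  · exact hsub.trans inter_subset_left

theorem exists_equiv_prod_of_ne_zero [FiniteDimensional ℝ E] {d : ℕ}
    (hd : Module.finrank ℝ E = d + 1) {c : E →L[ℝ] ℝ} (hc : c ≠ 0) :
    ∃ e : E ≃L[ℝ] EuclideanSpace ℝ (Fin d) × ℝ, ∀ v, (e v).2 = c v := by
  obtain ⟨P, hP⟩ := Submodule.ClosedComplemented.of_finiteDimensional c.ker
  have hker : Module.finrank ℝ c.ker = d := by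
    have hr : c.range = ⊤ := LinearMap.range_eq_top.2 (by
      refine LinearMap.surjective (f := (c : E →ₗ[ℝ] ℝ)) fun h => hc ?_
      ext v; exact congrArg (fun f : E →ₗ[ℝ] ℝ => f v) h)
    have := LinearMap.finrank_range_add_finrank_ker (c : E →ₗ[ℝ] ℝ)
    rw [show LinearMap.range (c : E →ₗ[ℝ] ℝ) = ⊤ from hr, hd] at this
    simp at this
    have h' : Module.finrank ℝ (LinearMap.ker (c : E →ₗ[ℝ] ℝ)) = d := by omega
    exact h'
  let i : c.ker ≃L[ℝ] EuclideanSpace ℝ (Fin d) :=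
    ContinuousLinearEquiv.ofFinrankEq (by simpa using hker)
  let A : E →L[ℝ] EuclideanSpace ℝ (Fin d) × ℝ := (i.toContinuousLinearMap ∘L P).prod c
  have hA : Function.Injective A := by
    rw [injective_iff_map_eq_zero]
    intro v hv
    have h1 : c v = 0 := congrArg Prod.snd hv
    have h2 : i (P v) = 0 := congrArg Prod.fst hv
    have h3 : P v = 0 := by simpa using h2
    have h4 := hP ⟨v, h1⟩
    have h5 : P v = ⟨v, h1⟩ := h4
    rw [h3] at h5
    exact congrArg Subtype.val h5.symm
  refine ⟨(LinearEquiv.ofInjectiveOfFinrankEq A.toLinearMap hA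
    (by simp [hd])).toContinuousLinearEquiv, fun v => rfl⟩

end InverseFunction

section LevelSet

variable {E : Type*} [NormedAddCommGroup E] [NormedSpace ℝ E] [FiniteDimensional ℝ E]
  {H : Type*} [TopologicalSpace H] {J : ModelWithCorners ℝ E H} [J.Boundaryless]
  {N : Type*} [TopologicalSpace N] [ChartedSpace H N] [IsManifold J ∞ N] {d : ℕ}

variable (J) in
/-- The preferred chart at a point. -/
def chartDiffeo (x : N) : PartialDiffeomorph J 𝓘(ℝ, E) N E ∞ where
  toPartialEquiv := extChartAt J x
  open_source := isOpen_extChartAt_source x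
  open_target := isOpen_extChartAt_target x
  contMDiffOn_toFun := fun _ hq => (contMDiffAt_chart hq).contMDiffWithinAt
  contMDiffOn_invFun := contMDiffOn_extChartAt_symm x

theorem exists_slice {f : N → ℝ} (hf : ContMDiff J 𝓘(ℝ, ℝ) ∞ f) {k : ℝ}
    (hd : Module.finrank ℝ E = d + 1) {x : N} (hx : md J 𝓘(ℝ, ℝ) f x ≠ 0) :
    ∃ Φ : PartialDiffeomorph J 𝓘(ℝ, EuclideanSpace ℝ (Fin d) × ℝ) N
        (EuclideanSpace ℝ (Fin d) × ℝ) ∞, x ∈ Φ.source ∧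
      ∀ y ∈ Φ.source, f y = k ↔ (Φ y).2 = 0 := by
  let g : E → ℝ := f ∘ (extChartAt J x).symm
  have hg : ContDiffOn ℝ ∞ g (extChartAt J x).target := contMDiffOn_iff_contDiffOn.1
    (hf.comp_contMDiffOn (contMDiffOn_extChartAt_symm x))
  have hxt : extChartAt J x x ∈ (extChartAt J x).target := mem_extChartAt_target x
  have hto := isOpen_extChartAt_target (I := J) x
  have hgd : DifferentiableAt ℝ g (extChartAt J x x) :=
    (hg.contDiffAt (hto.mem_nhds hxt)).differentiableAt (by simp)
  have hc : fderiv ℝ g (extChartAt J x x) ≠ 0 := by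
    have h1 : md 𝓘(ℝ, E) 𝓘(ℝ, ℝ) g (extChartAt J x x) = _ :=
      md_comp (hf.mdifferentiableAt (by simp)) (mdifferentiableAt_chart_symm hxt)
    rw [md_eq_fderiv] at h1
    have h2 : md 𝓘(ℝ, E) J (extChartAt J x).symm (extChartAt J x x) = .id ℝ E :=
      mfderiv_chart_symm_self x
    rw [h1, h2, ContinuousLinearMap.comp_id, extChartAt_to_inv]
    exact hx
  obtain ⟨e, he⟩ := exists_equiv_prod_of_ne_zero hd hc
  let G : E → EuclideanSpace ℝ (Fin d) × ℝ := fun y => ((e y).1, g y - k)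
  have hG : ContDiffOn ℝ ∞ G (extChartAt J x).target :=
    (e.contDiff.fst.contDiffOn).prodMk (hg.sub contDiffOn_const)
  have hG' : HasFDerivAt G (e : E →L[ℝ] EuclideanSpace ℝ (Fin d) × ℝ) (extChartAt J x x) := by
    have h1 : HasFDerivAt G (((ContinuousLinearMap.fst ℝ _ _) ∘L
      (e : E →L[ℝ] EuclideanSpace ℝ (Fin d) × ℝ)).prod (fderiv ℝ g (extChartAt J x x)))
        (extChartAt J x x) :=
      ((ContinuousLinearMap.fst ℝ _ _) ∘L
        (e : E →L[ℝ] EuclideanSpace ℝ (Fin d) × ℝ)).hasFDerivAt.prodMk (hgd.hasFDerivAt.sub_const k)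
    convert h1 using 1
    ext v
    · rfl
    · exact he v
  obtain ⟨Φ, hΦ, hsub, heq⟩ := exists_partialDiffeomorph hto hxt hG (by
    rw [hG'.fderiv]; exact ⟨e, rfl⟩)
  refine ⟨(chartDiffeo J x).trans Φ, ⟨mem_extChartAt_source x, hΦ⟩, fun y hy => ?_⟩
  have h1 : ((chartDiffeo J x).trans Φ) y = G (extChartAt J x y) := heq _
  rw [h1]
  change _ ↔ f ((extChartAt J x).symm (extChartAt J x y)) - k = 0
  rw [(extChartAt J x).left_inv hy.1, sub_eq_zero]

open Classical in
/-- The chart of a subset that is given by a slice chart of the surrounding space. -/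
def sliceChart {S : Set N} (s₀ : S) (Φ : PartialDiffeomorph J 𝓘(ℝ, EuclideanSpace ℝ (Fin d) × ℝ) N
    (EuclideanSpace ℝ (Fin d) × ℝ) ∞) (hΦ : ∀ y ∈ Φ.source, y ∈ S ↔ (Φ y).2 = 0) :
    OpenPartialHomeomorph S (EuclideanSpace ℝ (Fin d)) where
  toFun s := (Φ s).1
  invFun z := if h : Φ.toPartialEquiv.symm (z, 0) ∈ S then ⟨_, h⟩ else s₀
  source := Subtype.val ⁻¹' Φ.source
  target := (fun z => (z, (0 : ℝ))) ⁻¹' Φ.target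
  map_source' s hs := by
    have h1 : ((Φ s).1, (0 : ℝ)) = Φ s := Prod.ext rfl ((hΦ s hs).1 s.2).symm
    change ((Φ s).1, (0 : ℝ)) ∈ Φ.target
    rw [h1]
    exact Φ.map_source hs
  map_target' z hz := by
    have h1 : Φ.toPartialEquiv.symm (z, 0) ∈ Φ.source := Φ.map_target hz
    have h2 : Φ.toPartialEquiv.symm (z, 0) ∈ S :=
      (hΦ _ h1).2 (congrArg Prod.snd (Φ.toPartialEquiv.right_inv hz))
    rw [dif_pos h2]; exact h1
  left_inv' s hs := by
    have h1 : ((Φ s).1, (0 : ℝ)) = Φ s := Prod.ext rfl ((hΦ s hs).1 s.2).symm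
    have h2 : Φ.toPartialEquiv.symm ((Φ s).1, (0 : ℝ)) = s := by
      rw [h1]; exact Φ.left_inv hs
    rw [dif_pos (by rw [h2]; exact s.2)]
    exact Subtype.ext h2
  right_inv' z hz := by
    have h1 : Φ.toPartialEquiv.symm (z, 0) ∈ Φ.source := Φ.map_target hz
    have h2 : Φ.toPartialEquiv.symm (z, 0) ∈ S :=
      (hΦ _ h1).2 (congrArg Prod.snd (Φ.toPartialEquiv.right_inv hz))
    rw [dif_pos h2]
    exact congrArg Prod.fst (Φ.toPartialEquiv.right_inv hz)
  open_source := Φ.open_source.preimage continuous_subtype_val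
  open_target := Φ.open_target.preimage (by fun_prop)
  continuousOn_toFun := continuous_fst.comp_continuousOn
    (Φ.contMDiffOn_toFun.continuousOn.comp continuous_subtype_val.continuousOn fun _ h => h)
  continuousOn_invFun := by
    rw [Topology.IsInducing.subtypeVal.continuousOn_iff]
    have h0 : ContinuousOn (fun z : EuclideanSpace ℝ (Fin d) => Φ.toPartialEquiv.symm (z, (0 : ℝ)))
        ((fun z => (z, (0 : ℝ))) ⁻¹' Φ.target) :=
      Φ.contMDiffOn_invFun.continuousOn.comp (by fun_prop) fun _ h => h
    refine h0.congr fun z hz => ?_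
    have h1 : Φ.toPartialEquiv.symm (z, 0) ∈ Φ.source := Φ.map_target hz
    have h2 : Φ.toPartialEquiv.symm (z, 0) ∈ S :=
      (hΦ _ h1).2 (congrArg Prod.snd (Φ.toPartialEquiv.right_inv hz))
    simp only [Function.comp_apply, dif_pos h2]

theorem sliceChart_symm {S : Set N} (s₀ : S)
    (Φ : PartialDiffeomorph J 𝓘(ℝ, EuclideanSpace ℝ (Fin d) × ℝ) N
    (EuclideanSpace ℝ (Fin d) × ℝ) ∞) (hΦ : ∀ y ∈ Φ.source, y ∈ S ↔ (Φ y).2 = 0)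
    {z : EuclideanSpace ℝ (Fin d)} (hz : z ∈ (sliceChart s₀ Φ hΦ).target) :
    ((sliceChart s₀ Φ hΦ).symm z : N) = Φ.toPartialEquiv.symm (z, 0) := by
  have h1 : Φ.toPartialEquiv.symm (z, 0) ∈ Φ.source := Φ.map_target hz
  have h2 : Φ.toPartialEquiv.symm (z, 0) ∈ S :=
    (hΦ _ h1).2 (congrArg Prod.snd (Φ.toPartialEquiv.right_inv hz))
  exact congrArg Subtype.val (dif_pos h2)

theorem isSubmanifold_of_slices {S : Set N} (hd : Module.finrank ℝ E = d + 1)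
    (hS : ∀ x ∈ S, ∃ Φ : PartialDiffeomorph J 𝓘(ℝ, EuclideanSpace ℝ (Fin d) × ℝ) N
        (EuclideanSpace ℝ (Fin d) × ℝ) ∞, x ∈ Φ.source ∧ ∀ y ∈ Φ.source, y ∈ S ↔ (Φ y).2 = 0) :
    IsSubmanifold J d S := by
  choose Φ hx hΦ using fun s : S => hS s s.2
  let c : S → OpenPartialHomeomorph S (EuclideanSpace ℝ (Fin d)) := fun s =>
    sliceChart s (Φ s) (hΦ s)
  let C : ChartedSpace (EuclideanSpace ℝ (Fin d)) S :=
    { atlas := range c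
      chartAt := c
      mem_chart_source := fun s => hx s
      chart_mem_atlas := fun s => mem_range_self s }
  have hM : IsManifold (𝓡 d) ∞ S := by
    refine isManifold_of_contDiffOn _ _ _ ?_
    rintro _ _ ⟨s, rfl⟩ ⟨t, rfl⟩
    have h0 : ContDiffOn ℝ ∞ ((c s).symm ≫ₕ c t) ((c s).symm ≫ₕ c t).source := by
      intro z hz
      have hev : ((c s).symm ≫ₕ c t) =ᶠ[𝓝 z]
          fun z => ((Φ t) ((Φ s).toPartialEquiv.symm (z, 0))).1 := by
        filter_upwards [((c s).symm ≫ₕ c t).open_source.mem_nhds hz] with y hy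
        exact congrArg (fun q => ((Φ t) q).1) (sliceChart_symm s (Φ s) (hΦ s) hy.1)
      have h1 : ContMDiffAt 𝓘(ℝ, EuclideanSpace ℝ (Fin d) × ℝ) J ∞ (Φ s).toPartialEquiv.symm
          (z, 0) := (Φ s).contMDiffOn_invFun.contMDiffAt ((Φ s).open_target.mem_nhds hz.1)
      have hmem : (Φ s).toPartialEquiv.symm (z, 0) ∈ (Φ t).source := by
        have h2 : ((c s).symm z : N) ∈ (Φ t).source := hz.2
        rwa [sliceChart_symm s (Φ s) (hΦ s) hz.1] at h2
      have h2 : ContMDiffAt J 𝓘(ℝ, EuclideanSpace ℝ (Fin d) × ℝ) ∞ (Φ t)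
          ((Φ s).toPartialEquiv.symm (z, 0)) :=
        (Φ t).contMDiffOn_toFun.contMDiffAt ((Φ t).open_source.mem_nhds hmem)
      have h3 := (ContMDiffAt.comp (z, (0 : ℝ)) h2 h1).contDiffAt
      have h4 : ContDiffAt ℝ ∞ (fun z : EuclideanSpace ℝ (Fin d) => (z, (0 : ℝ))) z := by fun_prop
      have h5 := contDiffAt_fst.comp z (ContDiffAt.comp z h3 h4)
      exact (h5.congr_of_eventuallyEq hev).contDiffWithinAt
    simpa using h0
  refine ⟨C, hM, ⟨ULift.{_} ℝ, inferInstance, inferInstance, fun s => ?_⟩, .subtypeVal⟩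
  let L : (EuclideanSpace ℝ (Fin d) × ULift ℝ) ≃L[ℝ] EuclideanSpace ℝ (Fin d) × ℝ :=
    (ContinuousLinearEquiv.refl ℝ _).prodCongr ContinuousLinearEquiv.ulift
  let K : (EuclideanSpace ℝ (Fin d) × ℝ) ≃L[ℝ] E :=
    ContinuousLinearEquiv.ofFinrankEq (by simp [hd])
  let ψ : OpenPartialHomeomorph N H := (Φ s).toOpenPartialHomeomorph ≫ₕ
    (K.toHomeomorph.trans J.toHomeomorph.symm).toOpenPartialHomeomorph
  have hψ : ψ.source = (Φ s).source := by simp [ψ]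
  have hψe : ∀ y, ψ.extend J y = K (Φ s y) := fun y =>
    J.right_inv (by rw [J.range_eq_univ]; trivial)
  have hψm : ψ ∈ IsManifold.maximalAtlas J ∞ N := by
    refine ψ.mem_maximalAtlas_of_contMDiffOn ?_ ?_
    · rw [hψ]
      have h1 : ContMDiff 𝓘(ℝ, E) J ∞ J.symm := by
        have := J.contMDiffOn_symm (n := ∞)
        rwa [J.range_eq_univ, contMDiffOn_univ] at this
      exact (h1.comp K.contDiff.contMDiff).comp_contMDiffOn (Φ s).contMDiffOn_toFun
    · refine (Φ s).contMDiffOn_invFun.comp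
        (K.symm.contDiff.contMDiff.comp J.contMDiff).contMDiffOn ?_
      intro z hz
      exact hz.2
  refine .mk_of_continuousAt continuous_subtype_val.continuousAt (L.trans K) (c s) ψ
    (hx s) (by rw [hψ]; exact hx s) (IsManifold.chart_mem_maximalAtlas s) hψm ?_
  intro z hz
  have hz' : z ∈ (c s).target := by simpa using hz
  change ψ.extend J ((c s).symm z : N) = K (z, 0)
  rw [hψe, sliceChart_symm s (Φ s) (hΦ s) hz']
  exact congrArg K ((Φ s).toPartialEquiv.right_inv hz')

theorem isSubmanifold_level {f : N → ℝ} (hf : ContMDiff J 𝓘(ℝ, ℝ) ∞ f) {k : ℝ}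
    (hd : Module.finrank ℝ E = d + 1) (hx : ∀ x, f x = k → md J 𝓘(ℝ, ℝ) f x ≠ 0) :
    IsSubmanifold J d {x | f x = k} :=
  isSubmanifold_of_slices hd fun x h => exists_slice hf hd (hx x h)

end LevelSet

section Submanifold

variable {E : Type*} [NormedAddCommGroup E] [NormedSpace ℝ E]
  {H : Type*} [TopologicalSpace H] {J : ModelWithCorners ℝ E H} [J.Boundaryless]
  {N : Type*} [TopologicalSpace N] [ChartedSpace H N] [IsManifold J ∞ N] {d : ℕ}
  {E₁ H₁ X : Type*} [NormedAddCommGroup E₁] [NormedSpace ℝ E₁] [TopologicalSpace H₁]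
  {I₁ : ModelWithCorners ℝ E₁ H₁} [TopologicalSpace X] [ChartedSpace H₁ X]

theorem exists_local_leftInverse [I₁.Boundaryless] [IsManifold I₁ ∞ X] {f : X → N} {x : X}
    (h : Manifold.IsImmersionAt I₁ J ∞ f x) :
    ∃ L : N → X, ContMDiffAt J I₁ ∞ L (f x) ∧ ∀ᶠ y in 𝓝 x, L (f y) = y := by
  have key : ∀ y ∈ h.domChart.source,
      h.codChart.extend J (f y) = h.equiv (h.domChart.extend I₁ y, 0) := fun y hy => by
    have h1 := h.writtenInCharts ((h.domChart.extend I₁).map_source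
      (by rwa [OpenPartialHomeomorph.extend_source]))
    simp only [Function.comp_apply] at h1
    rwa [h.domChart.extend_left_inv hy] at h1
  refine ⟨fun y => (h.domChart.extend I₁).symm (h.equiv.symm (h.codChart.extend J y)).1, ?_, ?_⟩
  · have h1 := OpenPartialHomeomorph.contMDiffAt_extend h.codChart_mem_maximalAtlas
      h.mem_codChart_source
    have h2 : ContDiff ℝ ∞ fun z : E => (h.equiv.symm z).1 := h.equiv.symm.contDiff.fst
    have h3 : ContMDiffAt 𝓘(ℝ, E₁) I₁ ∞ (h.domChart.extend I₁).symm (h.domChart.extend I₁ x) := by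
      refine (contMDiffOn_extend_symm h.domChart_mem_maximalAtlas).contMDiffAt ?_
      rw [OpenPartialHomeomorph.extend_coe]
      have ho : IsOpen (I₁ '' h.domChart.target) :=
        I₁.toHomeomorph.isOpenMap _ h.domChart.open_target
      exact ho.mem_nhds (mem_image_of_mem _ (h.domChart.map_source h.mem_domChart_source))
    refine ContMDiffAt.comp_of_eq (x := f x) h3 (h2.contMDiff.contMDiffAt.comp (f x) h1) ?_
    rw [key x h.mem_domChart_source]
    simp
  · filter_upwards [h.domChart.open_source.mem_nhds h.mem_domChart_source] with y hy
    rw [key y hy, h.equiv.symm_apply_apply]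
    exact h.domChart.extend_left_inv hy

variable {S : Set N} [ChartedSpace (EuclideanSpace ℝ (Fin d)) S]

theorem IsSubmanifoldStructure.contMDiff (hS : IsSubmanifoldStructure J d S) :
    ContMDiff (𝓡 d) J ∞ (Subtype.val : S → N) :=
  hS.isSmoothEmbedding.contMDiff

theorem IsSubmanifoldStructure.isImmersionAt (hS : IsSubmanifoldStructure J d S) (s : S) :
    Manifold.IsImmersionAt (𝓡 d) J ∞ (Subtype.val : S → N) s :=
  hS.isSmoothEmbedding.isImmersion.isImmersionAt s

theorem IsSubmanifoldStructure.md_val_injective (hS : IsSubmanifoldStructure J d S) (s : S) :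
    Function.Injective (md (𝓡 d) J (Subtype.val : S → N) s) := by
  have := hS.isManifold
  obtain ⟨L, hL, hev⟩ := exists_local_leftInverse (hS.isImmersionAt s)
  have h1 := md_comp (hL.mdifferentiableAt (by simp)) ((hS.contMDiff s).mdifferentiableAt (by simp))
  rw [md_congr (I₁ := 𝓡 d) (I₂ := 𝓡 d) (show L ∘ Subtype.val =ᶠ[𝓝 s] id from hev), md_id] at h1
  intro v w hvw
  have h2 := fun v => congrArg (fun A : EuclideanSpace ℝ (Fin d) →L[ℝ] _ => A v) h1
  refine (h2 v).trans (Eq.trans ?_ (h2 w).symm)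
  exact congrArg (md J (𝓡 d) L s) hvw

theorem IsSubmanifoldStructure.contMDiffAt_iff (hS : IsSubmanifoldStructure J d S) {g : X → S}
    {x : X} : ContMDiffAt I₁ (𝓡 d) ∞ g x ↔ ContMDiffAt I₁ J ∞ (fun y => (g y : N)) x := by
  have := hS.isManifold
  rw [ContMDiffAt.iff_comp_isImmersionAt (hS.isImmersionAt (g x))]
  refine ⟨fun h => h.2, fun h => ⟨?_, h⟩⟩
  exact Topology.IsInducing.subtypeVal.continuousAt_iff.2 h.continuousAt

theorem IsSubmanifoldStructure.md_val_range [FiniteDimensional ℝ E]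
    (hS : IsSubmanifoldStructure J d S)
    (hd : Module.finrank ℝ E = d + 1) {f : N → ℝ} (hf : ContMDiff J 𝓘(ℝ, ℝ) ∞ f) {k : ℝ}
    (hk : ∀ s : S, f s = k) (s : S) (hs : md J 𝓘(ℝ, ℝ) f s ≠ 0) (v : E) :
    md J 𝓘(ℝ, ℝ) f s v = 0 ↔ ∃ w, md (𝓡 d) J (Subtype.val : S → N) s w = v := by
  have h1 := md_comp (I₁ := 𝓡 d) (hf.mdifferentiableAt (by simp) (x := (s : N)))
    ((hS.contMDiff s).mdifferentiableAt (by simp))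
  have h2 : f ∘ (Subtype.val : S → N) = fun _ => k := funext hk
  have h3 : md (𝓡 d) 𝓘(ℝ, ℝ) (fun _ : S => k) s = 0 := mfderiv_const
  rw [h2, h3] at h1
  let A := (md (𝓡 d) J (Subtype.val : S → N) s).toLinearMap
  let c := (md J 𝓘(ℝ, ℝ) f s).toLinearMap
  have hle : LinearMap.range A ≤ LinearMap.ker c := by
    rintro _ ⟨w, rfl⟩
    exact congrArg (fun B : EuclideanSpace ℝ (Fin d) →L[ℝ] ℝ => B w) h1.symm
  have hA : Module.finrank ℝ (LinearMap.range A) = d := by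
    rw [LinearMap.finrank_range_of_inj (hS.md_val_injective s)]; simp
  have hc : Module.finrank ℝ (LinearMap.ker c) = d := by
    have hr : LinearMap.range c = ⊤ := LinearMap.range_eq_top.2 (by
      refine LinearMap.surjective fun h => hs ?_
      ext v; exact congrArg (fun f : E →ₗ[ℝ] ℝ => f v) h)
    have := LinearMap.finrank_range_add_finrank_ker c
    rw [hr, hd] at this
    simp at this
    omega
  have heq := Submodule.eq_of_le_of_finrank_eq hle (hA.trans hc.symm)
  constructor
  · intro hv
    have : v ∈ LinearMap.range A := by rw [heq]; exact hv
    exact this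
  · rintro ⟨w, rfl⟩
    exact hle ⟨w, rfl⟩

end Submanifold

section Algebra

variable {E : Type*} [NormedAddCommGroup E] [NormedSpace ℝ E] [FiniteDimensional ℝ E]

/-- The canonical symplectic form on `E × E^*` twisted by the 2-form `s`. -/
def twist (s : E [⋀^Fin 2]→L[ℝ] ℝ) (v w : E × (E →L[ℝ] ℝ)) : ℝ :=
  v.2 w.1 - w.2 v.1 + s ![v.1, w.1]

theorem update_zero (v w x : E) : Function.update ![v, w] 0 x = ![x, w] := by
  ext i; fin_cases i <;> simp

theorem update_one (v w x : E) : Function.update ![v, w] 1 x = ![v, x] := by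
  ext i; fin_cases i <;> simp

theorem form_smul_left (s : E [⋀^Fin 2]→L[ℝ] ℝ) (c : ℝ) (v w : E) :
    s ![c • v, w] = c * s ![v, w] := by
  have := s.map_update_smul ![v, w] 0 c v
  simp only [update_zero] at this
  exact this

theorem form_add_left (s : E [⋀^Fin 2]→L[ℝ] ℝ) (v v' w : E) :
    s ![v + v', w] = s ![v, w] + s ![v', w] := by
  have := s.map_update_add ![v, w] 0 v v'
  simp only [update_zero] at this
  exact this

theorem form_smul_right (s : E [⋀^Fin 2]→L[ℝ] ℝ) (c : ℝ) (v w : E) :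
    s ![v, c • w] = c * s ![v, w] := by
  have := s.map_update_smul ![v, w] 1 c w
  simp only [update_one] at this
  exact this

theorem form_add_right (s : E [⋀^Fin 2]→L[ℝ] ℝ) (v w w' : E) :
    s ![v, w + w'] = s ![v, w] + s ![v, w'] := by
  have := s.map_update_add ![v, w] 1 w w'
  simp only [update_one] at this
  exact this

theorem form_swap (s : E [⋀^Fin 2]→L[ℝ] ℝ) (v w : E) : s ![v, w] = - s ![w, v] := by
  have := s.toAlternatingMap.map_swap ![w, v] (i := 0) (j := 1) (by simp)
  have h : ![w, v] ∘ Equiv.swap (0 : Fin 2) 1 = ![v, w] := by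
    ext i; fin_cases i <;> simp
  rw [h] at this
  exact this

theorem form_zero_left (s : E [⋀^Fin 2]→L[ℝ] ℝ) (w : E) : s ![0, w] = 0 := by
  have := form_smul_left s 0 0 w; simpa using this

theorem twist_add_left (s : E [⋀^Fin 2]→L[ℝ] ℝ) (v v' w : E × (E →L[ℝ] ℝ)) :
    twist s (v + v') w = twist s v w + twist s v' w := by
  simp only [twist, Prod.fst_add, Prod.snd_add, _root_.add_apply, map_add, form_add_left]; ring

theorem twist_smul_left (s : E [⋀^Fin 2]→L[ℝ] ℝ) (c : ℝ) (v w : E × (E →L[ℝ] ℝ)) :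
    twist s (c • v) w = c * twist s v w := by
  simp only [twist, Prod.smul_fst, Prod.smul_snd, _root_.smul_apply, map_smul, form_smul_left,
    smul_eq_mul]; ring

theorem twist_swap (s : E [⋀^Fin 2]→L[ℝ] ℝ) (v w : E × (E →L[ℝ] ℝ)) :
    twist s v w = - twist s w v := by
  simp only [twist, form_swap s v.1 w.1]; ring

theorem twist_self (s : E [⋀^Fin 2]→L[ℝ] ℝ) (v : E × (E →L[ℝ] ℝ)) : twist s v v = 0 := by
  have := twist_swap s v v; linarith

theorem twist_sub_smul_left (s : E [⋀^Fin 2]→L[ℝ] ℝ) (c : ℝ) (v v' w : E × (E →L[ℝ] ℝ)) :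
    twist s (v - c • v') w = twist s v w - c * twist s v' w := by
  have := twist_add_left s (v - c • v') (c • v') w
  rw [sub_add_cancel, twist_smul_left] at this
  linarith

theorem twist_nondegenerate (s : E [⋀^Fin 2]→L[ℝ] ℝ) {v : E × (E →L[ℝ] ℝ)}
    (h : ∀ w, twist s v w = 0) : v = 0 := by
  have h1 : v.1 = 0 := by
    by_contra hne
    obtain ⟨g, -, hg⟩ := exists_dual_vector ℝ v.1 (by simpa using hne)
    have h2 := h (0, g)
    simp [twist, form_swap s v.1 0, form_zero_left, hg] at h2
    exact hne h2
  refine Prod.ext h1 (ContinuousLinearMap.ext fun a => ?_)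
  have := h (a, 0)
  simpa [twist, h1, form_zero_left] using this

/-- The Hamiltonian vector of a covector. -/
theorem exists_twist_eq (s : E [⋀^Fin 2]→L[ℝ] ℝ) (D : E × (E →L[ℝ] ℝ) →L[ℝ] ℝ) {y : E}
    (hD : ∀ g, D (0, g) = g y) : ∃ X : E × (E →L[ℝ] ℝ), X.1 = -y ∧ ∀ w, twist s X w = D w := by
  let g : E →ₗ[ℝ] ℝ :=
    { toFun := fun a => D (a, 0) + s ![y, a]
      map_add' := fun a a' => by
        have : ((a + a', 0) : E × (E →L[ℝ] ℝ)) = (a, 0) + (a', 0) := by simp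
        rw [this, map_add, form_add_right]; ring
      map_smul' := fun c a => by
        have : ((c • a, 0) : E × (E →L[ℝ] ℝ)) = c • (a, 0) := by simp
        rw [this, map_smul, form_smul_right]; simp; ring }
  refine ⟨(-y, LinearMap.toContinuousLinearMap g), rfl, fun w => ?_⟩
  have h1 : D w = D (w.1, 0) + w.2 y := by
    rw [← hD, ← map_add]; simp
  have h2 : s ![-y, w.1] = - s ![y, w.1] := by
    have := form_smul_left s (-1) y w.1; simpa using this
  simp only [twist, map_neg, LinearMap.coe_toContinuousLinearMap', h1, h2]
  change D (w.1, 0) + s ![y, w.1] - _ + _ = _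
  ring

/-- The kernel of the restriction of a symplectic form to a hyperplane. -/
theorem twist_ker (s : E [⋀^Fin 2]→L[ℝ] ℝ) {D : E × (E →L[ℝ] ℝ) →L[ℝ] ℝ} {X : E × (E →L[ℝ] ℝ)}
    (hX : ∀ w, twist s X w = D w) (hX0 : X ≠ 0) {v : E × (E →L[ℝ] ℝ)} (hv : D v = 0) :
    (∀ w, D w = 0 → twist s v w = 0) ↔ ∃ c : ℝ, v = c • X := by
  constructor
  · intro h
    have hw : ∃ w, D w ≠ 0 := by
      by_contra! hw
      exact hX0 (twist_nondegenerate s fun w => (hX w).trans (hw w))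
    obtain ⟨w₀, hw₀⟩ := hw
    refine ⟨twist s v w₀ / D w₀, ?_⟩
    rw [← sub_eq_zero]
    refine twist_nondegenerate s fun w => ?_
    have h1 : ∀ w, twist s (v - (twist s v w₀ / D w₀) • X) w =
        twist s v w - (twist s v w₀ / D w₀) * D w := fun w => by
      rw [twist_sub_smul_left, hX]
    have h2 : D (w - (D w / D w₀) • w₀) = 0 := by simp [hw₀]
    have h3 := h _ h2
    rw [h1]
    rw [twist_swap, twist_sub_smul_left, twist_swap s w v, twist_swap s w₀ v] at h3
    field_simp at h3 ⊢
    linarith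
  · rintro ⟨c, rfl⟩ w hw
    rw [twist_smul_left, hX, hw, mul_zero]

end Algebra

section SecondDerivative

variable {E : Type*} [NormedAddCommGroup E] [NormedSpace ℝ E]
  {H : Type*} [TopologicalSpace H] {I : ModelWithCorners ℝ E H} [I.Boundaryless]
  {M : Type*} [TopologicalSpace M] [ChartedSpace H M] [IsManifold I ∞ M] {k : ℕ}

theorem inChart_vectorSpace (η : DiffForm 𝓘(ℝ, E) E k) (x : E) : inChart 𝓘(ℝ, E) η x = η := by
  funext y
  have h : (mfderiv 𝓘(ℝ, E) 𝓘(ℝ, E) (extChartAt 𝓘(ℝ, E) x).symm y : E →L[ℝ] E) = .id ℝ E := by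
    have : ((extChartAt 𝓘(ℝ, E) x).symm : E → E) = id := by
      rw [extChartAt_model_space_eq_id]; rfl
    rw [this]
    exact mfderiv_id
  have := congrArg (fun A : E →L[ℝ] E => ContinuousAlternatingMap.compContinuousLinearMap
    (η y : E [⋀^Fin k]→L[ℝ] ℝ) A) h
  exact this

theorem extD_vectorSpace (η : DiffForm 𝓘(ℝ, E) E k) (x : E) :
    @Eq (E [⋀^Fin (k + 1)]→L[ℝ] ℝ) (extD 𝓘(ℝ, E) η x)
      (extDeriv (fun y : E => (η y : E [⋀^Fin k]→L[ℝ] ℝ)) x) := by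
  refine (extD_apply_self η x).trans ?_
  rw [inChart_vectorSpace]
  rfl

theorem inChart_extD {η : DiffForm I M k} {x : M} (hη : ∀ᶠ q in 𝓝 x, SmoothFormAt I η q) :
    inChart I (extD I η) x =ᶠ[𝓝 (extChartAt I x x)] extDeriv (inChart I η x) := by
  have hφ : ContinuousAt (extChartAt I x).symm (extChartAt I x x) := continuousAt_extChartAt_symm x
  have e1 : ∀ᶠ y in 𝓝 (extChartAt I x x), SmoothFormAt I η ((extChartAt I x).symm y) :=
    hφ.eventually (by rwa [extChartAt_to_inv])
  filter_upwards [e1, extChartAt_target_mem_nhds (I := I) x] with y h1 h2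
  have h3 := extD_pullbackForm (contMDiffAt_chart_symm h2) h1
  exact h3.symm.trans (extD_vectorSpace _ y)

theorem SmoothFormAt.extD {η : DiffForm I M k} {x : M} (hη : ∀ᶠ q in 𝓝 x, SmoothFormAt I η q) :
    SmoothFormAt I (extD I η) x := by
  refine ContDiffAt.congr_of_eventuallyEq ?_ (inChart_extD hη)
  have h : ContDiffAt ℝ ∞ (inChart I η x) (extChartAt I x x) := hη.self_of_nhds
  exact (ContinuousAlternatingMap.alternatizeUncurryFinCLM ℝ E ℝ).contDiff.contDiffAt.comp _
    (h.fderiv_right (m := ∞) (by simp))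

theorem extD_extD {η : DiffForm I M k} {x : M} (hη : ∀ᶠ q in 𝓝 x, SmoothFormAt I η q) :
    extD I (extD I η) x = 0 := by
  refine (extD_apply_self _ x).trans ?_
  rw [(inChart_extD hη).extDeriv_eq]
  exact extDeriv_extDeriv_apply hη.self_of_nhds (by simpa using two_le_infty)

end SecondDerivative

section EnergySurface

variable {E : Type*} [NormedAddCommGroup E] [NormedSpace ℝ E] [FiniteDimensional ℝ E]
  {H : Type*} [TopologicalSpace H] {I : ModelWithCorners ℝ E H} [I.Boundaryless]
  {Q : Type*} [TopologicalSpace Q] [ChartedSpace H Q] [IsManifold I ∞ Q]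
  {b : ∀ x : Q, TangentSpace I x →L[ℝ] TangentSpace I x →L[ℝ] ℝ} {V : Q → ℝ}
  {d : ℕ} {S : Set (Cotangent I Q)}

/-- The value of a form at a point, on the model space. -/
def frm {E H M : Type*} [NormedAddCommGroup E] [NormedSpace ℝ E] [TopologicalSpace H]
    {I : ModelWithCorners ℝ E H} [TopologicalSpace M] [ChartedSpace H M] {k : ℕ}
    (η : DiffForm I M k) (x : M) : E [⋀^Fin k]→L[ℝ] ℝ := η x

/-- The value of a 1-form at a point, as a covector on the model space. -/
def cov (θ : DiffForm I Q 1) (x : Q) : E →L[ℝ] ℝ := toCovector I (θ x)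

theorem cov_apply (θ : DiffForm I Q 1) (x : Q) (v : E) :
    cov θ x v = frm θ x ![v] := by
  change frm θ x (fun _ => v) = _
  congr 1
  ext i; fin_cases i; rfl

/-- The vector dual to a covector. -/
def sharp (b : ∀ x : Q, TangentSpace I x →L[ℝ] TangentSpace I x →L[ℝ] ℝ) (u : Cotangent I Q) : E :=
  (bil b (proj I u)).inverse (fib u)

theorem md_energy_ne_zero (hb : IsMetric I b) (hV : ContMDiff I 𝓘(ℝ, ℝ) ∞ V) {u : Cotangent I Q}
    (hu : fib u ≠ 0) : md (I.prod 𝓘(ℝ, E →L[ℝ] ℝ)) 𝓘(ℝ, ℝ) (energy I b V) u ≠ 0 := by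
  intro h
  have h1 := md_energy_vertical hb hV u (fib u)
  rw [h] at h1
  exact (dual_pos (hb.pos (proj I u)) hu).ne h1

theorem fib_ne_zero_of_lt {u : Cotangent I Q} {k : ℝ} (h : energy I b V u = k)
    (hk : V (proj I u) < k) : fib u ≠ 0 := by
  intro h0
  rw [energy_eq, h0] at h
  simp at h
  linarith

theorem isSubmanifold_energy (hb : IsMetric I b) (hV : ContMDiff I 𝓘(ℝ, ℝ) ∞ V) {k : ℝ}
    (hk : ∀ q, V q < k) (hd : Module.finrank ℝ (E × (E →L[ℝ] ℝ)) = d + 1) :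
    IsSubmanifold (I.prod 𝓘(ℝ, E →L[ℝ] ℝ)) d {u : Cotangent I Q | energy I b V u = k} :=
  isSubmanifold_level (contMDiff_energy hb hV) hd fun _ hu =>
    md_energy_ne_zero hb hV (fib_ne_zero_of_lt hu (hk _))

theorem twistedSymplectic_apply (σ : DiffForm I Q 2) (u : Cotangent I Q)
    (v w : E × (E →L[ℝ] ℝ)) :
    frm (twistedSymplectic I σ) u ![v, w] =
      twist (frm σ (proj I u)) v w := by
  have h1 := extD_liouville u v w
  have h2 : frm (pullbackForm (I.prod 𝓘(ℝ, E →L[ℝ] ℝ)) I (proj I) σ) u ![v, w] =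
      frm σ (proj I u) ![v.1, w.1] := by
    change frm σ (proj I u) _ = _
    congr 1
    ext i; fin_cases i
    · exact mfderiv_proj_self u v
    · exact mfderiv_proj_self u w
  exact congrArg₂ (· + ·) h1 h2

theorem primitive_apply (θ : DiffForm I Q 1) (u : Cotangent I Q) (v : E × (E →L[ℝ] ℝ)) :
    frm (liouville I + pullbackForm (I.prod 𝓘(ℝ, E →L[ℝ] ℝ)) I (proj I) θ) u ![v] = fib u v.1 + cov θ (proj I u) v.1 := by
  have h1 := liouville_apply u v
  have h2 : frm (pullbackForm (I.prod 𝓘(ℝ, E →L[ℝ] ℝ)) I (proj I) θ) u ![v] = cov θ (proj I u) v.1 := by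
    rw [cov_apply]
    change frm θ (proj I u) _ = _
    congr 1
    ext i; fin_cases i
    exact mfderiv_proj_self u v
  exact congrArg₂ (· + ·) h1 h2

theorem smoothFormAt_twisted {σ : DiffForm I Q 2} {u : Cotangent I Q}
    (hσ : SmoothFormAt I σ (proj I u)) :
    SmoothFormAt (I.prod 𝓘(ℝ, E →L[ℝ] ℝ)) (twistedSymplectic I σ) u :=
  (SmoothFormAt.extD (.of_forall smoothFormAt_liouville)).add (hσ.pullback (contMDiff_proj u))

theorem extD_twisted {σ : DiffForm I Q 2} {u : Cotangent I Q}
    (hσ : SmoothFormAt I σ (proj I u)) (hσ' : extD I σ (proj I u) = 0) :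
    extD (I.prod 𝓘(ℝ, E →L[ℝ] ℝ)) (twistedSymplectic I σ) u = 0 := by
  refine (extD_add (SmoothFormAt.extD (.of_forall smoothFormAt_liouville))
    (hσ.pullback (contMDiff_proj u))).trans ?_
  rw [extD_extD (.of_forall smoothFormAt_liouville), zero_add,
    extD_pullbackForm (contMDiff_proj u) hσ]
  unfold pullbackForm
  rw [hσ']
  rfl

variable [ChartedSpace (EuclideanSpace ℝ (Fin d)) S]

variable (I) in
/-- The derivative of the inclusion of a submanifold. -/
def dval (s : S) : EuclideanSpace ℝ (Fin d) →L[ℝ] E × (E →L[ℝ] ℝ) :=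
  md (𝓡 d) (I.prod 𝓘(ℝ, E →L[ℝ] ℝ)) (Subtype.val : S → Cotangent I Q) s

theorem restrictedTwisted_apply (σ : DiffForm I Q 2) (s : S) (v w : EuclideanSpace ℝ (Fin d)) :
    frm (restrictedTwisted I σ S) s ![v, w] =
      twist (frm σ (proj I s.1)) (dval I s v) (dval I s w) := by
  rw [← twistedSymplectic_apply]
  change frm (twistedSymplectic I σ) s.1 _ = _
  congr 1
  refine funext fun i => ?_
  fin_cases i <;> rfl

theorem restrictedPrimitive_apply (θ : DiffForm I Q 1) (s : S) (v : EuclideanSpace ℝ (Fin d)) :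
    frm (restrictedPrimitive I θ S) s ![v] =
      fib s.1 (dval I s v).1 + cov θ (proj I s.1) (dval I s v).1 := by
  rw [← primitive_apply]
  change frm (liouville I + pullbackForm (I.prod 𝓘(ℝ, E →L[ℝ] ℝ)) I (proj I) θ) s.1 _ = _
  congr 1
  refine funext fun i => ?_
  fin_cases i; rfl

variable (hS : IsSubmanifoldStructure (I.prod 𝓘(ℝ, E →L[ℝ] ℝ)) d S)

include hS

theorem smoothFormAt_restrictedPrimitive {θ : DiffForm I Q 1} {s : S}
    (hθ : SmoothFormAt I θ (proj I s.1)) : SmoothFormAt (𝓡 d) (restrictedPrimitive I θ S) s := by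
  have := hS.isManifold
  exact ((smoothFormAt_liouville s.1).add (hθ.pullback (contMDiff_proj s.1))).pullback
    (hS.contMDiff s)

theorem extD_restrictedPrimitive {θ : DiffForm I Q 1} {s : S}
    (hθ : SmoothFormAt I θ (proj I s.1)) :
    extD (𝓡 d) (restrictedPrimitive I θ S) s = restrictedTwisted I (extD I θ) S s := by
  have := hS.isManifold
  have h2 := hθ.pullback (contMDiff_proj s.1)
  refine (extD_pullbackForm (hS.contMDiff s) ((smoothFormAt_liouville s.1).add h2)).trans ?_
  refine congrArg (fun A : (E × (E →L[ℝ] ℝ)) [⋀^Fin 2]→L[ℝ] ℝ =>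
    A.compContinuousLinearMap (dval I s)) ?_
  refine (extD_add (smoothFormAt_liouville s.1) h2).trans ?_
  exact congrArg (fun A : (E × (E →L[ℝ] ℝ)) [⋀^Fin 2]→L[ℝ] ℝ =>
    frm (extD (I.prod 𝓘(ℝ, E →L[ℝ] ℝ)) (liouville I)) s.1 + A) (extD_pullbackForm (contMDiff_proj s.1) hθ)

/-- The characteristic line of an energy surface. -/
theorem exists_characteristic (hb : IsMetric I b) (hV : ContMDiff I 𝓘(ℝ, ℝ) ∞ V) {k : ℝ}
    (hSk : ∀ u, u ∈ S ↔ energy I b V u = k)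
    (hd : Module.finrank ℝ (E × (E →L[ℝ] ℝ)) = d + 1) (σ : DiffForm I Q 2) (s : S)
    (hs : fib s.1 ≠ 0) :
    ∃ e : EuclideanSpace ℝ (Fin d), (dval I s e).1 = - sharp b s.1 ∧ e ≠ 0 ∧
      ∀ v, (∀ w, frm (restrictedTwisted I σ S) s ![v, w] = 0)
        ↔ ∃ c : ℝ, v = c • e := by
  obtain ⟨X, hX1, hX⟩ := exists_twist_eq (frm σ (proj I s.1))
    (md (I.prod 𝓘(ℝ, E →L[ℝ] ℝ)) 𝓘(ℝ, ℝ) (energy I b V) s.1) (y := sharp b s.1)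
    (fun g => md_energy_vertical hb hV s.1 g)
  have hy : sharp b s.1 ≠ 0 := by
    intro h0
    have h1 := apply_inverse_apply (hb.pos (proj I s.1)) (fib s.1)
    rw [show (bil b (proj I s.1)).inverse (fib s.1) = 0 from h0, map_zero] at h1
    exact hs h1.symm
  have hX0 : X ≠ 0 := by
    rintro rfl
    exact hy (neg_eq_zero.1 hX1.symm)
  have hr := hS.md_val_range hd (contMDiff_energy hb hV) (fun s => (hSk s).1 s.2) s
    (md_energy_ne_zero hb hV hs)
  obtain ⟨e, he⟩ := (hr X).1 ((hX X).symm.trans (twist_self _ _))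
  have he' : dval I s e = X := he
  have hinj : Function.Injective (dval I s) := hS.md_val_injective s
  refine ⟨e, by rw [he', hX1], ?_, fun v => ?_⟩
  · rintro rfl
    exact hX0 (he'.symm.trans (map_zero _))
  · have h1 := twist_ker _ hX hX0 ((hr (dval I s v)).2 ⟨v, rfl⟩)
    constructor
    · intro h
      obtain ⟨c, hc⟩ := h1.1 fun w hw => by
        obtain ⟨w', rfl⟩ := (hr w).1 hw
        exact (restrictedTwisted_apply σ s v w').symm.trans (h w')
      exact ⟨c, hinj (by rw [hc, map_smul, he'])⟩
    · rintro ⟨c, rfl⟩ w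
      rw [restrictedTwisted_apply]
      exact h1.2 ⟨c, by rw [map_smul, he']⟩ _ ((hr _).2 ⟨w, rfl⟩)

theorem isOddSymplectic_restrictedTwisted (hb : IsMetric I b) (hV : ContMDiff I 𝓘(ℝ, ℝ) ∞ V)
    {k : ℝ} (hk : ∀ q, V q < k) (hSk : ∀ u, u ∈ S ↔ energy I b V u = k)
    (hd : Module.finrank ℝ (E × (E →L[ℝ] ℝ)) = d + 1) {σ : DiffForm I Q 2}
    (hσ : IsSmoothForm I σ) (hσ' : extD I σ = 0) :
    IsOddSymplectic (𝓡 d) (restrictedTwisted I σ S) := by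
  have := hS.isManifold
  have hσs := isSmoothForm_iff.1 hσ
  refine ⟨isSmoothForm_iff.2 fun s => (smoothFormAt_twisted (hσs _)).pullback (hS.contMDiff s),
    funext fun s => ?_, fun s => ?_⟩
  · refine (extD_pullbackForm (hS.contMDiff s) (smoothFormAt_twisted (hσs _))).trans ?_
    have h0 := extD_twisted (u := s.1) (hσs _) (congrFun hσ' _)
    unfold pullbackForm
    rw [h0]
    rfl
  · obtain ⟨e, -, he0, he⟩ := exists_characteristic hS hb hV hSk hd σ s
      (fib_ne_zero_of_lt ((hSk s.1).1 s.2) (hk _))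
    exact ⟨e, he0, he⟩

theorem contact_at (hb : IsMetric I b) (hV : ContMDiff I 𝓘(ℝ, ℝ) ∞ V) {k : ℝ}
    (hSk : ∀ u, u ∈ S ↔ energy I b V u = k)
    (hd : Module.finrank ℝ (E × (E →L[ℝ] ℝ)) = d + 1) {θ : DiffForm I Q 1} {s : S}
    (hθ : SmoothFormAt I θ (proj I s.1)) (hs : fib s.1 ≠ 0)
    (hpos : fib s.1 (sharp b s.1) + cov θ (proj I s.1) (sharp b s.1) ≠ 0) :
    restrictedPrimitive (d := d) I θ S s ≠ 0 ∧
    ∀ v : EuclideanSpace ℝ (Fin d),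
      frm (restrictedPrimitive I θ S) s ![v] = 0 →
      (∀ w : EuclideanSpace ℝ (Fin d),
        frm (restrictedPrimitive I θ S) s ![w] = 0 →
        frm (extD (𝓡 d) (restrictedPrimitive I θ S)) s ![v, w] = 0) → v = 0 := by
  obtain ⟨e, he, he0, hker⟩ := exists_characteristic hS hb hV hSk hd (extD I θ) s hs
  have hα := restrictedPrimitive_apply (d := d) θ s
  have hαe : frm (restrictedPrimitive I θ S) s ![e] ≠ 0 := by
    rw [hα, he, map_neg, map_neg]
    intro h; apply hpos; linarith
  refine ⟨fun h => hαe (congrArg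
    (fun A : EuclideanSpace ℝ (Fin d) [⋀^Fin 1]→L[ℝ] ℝ => A ![e]) h), fun v hv h => ?_⟩
  have hd' : frm (extD (𝓡 d) (restrictedPrimitive I θ S)) s =
    frm (restrictedTwisted I (extD I θ) S) s := extD_restrictedPrimitive hS hθ
  rw [hd'] at h
  have hve : frm (restrictedTwisted I (extD I θ) S) s ![v, e] = 0 := by
    rw [form_swap, (hker e).2 ⟨1, (one_smul _ _).symm⟩ v, neg_zero]
  obtain ⟨c, rfl⟩ := (hker v).1 fun w => by
    set a := frm (restrictedPrimitive I θ S) s ![w] /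
      frm (restrictedPrimitive I θ S) s ![e] with ha
    have h1 := h (w - a • e) (by
      rw [hα, map_sub, map_smul] 
      simp only [Prod.fst_sub, Prod.smul_fst, map_sub, map_smul, smul_eq_mul]
      have h2 := hα w
      have h3 := hα e
      have h4 : a * (fib s.1 (dval I s e).1 + cov θ (proj I s.1) (dval I s e).1) =
        fib s.1 (dval I s w).1 + cov θ (proj I s.1) (dval I s w).1 := by
        rw [← h2, ← h3, ha, div_mul_cancel₀ _ hαe]
      linarith)
    have h2 : w = (w - a • e) + a • e := by simp
    rw [h2, form_add_right, form_smul_right, h1, hve, mul_zero, add_zero]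
  rw [hα, map_smul] at hv
  simp only [Prod.smul_fst, map_smul, smul_eq_mul] at hv
  rw [← mul_add, ← hα] at hv
  rcases mul_eq_zero.1 hv with h0 | h0
  · rw [h0, zero_smul]
  · exact absurd h0 hαe

end EnergySurface

theorem exists_bound_of_local {X : Type*} [TopologicalSpace X] [CompactSpace X]
    {P : X → ℝ → Prop} (hmono : ∀ x C C', C ≤ C' → P x C → P x C')
    (h : ∀ x, ∃ C, ∀ᶠ y in 𝓝 x, P y C) : ∃ C, ∀ x, P x C := by
  choose C hC using h
  obtain ⟨t, -, ht⟩ := isCompact_univ.elim_nhds_subcover (fun x => {y | P y (C x)})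
    fun x _ => hC x
  obtain ⟨D, hD⟩ := (t.image C).exists_le
  refine ⟨D, fun x => ?_⟩
  obtain ⟨y, hy, hxy⟩ := mem_iUnion₂.1 (ht (mem_univ x))
  exact hmono _ _ _ (hD _ (Finset.mem_image_of_mem C hy)) hxy

/-- A homogeneous function that is positive at one point of a parameter space is uniformly
positive at nearby points. -/
theorem exists_lower_bound {X E : Type*} [TopologicalSpace X] [NormedAddCommGroup E]
    [NormedSpace ℝ E] [FiniteDimensional ℝ E] {f : X → E → ℝ} {x : X}
    (hf : ∀ v, ContinuousAt (Function.uncurry f) (x, v)) (hpos : ∀ v, v ≠ 0 → 0 < f x v)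
    (hhom : ∀ x (t : ℝ) v, f x (t • v) = t ^ 2 * f x v) :
    ∃ c > 0, ∀ᶠ y in 𝓝 x, ∀ v, c * ‖v‖ ^ 2 ≤ f y v := by
  have hK : IsCompact (Metric.sphere (0 : E) 1) := isCompact_sphere 0 1
  obtain ⟨c, hc, hcf⟩ : ∃ c > 0, ∀ v ∈ Metric.sphere (0 : E) 1, c < f x v := by
    rcases (Metric.sphere (0 : E) 1).eq_empty_or_nonempty with h | h
    · exact ⟨1, one_pos, by simp [h]⟩
    · have hcont : ContinuousOn (f x) (Metric.sphere (0 : E) 1) := fun v _ =>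
        ((hf v).comp (f := fun v => (x, v)) (by fun_prop)).continuousWithinAt
      obtain ⟨v, hv, hmin⟩ := hK.exists_isMinOn h hcont
      have hv0 : 0 < f x v := hpos v (by rintro rfl; simp at hv)
      exact ⟨f x v / 2, by positivity, fun w hw => by have := hmin hw; simp at this; linarith⟩
  refine ⟨c, hc, ?_⟩
  have h1 : ∀ᶠ y in 𝓝 x, ∀ v ∈ Metric.sphere (0 : E) 1, c < f y v :=
    hK.eventually_forall_of_forall_eventually fun v hv => (hf v).eventually (lt_mem_nhds (hcf v hv))
  filter_upwards [h1] with y hy v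
  by_cases hv : v = 0
  · have := hhom y 0 0
    simp [hv] at this ⊢
    exact this.ge
  · have hn : ‖v‖ ≠ 0 := by simpa using hv
    have h2 := hy (‖v‖⁻¹ • v) (by simp [norm_smul, hn])
    have h3 : v = ‖v‖ • (‖v‖⁻¹ • v) := by rw [smul_smul, mul_inv_cancel₀ hn, one_smul]
    have h4 : 0 < ‖v‖ ^ 2 := by positivity
    rw [h3, hhom, ← h3]
    nlinarith

section Compact

variable {E : Type*} [NormedAddCommGroup E] [NormedSpace ℝ E] [FiniteDimensional ℝ E]
  {H : Type*} [TopologicalSpace H] {I : ModelWithCorners ℝ E H} [I.Boundaryless]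
  {Q : Type*} [TopologicalSpace Q] [ChartedSpace H Q] [IsManifold I ∞ Q]
  {b : ∀ x : Q, TangentSpace I x →L[ℝ] TangentSpace I x →L[ℝ] ℝ} {V : Q → ℝ}

theorem exists_local_compact (hb : IsMetric I b) (hV : ContMDiff I 𝓘(ℝ, ℝ) ∞ V) (k : ℝ) (q₀ : Q) :
    ∃ K : Set (Cotangent I Q), IsCompact K ∧
      ∀ᶠ q in 𝓝 q₀, ∀ u : Cotangent I Q, proj I u = q → energy I b V u = k → u ∈ K := by
  set x₀ := extChartAt I q₀ q₀
  have hx₀ : x₀ ∈ (extChartAt I q₀).target := mem_extChartAt_target q₀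
  have ht := (isOpen_extChartAt_target (I := I) q₀).mem_nhds hx₀
  have hG : ContinuousAt (gram I b (extChartAt I q₀).symm) x₀ :=
    ((hb.smooth q₀).contDiffAt ht).continuousAt
  have hG' : ∀ᶠ x in 𝓝 x₀, ‖gram I b (extChartAt I q₀).symm x‖ <
      ‖gram I b (extChartAt I q₀).symm x₀‖ + 1 := by
    have hc : Continuous fun A : E →L[ℝ] E →L[ℝ] ℝ => ‖A‖ :=
      continuous_norm (E := E →L[ℝ] E →L[ℝ] ℝ)
    have hn : ContinuousAt (fun x => ‖gram I b (extChartAt I q₀).symm x‖) x₀ :=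
      hc.continuousAt.comp hG
    exact hn.eventually (gt_mem_nhds (lt_add_one _))
  have hV' : ∀ᶠ x in 𝓝 x₀, V q₀ - 1 < V ((extChartAt I q₀).symm x) := by
    have h1 : ContinuousAt (V ∘ (extChartAt I q₀).symm) x₀ :=
      hV.continuous.continuousAt.comp (continuousAt_extChartAt_symm q₀)
    refine h1.eventually (lt_mem_nhds ?_)
    simp [x₀]
  obtain ⟨r, hr, hball⟩ := Metric.nhds_basis_closedBall.eventually_iff.1
    ((eventually_mem_set.2 ht).and (hG'.and hV'))
  set C := ‖gram I b (extChartAt I q₀).symm x₀‖ + 1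
  set m := 2 * (k - (V q₀ - 1))
  refine ⟨cotMk I q₀ '' (Metric.closedBall x₀ r ×ˢ Metric.closedBall 0 (√(m * C))), ?_, ?_⟩
  · have := FiniteDimensional.proper ℝ E
    have := FiniteDimensional.proper ℝ (E →L[ℝ] ℝ)
    refine ((isCompact_closedBall _ _).prod (isCompact_closedBall _ _)).image_of_continuousOn ?_
    intro z hz
    exact (contMDiffAt_cotMk (hball hz.1).1).continuousAt.continuousWithinAt
  · have h1 : ∀ᶠ q in 𝓝 q₀, extChartAt I q₀ q ∈ Metric.closedBall x₀ r :=
      (continuousAt_extChartAt q₀).eventually (Metric.closedBall_mem_nhds _ hr)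
    filter_upwards [h1, extChartAt_source_mem_nhds (I := I) q₀] with q hq hqs u hu huk
    subst hu
    obtain ⟨ht, hGx, hVx⟩ := hball hq
    refine ⟨cotCoord I q₀ u, ⟨hq, ?_⟩, cotMk_cotCoord hqs⟩
    rw [← cotMk_cotCoord hqs, energy_cotMk hb V (z := cotCoord I q₀ u) ht] at huk
    set p := (cotCoord I q₀ u).2
    have hsym : ∀ v w, gram I b (extChartAt I q₀).symm (cotCoord I q₀ u).1 v w =
        gram I b (extChartAt I q₀).symm (cotCoord I q₀ u).1 w v := fun v w => hb.symm _ _ _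
    have hGx' : ‖gram I b (extChartAt I q₀).symm (cotCoord I q₀ u).1‖ < C := hGx
    have hVx' : V q₀ - 1 < V ((extChartAt I q₀).symm (cotCoord I q₀ u).1) := hVx
    have hp := dual_apply_sq_le (gram_pos hb ht) hsym p
    have h0 := dual_nonneg (gram_pos hb ht) p
    rw [mem_closedBall_zero_iff]
    refine p.opNorm_le_bound (Real.sqrt_nonneg _) fun v => ?_
    have hsq : (p v) ^ 2 ≤ m * C * ‖v‖ ^ 2 := by
      refine (hp v).trans ?_
      have h2 : gram I b (extChartAt I q₀).symm (cotCoord I q₀ u).1 v v ≤ C * ‖v‖ ^ 2 := by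
        refine (le_abs_self _).trans (((gram I b _ _).le_opNorm₂ v v).trans ?_)
        nlinarith [sq_nonneg ‖v‖]
      have h3 : p ((gram I b (extChartAt I q₀).symm (cotCoord I q₀ u).1).inverse p) ≤ m := by
        have : 1 / 2 * p ((gram I b (extChartAt I q₀).symm (cotCoord I q₀ u).1).inverse p) +
          V ((extChartAt I q₀).symm (cotCoord I q₀ u).1) = k := huk
        linarith
      have h4 : 0 ≤ C * ‖v‖ ^ 2 := by positivity
      calc _ ≤ p ((gram I b (extChartAt I q₀).symm (cotCoord I q₀ u).1).inverse p) * (C * ‖v‖ ^ 2) :=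
            mul_le_mul_of_nonneg_left h2 h0
        _ ≤ m * (C * ‖v‖ ^ 2) := mul_le_mul_of_nonneg_right h3 h4
        _ = _ := by ring
    have hsq' := Real.abs_le_sqrt hsq
    rwa [Real.sqrt_mul' _ (by positivity), Real.sqrt_sq (norm_nonneg v)] at hsq'

theorem isCompact_energy [CompactSpace Q] (hb : IsMetric I b) (hV : ContMDiff I 𝓘(ℝ, ℝ) ∞ V)
    (k : ℝ) : IsCompact {u : Cotangent I Q | energy I b V u = k} := by
  choose K hK hKu using exists_local_compact hb hV k
  obtain ⟨t, -, ht⟩ := isCompact_univ.elim_nhds_subcover (fun q₀ : Q =>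
    {q | ∀ u : Cotangent I Q, proj I u = q → energy I b V u = k → u ∈ K q₀}) fun q _ => hKu q
  have h1 : IsCompact (⋃ q ∈ t, K q) := t.isCompact_biUnion fun q _ => hK q
  refine (h1.inter_right (isClosed_eq (contMDiff_energy hb hV).continuous
    (continuous_const (y := k)))).of_isClosed_subset ?_ ?_
  · exact isClosed_eq (contMDiff_energy hb hV).continuous continuous_const
  · intro u hu
    refine ⟨?_, hu⟩
    obtain ⟨q, hq, hmem⟩ := mem_iUnion₂.1 (ht (mem_univ (proj I u)))
    exact mem_iUnion₂.2 ⟨q, hq, hmem u rfl hu⟩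

end Compact

section Bounds

variable {E : Type*} [NormedAddCommGroup E] [NormedSpace ℝ E] [FiniteDimensional ℝ E]
  {H : Type*} [TopologicalSpace H] {I : ModelWithCorners ℝ E H} [I.Boundaryless]
  {Q : Type*} [TopologicalSpace Q] [ChartedSpace H Q] [IsManifold I ∞ Q]
  {b : ∀ x : Q, TangentSpace I x →L[ℝ] TangentSpace I x →L[ℝ] ℝ} {V : Q → ℝ}
  {E₁ : Type*} [NormedAddCommGroup E₁] [NormedSpace ℝ E₁] [FiniteDimensional ℝ E₁]
  {H₁ : Type*} [TopologicalSpace H₁] {I₁ : ModelWithCorners ℝ E₁ H₁} [I₁.Boundaryless]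
  {M : Type*} [TopologicalSpace M] [ChartedSpace H₁ M] [IsManifold I₁ ∞ M]
  {g : ∀ x : M, TangentSpace I₁ x →L[ℝ] TangentSpace I₁ x →L[ℝ] ℝ}

theorem continuousAt_gram_uncurry (hb : IsMetric I b) {F : E₁ → Q} {y : E₁}
    (hF : ContMDiffAt 𝓘(ℝ, E₁) I ∞ F y) (v : E₁) :
    ContinuousAt (fun z : E₁ × E₁ => gram I b F z.1 z.2 z.2) (y, v) := by
  have h1 : ContinuousAt (fun z : E₁ × E₁ => gram I b F z.1) (y, v) :=
    ContinuousAt.comp (g := gram I b F) (contDiffAt_gram hb hF).continuousAt continuousAt_fst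
  exact (h1.clm_apply continuousAt_snd).clm_apply continuousAt_snd

theorem exists_upper_bound (hb : IsMetric I b) {F : E₁ → Q} {y : E₁}
    (hF : ContMDiffAt 𝓘(ℝ, E₁) I ∞ F y) :
    ∃ C, 0 ≤ C ∧ ∀ᶠ z in 𝓝 y, ∀ v, gram I b F z v v ≤ C * ‖v‖ ^ 2 := by
  have hc : Continuous fun A : E₁ →L[ℝ] E₁ →L[ℝ] ℝ => ‖A‖ :=
    continuous_norm (E := E₁ →L[ℝ] E₁ →L[ℝ] ℝ)
  have hn : ContinuousAt (fun z => ‖gram I b F z‖) y :=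
    hc.continuousAt.comp (contDiffAt_gram hb hF).continuousAt
  refine ⟨‖gram I b F y‖ + 1, by positivity, ?_⟩
  filter_upwards [hn.eventually (gt_mem_nhds (lt_add_one _))] with z hz v
  refine (le_abs_self _).trans (((gram I b F z).le_opNorm₂ v v).trans ?_)
  nlinarith [sq_nonneg ‖v‖]

theorem gram_chart_apply (F : M → Q) {x₀ x : M} (hx : x ∈ (extChartAt I₁ x₀).source)
    (hF : MDifferentiableAt I₁ I F x) (v : E₁) :
    gram I b (F ∘ (extChartAt I₁ x₀).symm) (extChartAt I₁ x₀ x)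
      (md I₁ 𝓘(ℝ, E₁) (extChartAt I₁ x₀) x v) (md I₁ 𝓘(ℝ, E₁) (extChartAt I₁ x₀) x v) =
      bil b (F x) (md I₁ I F x v) (md I₁ I F x v) := by
  have h1 := (extChartAt I₁ x₀).left_inv hx
  have h2 := md_comp (I₁ := 𝓘(ℝ, E₁)) (f := (extChartAt I₁ x₀).symm) (g := F)
    (x := extChartAt I₁ x₀ x) (by rw [h1]; exact hF)
    (mdifferentiableAt_chart_symm ((extChartAt I₁ x₀).map_source hx))
  rw [gram_apply, h2, ContinuousLinearMap.comp_apply, md_symm_comp_chart hx, Function.comp_apply,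
    h1]

theorem exists_metric_comparison [CompactSpace M] (hb : IsMetric I b) (hg : IsMetric I₁ g)
    {F : M → Q} (hF : ContMDiff I₁ I ∞ F) :
    ∃ C : ℝ, ∀ x v, bil b (F x) (md I₁ I F x v) (md I₁ I F x v) ≤ C * bil g x v v := by
  refine exists_bound_of_local (P := fun x C => ∀ v, bil b (F x) (md I₁ I F x v)
    (md I₁ I F x v) ≤ C * bil g x v v) (fun x C C' h hP v => (hP v).trans
      (mul_le_mul_of_nonneg_right h (bilin_nonneg (hg.pos x) v))) fun x₀ => ?_
  have hx₀ : extChartAt I₁ x₀ x₀ ∈ (extChartAt I₁ x₀).target := mem_extChartAt_target x₀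
  have hc := contMDiffAt_chart_symm (I := I₁) hx₀
  obtain ⟨C, hC, h1⟩ := exists_upper_bound hb ((hF _).comp _ hc)
  obtain ⟨c, hc0, h2⟩ := exists_lower_bound
    (f := fun z v => gram I₁ g (extChartAt I₁ x₀).symm z v v) (x := extChartAt I₁ x₀ x₀)
    (continuousAt_gram_uncurry hg hc) (gram_pos hg hx₀)
    (fun x t v => by simp only [map_smul, _root_.smul_apply, smul_eq_mul]; ring)
  refine ⟨C / c, ?_⟩
  have hcx := continuousAt_extChartAt (I := I₁) x₀
  filter_upwards [hcx.eventually h1, hcx.eventually h2, extChartAt_source_mem_nhds (I := I₁) x₀]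
    with x h1 h2 hx v
  have h3 := h1 (md I₁ 𝓘(ℝ, E₁) (extChartAt I₁ x₀) x v)
  have h4 := h2 (md I₁ 𝓘(ℝ, E₁) (extChartAt I₁ x₀) x v)
  rw [gram_chart_apply F hx (hF.mdifferentiableAt (by simp))] at h3
  have h5 := gram_chart_apply (b := g) (I := I₁) (id : M → M) hx mdifferentiableAt_id v
  rw [md_id] at h5
  have h6 : gram I₁ g (extChartAt I₁ x₀).symm (extChartAt I₁ x₀ x)
    (md I₁ 𝓘(ℝ, E₁) (extChartAt I₁ x₀) x v) (md I₁ 𝓘(ℝ, E₁) (extChartAt I₁ x₀) x v) =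
      bil g x v v := h5
  rw [h6] at h4
  rw [div_mul_eq_mul_div, le_div_iff₀ hc0]
  nlinarith

theorem inChart_apply_two (η : DiffForm I₁ M 2) (x₀ : M) (y v w : E₁) :
    inChart I₁ η x₀ y ![v, w] = frm η ((extChartAt I₁ x₀).symm y)
      ![md 𝓘(ℝ, E₁) I₁ (extChartAt I₁ x₀).symm y v, md 𝓘(ℝ, E₁) I₁ (extChartAt I₁ x₀).symm y w] := by
  change frm η ((extChartAt I₁ x₀).symm y) _ = _
  congr 1
  refine funext fun i => ?_
  fin_cases i <;> rfl

theorem form_eq_zero_of_basis {ι : Type*} (e : Module.Basis ι ℝ E₁) (s : E₁ [⋀^Fin 2]→L[ℝ] ℝ)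
    {v : E₁} (h : ∀ i, s ![v, e i] = 0) (w : E₁) : s ![v, w] = 0 := by
  let L : E₁ →ₗ[ℝ] ℝ :=
    { toFun := fun w => s ![v, w]
      map_add' := form_add_right s v
      map_smul' := fun c w => form_smul_right s c v w }
  have : L = 0 := e.ext h
  exact congrArg (fun A : E₁ →ₗ[ℝ] ℝ => A w) this

/-- On the kernel of a 2-form, a metric is bounded by a semi-definite form that is positive on the
kernel. -/
theorem exists_metric_comparison_ker [CompactSpace M] (hb : IsMetric I b) (hg : IsMetric I₁ g)
    {F : M → Q} (hF : ContMDiff I₁ I ∞ F) {η : DiffForm I₁ M 2} (hη : IsSmoothForm I₁ η)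
    (hker : ∀ x v, (∀ w, frm η x ![v, w] = 0) → md I₁ I F x v = 0 → v = 0) :
    ∃ C : ℝ, ∀ x v, (∀ w, frm η x ![v, w] = 0) →
      bil g x v v ≤ C * bil b (F x) (md I₁ I F x v) (md I₁ I F x v) := by
  refine exists_bound_of_local (P := fun x C => ∀ v, (∀ w, frm η x ![v, w] = 0) →
    bil g x v v ≤ C * bil b (F x) (md I₁ I F x v) (md I₁ I F x v)) (fun x C C' h hP v hv =>
      (hP v hv).trans (mul_le_mul_of_nonneg_right h (bilin_nonneg (hb.pos _) _))) fun x₀ => ?_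
  have hx₀ : extChartAt I₁ x₀ x₀ ∈ (extChartAt I₁ x₀).target := mem_extChartAt_target x₀
  have hc := contMDiffAt_chart_symm (I := I₁) hx₀
  obtain ⟨C, hC, h1⟩ := exists_upper_bound hg hc
  let e := Module.finBasis ℝ E₁
  have hηc : ContinuousAt (inChart I₁ η x₀) (extChartAt I₁ x₀ x₀) :=
    ContDiffAt.continuousAt (isSmoothForm_iff.1 hη x₀)
  obtain ⟨c, hc0, h2⟩ := exists_lower_bound
    (f := fun z v => gram I b (F ∘ (extChartAt I₁ x₀).symm) z v v +
      ∑ i, (inChart I₁ η x₀ z ![v, e i]) ^ 2) (x := extChartAt I₁ x₀ x₀)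
    (fun v => by
      refine (continuousAt_gram_uncurry hb ((hF _).comp _ hc) v).add ?_
      refine tendsto_finsetSum _ fun i _ => ?_
      refine ContinuousAt.pow ?_ 2
      have h3 : ContinuousAt (fun z : E₁ × E₁ => inChart I₁ η x₀ z.1) (extChartAt I₁ x₀ x₀, v) :=
        ContinuousAt.comp (g := inChart I₁ η x₀) hηc continuousAt_fst
      have h4 : ContinuousAt (fun z : E₁ × E₁ => ![z.2, e i]) (extChartAt I₁ x₀ x₀, v) := by
        refine continuousAt_pi.2 fun j => ?_
        fin_cases j
        · exact continuousAt_snd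
        · exact continuousAt_const
      exact h3.eval h4)
    (fun v hv => by
      have h3 : 0 ≤ gram I b (F ∘ (extChartAt I₁ x₀).symm) (extChartAt I₁ x₀ x₀) v v :=
        bilin_nonneg (hb.pos _) _
      have h4 : 0 ≤ ∑ i, (inChart I₁ η x₀ (extChartAt I₁ x₀ x₀) ![v, e i]) ^ 2 :=
        Finset.sum_nonneg fun i _ => sq_nonneg _
      by_contra hle
      have h5 : gram I b (F ∘ (extChartAt I₁ x₀).symm) (extChartAt I₁ x₀ x₀) v v = 0 := by linarith
      have h6 : ∑ i, (inChart I₁ η x₀ (extChartAt I₁ x₀ x₀) ![v, e i]) ^ 2 = 0 := by linarith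
      have h7 := fun i => (Finset.sum_eq_zero_iff_of_nonneg fun i _ => sq_nonneg _).1 h6 i
        (Finset.mem_univ i)
      have h8 := form_eq_zero_of_basis e _ fun i => pow_eq_zero_iff two_ne_zero |>.1 (h7 i)
      have h9 : md 𝓘(ℝ, E₁) I₁ (extChartAt I₁ x₀).symm (extChartAt I₁ x₀ x₀) v = 0 := by
        refine hker ((extChartAt I₁ x₀).symm (extChartAt I₁ x₀ x₀)) _ (fun w => ?_) ?_
        · have h10 := h8 (md I₁ 𝓘(ℝ, E₁) (extChartAt I₁ x₀)
            ((extChartAt I₁ x₀).symm (extChartAt I₁ x₀ x₀)) w)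
          rw [inChart_apply_two] at h10
          have h11 := md_symm_comp_chart ((extChartAt I₁ x₀).map_target hx₀) w
          rw [(extChartAt I₁ x₀).right_inv hx₀] at h11
          rwa [h11] at h10
        · by_contra hne
          have h10 := md_comp (g := F) (hF.mdifferentiableAt (by simp))
            (mdifferentiableAt_chart_symm hx₀)
          have h11 := hb.pos (F ((extChartAt I₁ x₀).symm (extChartAt I₁ x₀ x₀))) _ hne
          rw [gram_apply, h10] at h5
          exact h11.ne' h5
      apply hv
      rw [← md_chart_comp_symm hx₀ v]
      exact (congrArg _ h9).trans (map_zero _))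
    (fun x t v => by
      have h3 : ∀ i, (inChart I₁ η x₀ x ![t • v, e i]) ^ 2 =
        t ^ 2 * (inChart I₁ η x₀ x ![v, e i]) ^ 2 := fun i => by rw [form_smul_left]; ring
      simp only [map_smul, _root_.smul_apply, smul_eq_mul, h3, ← Finset.mul_sum]; ring)
  refine ⟨C / c, ?_⟩
  have hcx := continuousAt_extChartAt (I := I₁) x₀
  filter_upwards [hcx.eventually h1, hcx.eventually h2, extChartAt_source_mem_nhds (I := I₁) x₀]
    with x h1 h2 hx v hv
  have h3 := h1 (md I₁ 𝓘(ℝ, E₁) (extChartAt I₁ x₀) x v)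
  have h4 := h2 (md I₁ 𝓘(ℝ, E₁) (extChartAt I₁ x₀) x v)
  rw [gram_chart_apply F hx (hF.mdifferentiableAt (by simp))] at h4
  have h5 := gram_chart_apply (b := g) (I := I₁) (id : M → M) hx mdifferentiableAt_id v
  rw [md_id] at h5
  have h6 : gram I₁ g (extChartAt I₁ x₀).symm (extChartAt I₁ x₀ x)
    (md I₁ 𝓘(ℝ, E₁) (extChartAt I₁ x₀) x v) (md I₁ 𝓘(ℝ, E₁) (extChartAt I₁ x₀) x v) =
      bil g x v v := h5
  rw [h6] at h3
  have h7 : ∀ i, inChart I₁ η x₀ (extChartAt I₁ x₀ x)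
      ![md I₁ 𝓘(ℝ, E₁) (extChartAt I₁ x₀) x v, e i] = 0 := fun i => by
    rw [inChart_apply_two, md_symm_comp_chart hx]
    have h8 := (extChartAt I₁ x₀).left_inv hx
    rw [h8]
    exact hv _
  simp only [h7, zero_pow two_ne_zero, Finset.sum_const_zero, add_zero] at h4
  rw [div_mul_eq_mul_div, le_div_iff₀ hc0]
  nlinarith

end Bounds

section CotangentMap

variable {E : Type*} [NormedAddCommGroup E] [NormedSpace ℝ E] [FiniteDimensional ℝ E]
  {H : Type*} [TopologicalSpace H] {I : ModelWithCorners ℝ E H} [I.Boundaryless]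
  {Q : Type*} [TopologicalSpace Q] [ChartedSpace H Q] [IsManifold I ∞ Q]
  {Q' : Type*} [TopologicalSpace Q'] [ChartedSpace H Q'] [IsManifold I ∞ Q']

theorem md_partialDiffeomorph_left (Φ : PartialDiffeomorph I I Q' Q ∞) {x : Q'} (hx : x ∈ Φ.source)
    (v : E) : md I I Φ.symm (Φ x) (md I I Φ x v) = v := by
  have h1 := md_comp (x := x) (Φ.symm.mdifferentiableAt (by simp) (Φ.map_source hx))
    (Φ.mdifferentiableAt (by simp) hx)
  rw [md_congr (I₁ := I) (I₂ := I) (g := id), md_id] at h1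
  · exact (congrArg (fun A : E →L[ℝ] E => A v) h1).symm
  · filter_upwards [Φ.open_source.mem_nhds hx] with y hy
    exact Φ.left_inv hy

theorem md_partialDiffeomorph_right (Φ : PartialDiffeomorph I I Q' Q ∞) {x : Q'}
    (hx : x ∈ Φ.source) (v : E) : md I I Φ x (md I I Φ.symm (Φ x) v) = v := by
  have h1 := md_partialDiffeomorph_left Φ.symm (Φ.map_source hx) v
  have h2 : Φ.symm (Φ x) = x := Φ.left_inv hx
  rwa [h2] at h1

theorem md_partialDiffeomorph_inverse (Φ : PartialDiffeomorph I I Q' Q ∞) {x : Q'}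
    (hx : x ∈ Φ.source) : (md I I Φ x).inverse = md I I Φ.symm (Φ x) := by
  let e : E ≃L[ℝ] E := ContinuousLinearEquiv.equivOfInverse (md I I Φ x) (md I I Φ.symm (Φ x))
    (md_partialDiffeomorph_left Φ hx) (md_partialDiffeomorph_right Φ hx)
  exact ContinuousLinearMap.inverse_equiv e

theorem cotangentMap_congr {f g : Q' → Q} {u : Cotangent I Q'} (h : f =ᶠ[𝓝 (proj I u)] g) :
    cotangentMap I f u = cotangentMap I g u := by
  refine cotangent_ext h.self_of_nhds fun v => ?_
  change fib u ((md I I f (proj I u)).inverse v) = fib u ((md I I g (proj I u)).inverse v)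
  rw [md_congr h]

theorem cotCoord_cotangentMap (Φ : PartialDiffeomorph I I Q' Q ∞) {q₀ : Q} {q₁ : Q'}
    {u : Cotangent I Q'} (hu : proj I u ∈ Φ.source) (h₁ : proj I u ∈ (extChartAt I q₁).source)
    (h₀ : Φ (proj I u) ∈ (extChartAt I q₀).source) :
    cotCoord I q₀ (cotangentMap I Φ u) =
      (extChartAt I q₀ (Φ ((extChartAt I q₁).symm (cotCoord I q₁ u).1)),
        (cotCoord I q₁ u).2 ∘L fderiv ℝ (extChartAt I q₁ ∘ Φ.symm ∘ (extChartAt I q₀).symm)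
          (extChartAt I q₀ (Φ ((extChartAt I q₁).symm (cotCoord I q₁ u).1)))) := by
  have e1 : (extChartAt I q₁).symm (cotCoord I q₁ u).1 = proj I u := (extChartAt I q₁).left_inv h₁
  rw [e1]
  refine Prod.ext rfl (ContinuousLinearMap.ext fun v => ?_)
  have e0 : (extChartAt I q₀).symm (extChartAt I q₀ (Φ (proj I u))) = Φ (proj I u) :=
    (extChartAt I q₀).left_inv h₀
  have e2 : Φ.symm (Φ (proj I u)) = proj I u := Φ.left_inv hu
  have d0 : MDifferentiableAt 𝓘(ℝ, E) I (extChartAt I q₀).symm (extChartAt I q₀ (Φ (proj I u))) :=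
    (contMDiffAt_chart_symm ((extChartAt I q₀).map_source h₀)).mdifferentiableAt (by simp)
  have d1 : MDifferentiableAt I I Φ.symm
      ((extChartAt I q₀).symm (extChartAt I q₀ (Φ (proj I u)))) := by
    rw [e0]; exact Φ.symm.mdifferentiableAt (by simp) (Φ.map_source hu)
  have d2 : MDifferentiableAt I 𝓘(ℝ, E) (extChartAt I q₁)
      ((Φ.symm ∘ (extChartAt I q₀).symm) (extChartAt I q₀ (Φ (proj I u)))) := by
    simp only [Function.comp_apply]
    rw [e0, e2]
    exact (contMDiffAt_chart h₁).mdifferentiableAt (by simp)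
  have h3 : fderiv ℝ (extChartAt I q₁ ∘ Φ.symm ∘ (extChartAt I q₀).symm)
      (extChartAt I q₀ (Φ (proj I u))) = (md I 𝓘(ℝ, E) (extChartAt I q₁) (proj I u)).comp
        ((md I I Φ.symm (Φ (proj I u))).comp
          (md 𝓘(ℝ, E) I (extChartAt I q₀).symm (extChartAt I q₀ (Φ (proj I u))))) := by
    rw [← md_eq_fderiv, md_comp d2 (d1.comp _ d0), md_comp d1 d0]
    simp only [Function.comp_apply]
    rw [e0, e2]
  rw [h3]
  change fib u ((md I I Φ (proj I u)).inverse _) =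
    fib u (md 𝓘(ℝ, E) I (extChartAt I q₁).symm (extChartAt I q₁ (proj I u))
      (md I 𝓘(ℝ, E) (extChartAt I q₁) (proj I u) _))
  rw [md_symm_comp_chart h₁, md_partialDiffeomorph_inverse Φ hu]
  rfl

theorem contMDiffAt_cotangentMap (Φ : PartialDiffeomorph I I Q' Q ∞) {u : Cotangent I Q'}
    (hu : proj I u ∈ Φ.source) :
    ContMDiffAt (I.prod 𝓘(ℝ, E →L[ℝ] ℝ)) (I.prod 𝓘(ℝ, E →L[ℝ] ℝ)) ∞ (cotangentMap I Φ) u := by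
  set q₁ := proj I u
  set q₀ := Φ q₁
  have c1 : ContinuousAt (proj I (Q := Q')) u := contMDiff_proj.continuous.continuousAt
  have hΦ : ContMDiffAt I I ∞ Φ q₁ := Φ.contMDiffOn.contMDiffAt (Φ.open_source.mem_nhds hu)
  have hΦ' : ContMDiffAt I I ∞ Φ.symm q₀ :=
    Φ.symm.contMDiffOn.contMDiffAt (Φ.open_target.mem_nhds (Φ.map_source hu))
  have n1 : ∀ᶠ y in 𝓝 u, proj I y ∈ Φ.source :=
    c1.eventually (Φ.open_source.mem_nhds hu)
  have n2 : ∀ᶠ y in 𝓝 u, proj I y ∈ (extChartAt I q₁).source :=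
    c1.eventually (extChartAt_source_mem_nhds q₁)
  have n3 : ∀ᶠ y in 𝓝 u, Φ (proj I y) ∈ (extChartAt I q₀).source :=
    (hΦ.continuousAt.comp c1).eventually (extChartAt_source_mem_nhds q₀)
  refine (contMDiffAt_cotangent_iff n3).2 ?_
  have e : (fun y => cotCoord I q₀ (cotangentMap I Φ y)) =ᶠ[𝓝 u]
      (fun z : E × (E →L[ℝ] ℝ) => (extChartAt I q₀ (Φ ((extChartAt I q₁).symm z.1)),
        z.2 ∘L fderiv ℝ (extChartAt I q₁ ∘ Φ.symm ∘ (extChartAt I q₀).symm)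
          (extChartAt I q₀ (Φ ((extChartAt I q₁).symm z.1))))) ∘ cotCoord I q₁ := by
    filter_upwards [n1, n2, n3] with y h1 h2 h3
    exact cotCoord_cotangentMap Φ h1 h2 h3
  refine ContMDiffAt.congr_of_eventuallyEq ?_ e
  have hinv : (extChartAt I q₁).symm (extChartAt I q₁ q₁) = q₁ := extChartAt_to_inv _
  have hF : ContDiffAt ℝ ∞ (fun x : E => extChartAt I q₀ (Φ ((extChartAt I q₁).symm x)))
      (extChartAt I q₁ q₁) := by
    refine ContMDiffAt.contDiffAt ?_
    have s1 : ContMDiffAt 𝓘(ℝ, E) I ∞ (extChartAt I q₁).symm (extChartAt I q₁ q₁) :=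
      contMDiffAt_chart_symm (mem_extChartAt_target _)
    have s2 : ContMDiffAt I 𝓘(ℝ, E) ∞ (extChartAt I q₀) q₀ :=
      contMDiffAt_chart (mem_extChartAt_source _)
    exact (s2.comp q₁ hΦ).comp_of_eq s1 hinv
  have hG : ContDiffAt ℝ ∞ (extChartAt I q₁ ∘ Φ.symm ∘ (extChartAt I q₀).symm)
      (extChartAt I q₀ q₀) := by
    refine ContMDiffAt.contDiffAt ?_
    have s1 : ContMDiffAt 𝓘(ℝ, E) I ∞ (extChartAt I q₀).symm (extChartAt I q₀ q₀) :=
      contMDiffAt_chart_symm (mem_extChartAt_target _)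
    have s2 : ContMDiffAt I 𝓘(ℝ, E) ∞ (extChartAt I q₁) q₁ :=
      contMDiffAt_chart (mem_extChartAt_source _)
    have e2 : Φ.symm q₀ = q₁ := Φ.left_inv hu
    exact (s2.comp_of_eq hΦ' e2).comp_of_eq s1 (extChartAt_to_inv _)
  have hG' := (hG.fderiv_right (m := ∞) (by simp))
  have hz : (cotCoord I q₁ u).1 = extChartAt I q₁ q₁ := rfl
  have hF1 : ContDiffAt ℝ ∞ (fun z : E × (E →L[ℝ] ℝ) =>
      extChartAt I q₀ (Φ ((extChartAt I q₁).symm z.1))) (cotCoord I q₁ u) :=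
    ContDiffAt.comp (f := Prod.fst) (cotCoord I q₁ u) hF contDiffAt_fst
  have hK : ContDiffAt ℝ ∞ (fun z : E × (E →L[ℝ] ℝ) =>
      (extChartAt I q₀ (Φ ((extChartAt I q₁).symm z.1)),
        z.2 ∘L fderiv ℝ (extChartAt I q₁ ∘ Φ.symm ∘ (extChartAt I q₀).symm)
          (extChartAt I q₀ (Φ ((extChartAt I q₁).symm z.1))))) (cotCoord I q₁ u) := by
    refine hF1.prodMk (contDiffAt_snd.clm_comp ?_)
    refine ContDiffAt.comp (g := fderiv ℝ (extChartAt I q₁ ∘ Φ.symm ∘ (extChartAt I q₀).symm))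
      (cotCoord I q₁ u) ?_ hF1
    rw [hz, hinv]
    exact hG'
  exact hK.contMDiffAt.comp u (contMDiffAt_cotCoord (mem_extChartAt_source _))

theorem cotangentMap_symm (Φ : PartialDiffeomorph I I Q' Q ∞) {u : Cotangent I Q'}
    (hu : proj I u ∈ Φ.source) : cotangentMap I Φ.symm (cotangentMap I Φ u) = u := by
  refine cotangent_ext (Φ.left_inv hu) fun v => ?_
  change fib u ((md I I Φ (proj I u)).inverse ((md I I Φ.symm (Φ (proj I u))).inverse v)) = fib u v
  have h1 := md_partialDiffeomorph_inverse Φ.symm (Φ.map_source hu)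
  have h2 : Φ.symm (Φ (proj I u)) = proj I u := Φ.left_inv hu
  rw [h2] at h1
  rw [md_partialDiffeomorph_inverse Φ hu]
  refine congrArg (fib u) (Eq.trans ?_ (md_partialDiffeomorph_left Φ hu v))
  exact congrArg (fun A : E →L[ℝ] E => md I I Φ.symm (Φ (proj I u)) (A v)) h1

/-- The partial diffeomorphism of cotangent bundles induced by a partial diffeomorphism. -/
def cotangentDiffeo (Φ : PartialDiffeomorph I I Q' Q ∞) :
    PartialDiffeomorph (I.prod 𝓘(ℝ, E →L[ℝ] ℝ)) (I.prod 𝓘(ℝ, E →L[ℝ] ℝ))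
      (Cotangent I Q') (Cotangent I Q) ∞ where
  toFun := cotangentMap I Φ
  invFun := cotangentMap I Φ.symm
  source := proj I ⁻¹' Φ.source
  target := proj I ⁻¹' Φ.target
  map_source' _ hu := Φ.map_source hu
  map_target' _ hu := Φ.map_target hu
  left_inv' _ hu := cotangentMap_symm Φ hu
  right_inv' _ hu := cotangentMap_symm Φ.symm hu
  open_source := Φ.open_source.preimage contMDiff_proj.continuous
  open_target := Φ.open_target.preimage contMDiff_proj.continuous
  contMDiffOn_toFun _ hu := (contMDiffAt_cotangentMap Φ hu).contMDiffWithinAt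
  contMDiffOn_invFun _ hu := (contMDiffAt_cotangentMap Φ.symm hu).contMDiffWithinAt

theorem exists_cotangentDiffeo {μ : Q' → Q} (hμ : IsLocalDiffeomorph I I ∞ μ)
    (u : Cotangent I Q') : ∃ Ψ : PartialDiffeomorph (I.prod 𝓘(ℝ, E →L[ℝ] ℝ))
      (I.prod 𝓘(ℝ, E →L[ℝ] ℝ)) (Cotangent I Q') (Cotangent I Q) ∞,
      (∃ O : Set Q', IsOpen O ∧ proj I u ∈ O ∧ Ψ.source = proj I ⁻¹' O) ∧
        EqOn (cotangentMap I μ) Ψ Ψ.source := by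
  obtain ⟨Φ, hx, he⟩ := hμ (proj I u)
  refine ⟨cotangentDiffeo Φ, ⟨Φ.source, Φ.open_source, hx, rfl⟩, fun w hw => ?_⟩
  exact cotangentMap_congr (he.eventuallyEq_of_mem (Φ.open_source.mem_nhds hw))

theorem isLocalDiffeomorph_cotangentMap {μ : Q' → Q} (hμ : IsLocalDiffeomorph I I ∞ μ) :
    IsLocalDiffeomorph (I.prod 𝓘(ℝ, E →L[ℝ] ℝ)) (I.prod 𝓘(ℝ, E →L[ℝ] ℝ)) ∞
      (cotangentMap I μ) := fun u => by
  obtain ⟨Ψ, ⟨O, -, hO, hs⟩, he⟩ := exists_cotangentDiffeo hμ u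
  exact ⟨Ψ, by rw [hs]; exact hO, he⟩

theorem continuousAt_of_cotangentMap {Z : Type*} [TopologicalSpace Z] {μ : Q' → Q}
    (hμ : IsLocalDiffeomorph I I ∞ μ) {g : Z → Cotangent I Q'} {z : Z}
    (h1 : ContinuousAt (fun z => cotangentMap I μ (g z)) z)
    (h2 : ContinuousAt (fun z => proj I (g z)) z) : ContinuousAt g z := by
  obtain ⟨Ψ, ⟨O, hOo, hO, hs⟩, he⟩ := exists_cotangentDiffeo hμ (g z)
  have n : ∀ᶠ y in 𝓝 z, g y ∈ Ψ.source := by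
    rw [hs]; exact h2.eventually (hOo.mem_nhds hO)
  have e : g =ᶠ[𝓝 z] fun y => Ψ.symm (cotangentMap I μ (g y)) := by
    filter_upwards [n] with y hy
    rw [he hy]; exact (Ψ.left_inv hy).symm
  refine ContinuousAt.congr ?_ e.symm
  refine ContinuousAt.comp (f := fun z => cotangentMap I μ (g z)) ?_ h1
  rw [he n.self_of_nhds]
  exact (Ψ.symm.contMDiffOn.contMDiffAt
    (Ψ.open_target.mem_nhds (Ψ.map_source n.self_of_nhds))).continuousAt

/-- The lift to `T^*Q'` of a covector on `Q`. -/
def liftCovector (μ : Q' → Q) (w : Cotangent I Q) (x : Q') : Cotangent I Q' :=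
  ⟨x, (fib w ∘L md I I μ x : E →L[ℝ] ℝ)⟩

theorem cotangentMap_liftCovector {μ : Q' → Q} (hμ : IsLocalDiffeomorph I I ∞ μ)
    {w : Cotangent I Q} {x : Q'} (hx : μ x = proj I w) :
    cotangentMap I μ (liftCovector μ w x) = w := by
  refine cotangent_ext hx fun v => ?_
  change fib w (md I I μ x ((md I I μ x).inverse v)) = fib w v
  rw [(md_inverse_apply hμ _ v).1]

theorem liftCovector_cotangentMap {μ : Q' → Q} (hμ : IsLocalDiffeomorph I I ∞ μ)
    (u : Cotangent I Q') : liftCovector μ (cotangentMap I μ u) (proj I u) = u := by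
  refine cotangent_ext rfl fun v => ?_
  change fib u ((md I I μ (proj I u)).inverse (md I I μ (proj I u) v)) = fib u v
  rw [(md_inverse_apply hμ _ v).2]

theorem isCoveringMap_cotangentMap {μ : Q' → Q} (hμ : IsSmoothCovering I μ) :
    IsCoveringMap (cotangentMap I μ) := by
  intro w
  have hl := hμ.isLocalDiffeomorph
  have hc : Continuous (cotangentMap I μ) := (isLocalDiffeomorph_cotangentMap hl).contMDiff.continuous
  have hp : Continuous (proj I (Q := Q)) := contMDiff_proj.continuous
  have hp' : Continuous (proj I (Q := Q')) := contMDiff_proj.continuous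
  obtain ⟨hdisc, U, hxU, hU, hU', T, hT⟩ := hμ.isCoveringMap (proj I w)
  refine IsEvenlyCovered.to_isEvenlyCovered_preimage (I := μ ⁻¹' {proj I w}) ?_
  have hsymm : ∀ (y : U) i, μ (T.symm (y, i)).1 = y.1 := fun y i => by
    rw [← hT, T.apply_symm_apply]
  refine ⟨hdisc, proj I ⁻¹' U, hxU, hU.preimage hp, (hU.preimage hp).preimage hc, ?_⟩
  let inv : (proj I ⁻¹' U : Set (Cotangent I Q)) × (μ ⁻¹' {proj I w}) → Cotangent I Q' := fun z =>
    liftCovector μ z.1.1 (T.symm (⟨proj I z.1.1, z.1.2⟩, z.2)).1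
  have hinv : ∀ z, cotangentMap I μ (inv z) = z.1.1 := fun z =>
    cotangentMap_liftCovector hl (hsymm _ _)
  have hcinv : Continuous inv := by
    refine continuous_iff_continuousAt.2 fun z => continuousAt_of_cotangentMap hl ?_ ?_
    · simp only [hinv]
      exact (continuous_subtype_val.comp continuous_fst).continuousAt
    · have : Continuous fun z : (proj I ⁻¹' U : Set (Cotangent I Q)) × (μ ⁻¹' {proj I w}) =>
          ((⟨proj I z.1.1, z.1.2⟩ : U), z.2) :=
        ((hp.comp (continuous_subtype_val.comp continuous_fst)).subtype_mk _).prodMk continuous_snd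
      exact (continuous_subtype_val.comp (T.symm.continuous.comp this)).continuousAt
  refine ⟨⟨⟨fun u => (⟨cotangentMap I μ u.1, u.2⟩, (T ⟨proj I u.1, u.2⟩).2),
    fun z => ⟨inv z, ?_⟩, fun u => ?_, fun z => ?_⟩, ?_, ?_⟩, fun u => rfl⟩
  · change proj I (cotangentMap I μ (inv z)) ∈ U
    rw [hinv]; exact z.1.2
  · refine Subtype.ext ?_
    have e1 : T.symm (⟨proj I (cotangentMap I μ u.1), u.2⟩, (T ⟨proj I u.1, u.2⟩).2) =
        ⟨proj I u.1, u.2⟩ := by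
      rw [Homeomorph.symm_apply_eq]
      exact Prod.ext (Subtype.ext (hT ⟨proj I u.1, u.2⟩).symm) rfl
    change liftCovector μ (cotangentMap I μ u.1) (T.symm _).1 = u.1
    rw [e1]
    exact liftCovector_cotangentMap hl u.1
  · refine Prod.ext (Subtype.ext (hinv z)) ?_
    change (T (T.symm _)).2 = z.2
    rw [T.apply_symm_apply]
  · exact (((hc.comp continuous_subtype_val).subtype_mk _).prodMk
      (continuous_snd.comp (T.continuous.comp ((hp'.comp continuous_subtype_val).subtype_mk _))))
  · exact hcinv.subtype_mk _

theorem surjective_cotangentMap {μ : Q' → Q} (hμ : IsSmoothCovering I μ) :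
    Function.Surjective (cotangentMap I μ) := by
  intro w
  obtain ⟨x, hx⟩ := hμ.surjective (proj I w)
  exact ⟨liftCovector μ w x, cotangentMap_liftCovector hμ.isLocalDiffeomorph hx⟩

end CotangentMap

section Restrict

variable {E : Type*} [NormedAddCommGroup E] [NormedSpace ℝ E]
  {H : Type*} [TopologicalSpace H] {J : ModelWithCorners ℝ E H} [J.Boundaryless]
  {N : Type*} [TopologicalSpace N] [ChartedSpace H N] [IsManifold J ∞ N] {d : ℕ}
  {N' : Type*} [TopologicalSpace N'] [ChartedSpace H N'] [IsManifold J ∞ N']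
  {S : Set N} [ChartedSpace (EuclideanSpace ℝ (Fin d)) S]
  {S' : Set N'} [ChartedSpace (EuclideanSpace ℝ (Fin d)) S']

/-- A local diffeomorphism restricts to the preimage of a submanifold. -/
theorem isLocalDiffeomorph_restrict (hS : IsSubmanifoldStructure J d S)
    (hS' : IsSubmanifoldStructure J d S') {P : N' → N} (hP : IsLocalDiffeomorph J J ∞ P)
    {p : S' → S} (hp : ∀ s, (p s : N) = P s) (hPS : ∀ u, P u ∈ S → u ∈ S') :
    IsLocalDiffeomorph (𝓡 d) (𝓡 d) ∞ p := by
  classical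
  intro s₀
  obtain ⟨Φ, hs₀, he⟩ := hP s₀
  let inv : S → S' := fun s => if h : Φ.symm s ∈ S' then ⟨Φ.symm s, h⟩ else s₀
  have hinv : ∀ s : S, (s : N) ∈ Φ.target → (inv s : N') = Φ.symm s := fun s hs => by
    have h1 : P (Φ.symm s) = s := (he (Φ.map_target hs)).trans (Φ.right_inv hs)
    have h2 : Φ.symm s ∈ S' := hPS _ (by rw [h1]; exact s.2)
    simp only [inv, dif_pos h2]
  have ho : IsOpen (Subtype.val ⁻¹' Φ.source : Set S') := Φ.open_source.preimage continuous_subtype_val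
  have ho' : IsOpen (Subtype.val ⁻¹' Φ.target : Set S) := Φ.open_target.preimage continuous_subtype_val
  have hpe : ∀ s : S', (s : N') ∈ Φ.source → (p s : N) = Φ s := fun s hs => (hp s).trans (he hs)
  refine ⟨⟨⟨p, inv, Subtype.val ⁻¹' Φ.source, Subtype.val ⁻¹' Φ.target, fun s hs => ?_,
    fun s hs => ?_, fun s hs => ?_, fun s hs => ?_⟩, ho, ho', fun s hs => ?_, fun s hs => ?_⟩,
    hs₀, fun _ _ => rfl⟩
  · change (p s : N) ∈ Φ.target
    rw [hpe s hs]; exact Φ.map_source hs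
  · change (inv s : N') ∈ Φ.source
    rw [hinv s hs]; exact Φ.map_target hs
  · refine Subtype.ext ?_
    have h1 : (p s : N) ∈ Φ.target := by rw [hpe s hs]; exact Φ.map_source hs
    rw [hinv _ h1, hpe s hs]; exact Φ.left_inv hs
  · refine Subtype.ext ?_
    have h1 : (inv s : N') ∈ Φ.source := by rw [hinv s hs]; exact Φ.map_target hs
    rw [hpe _ h1, hinv s hs]; exact Φ.right_inv hs
  · refine ContMDiffAt.contMDiffWithinAt (hS.contMDiffAt_iff.2 ?_)
    simp only [hp]
    exact hP.contMDiff.contMDiffAt.comp s (hS'.contMDiff s)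
  · refine ContMDiffAt.contMDiffWithinAt (hS'.contMDiffAt_iff.2 ?_)
    have h1 : ContMDiffAt (𝓡 d) J ∞ (fun y : S => Φ.symm (y : N)) s :=
      (Φ.symm.contMDiffOn.contMDiffAt (Φ.open_target.mem_nhds hs)).comp s (hS.contMDiff s)
    refine h1.congr_of_eventuallyEq ?_
    filter_upwards [ho'.mem_nhds hs] with y hy using hinv y hy

end Restrict

section Lift

variable {E : Type*} [NormedAddCommGroup E] [NormedSpace ℝ E] [FiniteDimensional ℝ E]
  {H : Type*} [TopologicalSpace H] {I : ModelWithCorners ℝ E H} [I.Boundaryless]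
  {Q : Type*} [TopologicalSpace Q] [ChartedSpace H Q] [IsManifold I ∞ Q]
  {Q' : Type*} [TopologicalSpace Q'] [ChartedSpace H Q'] [IsManifold I ∞ Q'] {d : ℕ}

theorem inChart_zero {k : ℕ} (x : Q) : inChart I (0 : DiffForm I Q k) x = 0 := rfl

theorem smoothFormAt_zero {k : ℕ} (x : Q) : SmoothFormAt I (0 : DiffForm I Q k) x :=
  contDiffAt_const (c := (0 : E [⋀^Fin k]→L[ℝ] ℝ))

theorem extD_zero {k : ℕ} : extD I (0 : DiffForm I Q k) = 0 := by
  funext x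
  refine (extD_apply_self _ x).trans ?_
  rw [inChart_zero]
  have : extDeriv (0 : E → E [⋀^Fin k]→L[ℝ] ℝ) (extChartAt I x x) = 0 := by
    have h1 : fderiv ℝ (0 : E → E [⋀^Fin k]→L[ℝ] ℝ) (extChartAt I x x) = 0 := by simp
    rw [extDeriv, h1]
    exact map_zero (ContinuousAlternatingMap.alternatizeUncurryFinCLM ℝ E ℝ)
  exact this

theorem oneForm_ext {α β : E [⋀^Fin 1]→L[ℝ] ℝ} (h : ∀ v, α ![v] = β ![v]) : α = β := by
  refine ContinuousAlternatingMap.ext fun w => ?_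
  have hw : w = ![w 0] := by ext i; fin_cases i; rfl
  rw [hw]; exact h _

theorem twoForm_ext {α β : E [⋀^Fin 2]→L[ℝ] ℝ} (h : ∀ v w, α ![v, w] = β ![v, w]) : α = β := by
  refine ContinuousAlternatingMap.ext fun w => ?_
  have hw : w = ![w 0, w 1] := by ext i; fin_cases i <;> rfl
  rw [hw]; exact h _ _

theorem md_proj_val {S : Set (Cotangent I Q)} [ChartedSpace (EuclideanSpace ℝ (Fin d)) S]
    (hS : IsSubmanifoldStructure (I.prod 𝓘(ℝ, E →L[ℝ] ℝ)) d S) (s : S)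
    (v : EuclideanSpace ℝ (Fin d)) :
    md (𝓡 d) I (fun s : S => proj I s.1) s v = (dval I s v).1 := by
  have h := md_comp (x := s) ((contMDiff_proj (I := I) (Q := Q)).mdifferentiableAt (by simp))
    ((hS.contMDiff s).mdifferentiableAt (by simp))
  exact (congrArg (fun A : EuclideanSpace ℝ (Fin d) →L[ℝ] E => A v) h).trans (mfderiv_proj_self s.1 _)

variable (h : RiemMetric I Q) (V : Q → ℝ) {μ : Q' → Q} {k : ℝ}
  [ChartedSpace (EuclideanSpace ℝ (Fin d)) (energySurface I h V k)]
  [ChartedSpace (EuclideanSpace ℝ (Fin d)) (liftedEnergySurface I μ h V k)]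

section

variable {h V} (hS : IsSubmanifoldStructure (I.prod 𝓘(ℝ, E →L[ℝ] ℝ)) d (energySurface I h V k))
  (hS' : IsSubmanifoldStructure (I.prod 𝓘(ℝ, E →L[ℝ] ℝ)) d (liftedEnergySurface I μ h V k))
include hS hS'

theorem isSmoothCovering_energyProj (hμ : IsSmoothCovering I μ) :
    IsSmoothCovering (𝓡 d) (energyProj I μ h V k) where
  isCoveringMap := (isCoveringMap_cotangentMap hμ).restrictPreimage (energySurface I h V k)
  surjective s := by
    obtain ⟨u, hu⟩ := surjective_cotangentMap hμ s.1
    refine ⟨⟨u, ?_⟩, Subtype.ext hu⟩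
    change cotangentMap I μ u ∈ energySurface I h V k
    rw [hu]; exact s.2
  isLocalDiffeomorph := isLocalDiffeomorph_restrict hS hS'
    (isLocalDiffeomorph_cotangentMap hμ.isLocalDiffeomorph) (fun _ => rfl) fun _ hu => hu

theorem dval_energyProj (hμ : IsSmoothCovering I μ) (s : liftedEnergySurface I μ h V k)
    (v : EuclideanSpace ℝ (Fin d)) :
    (dval I (energyProj I μ h V k s) (md (𝓡 d) (𝓡 d) (energyProj I μ h V k) s v)).1 =
      md I I μ (proj I s.1) (dval I s v).1 := by
  have := hS.isManifold
  have := hS'.isManifold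
  have hp := (isSmoothCovering_energyProj hS hS' hμ).isLocalDiffeomorph.contMDiff
  have hp1 : ContMDiff (𝓡 d) I ∞ fun s : energySurface I h V k => proj I s.1 :=
    contMDiff_proj.comp hS.contMDiff
  have hp2 : ContMDiff (𝓡 d) I ∞ fun s : liftedEnergySurface I μ h V k => proj I s.1 :=
    contMDiff_proj.comp hS'.contMDiff
  have h1 := md_comp (x := s) (hp1.mdifferentiableAt (by simp)) (hp.mdifferentiableAt (by simp))
  have h2 := md_comp (x := s) (hμ.isLocalDiffeomorph.contMDiff.mdifferentiableAt (by simp))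
    (hp2.mdifferentiableAt (by simp))
  rw [← md_proj_val hS, ← md_proj_val hS']
  exact congrArg (fun A : EuclideanSpace ℝ (Fin d) →L[ℝ] E => A v) (h1.symm.trans h2)

theorem pullback_restrictedPrimitive (hμ : IsSmoothCovering I μ) (θ : DiffForm I Q 1) :
    pullbackForm (𝓡 d) (𝓡 d) (energyProj I μ h V k) (restrictedPrimitive I θ _) =
      restrictedPrimitive I (pullbackForm I I μ θ) (liftedEnergySurface I μ h V k) := by
  funext s
  refine oneForm_ext (E := EuclideanSpace ℝ (Fin d)) fun w => ?_
  have h1 : frm (pullbackForm (𝓡 d) (𝓡 d) (energyProj I μ h V k) (restrictedPrimitive I θ _)) s ![w]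
      = frm (restrictedPrimitive I θ _) (energyProj I μ h V k s)
        ![md (𝓡 d) (𝓡 d) (energyProj I μ h V k) s w] := by
    change frm (restrictedPrimitive I θ _) (energyProj I μ h V k s) _ = _
    congr 1
    ext i; fin_cases i; rfl
  have h2 : cov (pullbackForm I I μ θ) (proj I s.1) (dval I s w).1 =
      cov θ (μ (proj I s.1)) (md I I μ (proj I s.1) (dval I s w).1) := rfl
  have h3 := restrictedPrimitive_apply (pullbackForm I I μ θ) s w
  rw [restrictedPrimitive_apply, dval_energyProj hS hS' hμ] at h1
  refine h1.trans (Eq.trans ?_ h3.symm)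
  rw [h2]
  refine congrArg₂ (· + ·) ?_ rfl
  change fib s.1 ((md I I μ (proj I s.1)).inverse (md I I μ (proj I s.1) _)) = _
  rw [(md_inverse_apply hμ.isLocalDiffeomorph _ _).2]

theorem pullback_restrictedTwisted (hμ : IsSmoothCovering I μ) {σ : DiffForm I Q 2}
    {θ : DiffForm I Q' 1} (hθ : IsSmoothForm I θ) (hθσ : extD I θ = pullbackForm I I μ σ) :
    pullbackForm (𝓡 d) (𝓡 d) (energyProj I μ h V k) (restrictedTwisted I σ _) =
      extD (𝓡 d) (restrictedPrimitive I θ (liftedEnergySurface I μ h V k)) := by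
  have := hS.isManifold
  have := hS'.isManifold
  have hp := (isSmoothCovering_energyProj hS hS' hμ).isLocalDiffeomorph.contMDiff
  funext s
  refine Eq.trans ?_ (extD_restrictedPrimitive hS' (isSmoothForm_iff.1 hθ _)).symm
  rw [hθσ]
  have h0 : pullbackForm (𝓡 d) (𝓡 d) (energyProj I μ h V k)
      (restrictedTwisted I (0 : DiffForm I Q 2) _) s =
      restrictedTwisted I (0 : DiffForm I Q' 2) (liftedEnergySurface I μ h V k) s := by
    have e1 := extD_pullbackForm (hp s) (smoothFormAt_restrictedPrimitive hS
      (smoothFormAt_zero (I := I) (proj I (energyProj I μ h V k s).1)))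
    have e2 := extD_restrictedPrimitive hS' (s := s) (smoothFormAt_zero (I := I) (Q := Q') (k := 1) _)
    have e3 := extD_restrictedPrimitive hS (s := energyProj I μ h V k s)
      (smoothFormAt_zero (I := I) (Q := Q) (k := 1) _)
    rw [pullback_restrictedPrimitive hS hS' hμ] at e1
    rw [extD_zero] at e2 e3
    have e4 : pullbackForm I I μ (0 : DiffForm I Q 1) = 0 := rfl
    rw [e4] at e1
    unfold pullbackForm at e1 ⊢
    rw [e3] at e1
    exact e1.symm.trans e2
  refine twoForm_ext (E := EuclideanSpace ℝ (Fin d)) fun w w' => ?_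
  have h1 : ∀ η : DiffForm I Q 2,
      frm (pullbackForm (𝓡 d) (𝓡 d) (energyProj I μ h V k) (restrictedTwisted I η _)) s ![w, w']
      = frm (restrictedTwisted I η _) (energyProj I μ h V k s)
        ![md (𝓡 d) (𝓡 d) (energyProj I μ h V k) s w,
          md (𝓡 d) (𝓡 d) (energyProj I μ h V k) s w'] := fun η => by
    change frm (restrictedTwisted I η _) (energyProj I μ h V k s) _ = _
    congr 1
    ext i; fin_cases i <;> rfl
  have h2 := (h1 0).symm.trans (congrArg
    (fun A : EuclideanSpace ℝ (Fin d) [⋀^Fin 2]→L[ℝ] ℝ => A ![w, w']) h0)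
  have h3 := restrictedTwisted_apply (0 : DiffForm I Q' 2) s w w'
  have h4 := restrictedTwisted_apply (pullbackForm I I μ σ) s w w'
  have h5 : frm (pullbackForm I I μ σ) (proj I s.1) ![(dval I s w).1, (dval I s w').1] =
      frm σ (μ (proj I s.1)) ![md I I μ (proj I s.1) (dval I s w).1,
        md I I μ (proj I s.1) (dval I s w').1] := by
    change frm σ (μ (proj I s.1)) _ = _
    congr 1
    ext i; fin_cases i <;> rfl
  have h6 := h2.trans h3
  refine (h1 σ).trans (Eq.trans ?_ h4.symm)
  rw [restrictedTwisted_apply] at h6 ⊢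
  simp only [twist, dval_energyProj hS hS' hμ] at h6 ⊢
  rw [h5]
  refine congrArg₂ (· + ·) ?_ rfl
  exact (add_zero _).symm.trans (h6.trans (add_zero _))

end

end Lift

section Estimates

variable {E : Type*} [NormedAddCommGroup E] [NormedSpace ℝ E] [FiniteDimensional ℝ E]
  {H : Type*} [TopologicalSpace H] {I : ModelWithCorners ℝ E H} [I.Boundaryless]
  {Q : Type*} [TopologicalSpace Q] [ChartedSpace H Q] [IsManifold I ∞ Q]
  {b : ∀ x : Q, TangentSpace I x →L[ℝ] TangentSpace I x →L[ℝ] ℝ} {V : Q → ℝ}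

theorem energy_toSection (θ : DiffForm I Q 1) (q : Q) : energy I b V (toSection I θ q) =
    1 / 2 * cov θ q ((bil b q).inverse (cov θ q)) + V q := rfl

theorem sharp_ne_zero (hb : IsMetric I b) {u : Cotangent I Q} (hu : fib u ≠ 0) :
    sharp b u ≠ 0 := by
  intro h0
  have h1 := apply_inverse_apply (hb.pos (proj I u)) (fib u)
  rw [show (bil b (proj I u)).inverse (fib u) = 0 from h0, map_zero] at h1
  exact hu h1.symm

theorem bil_sharp (hb : IsMetric I b) (u : Cotangent I Q) :
    bil b (proj I u) (sharp b u) (sharp b u) = fib u (sharp b u) := by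
  have h1 := apply_inverse_apply (hb.pos (proj I u)) (fib u)
  exact congrArg (fun A : E →L[ℝ] ℝ => A (sharp b u)) h1

theorem fib_sharp_eq {u : Cotangent I Q} {k : ℝ} (hu : energy I b V u = k) :
    fib u (sharp b u) = 2 * (k - V (proj I u)) := by
  rw [energy_eq] at hu
  rw [sharp]; linarith

/-- Above the energy of `θ`, the form `λ + θ` is positive on the characteristic direction. -/
theorem le_characteristic (hb : IsMetric I b) {u : Cotangent I Q} {k r : ℝ}
    (hu : energy I b V u = k) {θ : DiffForm I Q 1}
    (hr : energy I b V (toSection I θ (proj I u)) ≤ r) :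
    k - r ≤ fib u (sharp b u) + cov θ (proj I u) (sharp b u) := by
  rw [energy_toSection] at hr
  have h1 := fib_sharp_eq hu
  have h2 := dual_apply_sq_le (hb.pos (proj I u)) (hb.symm _) (cov θ (proj I u)) (sharp b u)
  have h0 := dual_nonneg (hb.pos (proj I u)) (cov θ (proj I u))
  have h3 := dual_nonneg (hb.pos (proj I u)) (fib u)
  rw [bil_sharp hb] at h2
  set T := cov θ (proj I u) ((bil b (proj I u)).inverse (cov θ (proj I u)))
  change 0 ≤ fib u (sharp b u) at h3
  set N := fib u (sharp b u)
  set z := cov θ (proj I u) (sharp b u)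
  have h4 : |z| ≤ (T + N) / 2 := by
    refine abs_le_of_sq_le_sq (h2.trans ?_) (by linarith)
    nlinarith [sq_nonneg (T - N)]
  have h5 := (abs_le.1 h4).1
  linarith

theorem primitive_sq_le (hb : IsMetric I b) {u : Cotangent I Q} {k : ℝ}
    (hu : energy I b V u = k) {θ : DiffForm I Q 1}
    (hr : energy I b V (toSection I θ (proj I u)) ≤ k) (a : E) :
    (fib u a + cov θ (proj I u) a) ^ 2 ≤ 8 * (k - V (proj I u)) * bil b (proj I u) a a := by
  rw [energy_toSection] at hr
  have h1 := fib_sharp_eq hu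
  have h2 := dual_apply_sq_le (hb.pos (proj I u)) (hb.symm _) (cov θ (proj I u)) a
  have h3 := dual_apply_sq_le (hb.pos (proj I u)) (hb.symm _) (fib u) a
  change _ ≤ fib u (sharp b u) * _ at h3
  rw [h1] at h3
  have h0 := bilin_nonneg (hb.pos (proj I u)) a
  have h4 := mul_le_mul_of_nonneg_right (show cov θ (proj I u) ((bil b (proj I u)).inverse
    (cov θ (proj I u))) ≤ 2 * (k - V (proj I u)) by linarith) h0
  nlinarith [sq_nonneg (fib u a - cov θ (proj I u) a)]

end Estimates

section VirtuallyContact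

variable {E : Type*} [NormedAddCommGroup E] [NormedSpace ℝ E] [FiniteDimensional ℝ E]
  {H : Type*} [TopologicalSpace H] {I : ModelWithCorners ℝ E H} [I.Boundaryless]
  {Q : Type*} [TopologicalSpace Q] [ChartedSpace H Q] [IsManifold I ∞ Q]
  {Q' : Type*} [TopologicalSpace Q'] [ChartedSpace H Q'] [IsManifold I ∞ Q'] {d : ℕ}

theorem mem_liftedEnergySurface_iff (h : RiemMetric I Q) (V : Q → ℝ) {μ : Q' → Q}
    (hμ : IsSmoothCovering I μ) {k : ℝ} (u : Cotangent I Q') :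
    u ∈ liftedEnergySurface I μ h V k ↔ energy I (pullbackMetric I μ h.inner) (V ∘ μ) u = k := by
  rw [← liftedHamiltonian_eq_energy h V hμ.isLocalDiffeomorph]; rfl

theorem isVirtuallyContact_energyProj [CompactSpace Q]
    (hd : Module.finrank ℝ (E × (E →L[ℝ] ℝ)) = d + 1)
    (h : RiemMetric I Q) {μ : Q' → Q} (hμ : IsSmoothCovering I μ)
    {V : Q → ℝ} (hV : ContMDiff I 𝓘(ℝ, ℝ) ∞ V)
    {σ : DiffForm I Q 2} (hσ : IsSmoothForm I σ) (hσ' : extD I σ = 0)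
    {θ : DiffForm I Q' 1} (hθ : IsSmoothForm I θ) (hθσ : extD I θ = pullbackForm I I μ σ)
    {k r : ℝ} (hrk : r < k) (hr : ∀ x, liftedHamiltonian I μ h V (toSection I θ x) ≤ r)
    [ChartedSpace (EuclideanSpace ℝ (Fin d)) (energySurface I h V k)]
    [ChartedSpace (EuclideanSpace ℝ (Fin d)) (liftedEnergySurface I μ h V k)]
    [IsManifold (𝓡 d) ∞ (energySurface I h V k)]
    (hS : IsSubmanifoldStructure (I.prod 𝓘(ℝ, E →L[ℝ] ℝ)) d (energySurface I h V k))
    (hS' : IsSubmanifoldStructure (I.prod 𝓘(ℝ, E →L[ℝ] ℝ)) d (liftedEnergySurface I μ h V k))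
    (g : RiemMetric (𝓡 d) (energySurface I h V k)) :
    IsVirtuallyContact (𝓡 d) (energyProj I μ h V k)
      (restrictedPrimitive I θ (liftedEnergySurface I μ h V k))
      (restrictedTwisted I σ (energySurface I h V k)) g := by
  have := hS'.isManifold
  have hl := hμ.isLocalDiffeomorph
  have hb := isMetric_inner h
  have hb' := isMetric_pullback hb hl
  have hg := isMetric_inner g
  have hV' : ContMDiff I 𝓘(ℝ, ℝ) ∞ (V ∘ μ) := hV.comp hl.contMDiff
  have hp := isSmoothCovering_energyProj hS hS' hμ
  have hgp := isMetric_pullback hg hp.isLocalDiffeomorph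
  have hcomp : CompactSpace (energySurface I h V k) :=
    isCompact_iff_compactSpace.1 (isCompact_energy hb hV k)
  have hpb := pullback_restrictedTwisted hS hS' hμ hθ hθσ
  rw [liftedHamiltonian_eq_energy h V hl] at hr
  have hkV' : ∀ x, V (μ x) < k := fun x => by
    have h1 := hr x
    rw [energy_toSection] at h1
    have h2 := dual_nonneg (hb'.pos x) (cov θ x)
    simp only [Function.comp_apply] at h1
    linarith
  have hkV : ∀ q, V q < k := fun q => by
    obtain ⟨x, rfl⟩ := hμ.surjective q
    exact hkV' x
  have hmem := mem_liftedEnergySurface_iff h V hμ (k := k)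
  have hfib : ∀ s : liftedEnergySurface I μ h V k, fib s.1 ≠ 0 := fun s =>
    fib_ne_zero_of_lt ((hmem s.1).1 s.2) (hkV' _)
  have hpos : ∀ s : liftedEnergySurface I μ h V k,
      k - r ≤ fib s.1 (sharp (pullbackMetric I μ h.inner) s.1) +
        cov θ (proj I s.1) (sharp (pullbackMetric I μ h.inner) s.1) := fun s =>
    le_characteristic hb' ((hmem s.1).1 s.2) (hr _)
  obtain ⟨m, hm⟩ := (isCompact_range hV.continuous).bddBelow
  have hm' : ∀ q, m ≤ V q := fun q => hm (mem_range_self q)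
  have hF : ContMDiff (𝓡 d) I ∞ fun s : energySurface I h V k => proj I s.1 :=
    contMDiff_proj.comp hS.contMDiff
  have hFp : ∀ s v, md (𝓡 d) I (fun s : energySurface I h V k => proj I s.1)
      (energyProj I μ h V k s) (md (𝓡 d) (𝓡 d) (energyProj I μ h V k) s v) =
      md I I μ (proj I s.1) (dval I s v).1 := fun s v => by
    rw [md_proj_val hS]; exact dval_energyProj hS hS' hμ s v
  have hodd := isOddSymplectic_restrictedTwisted hS hb hV hkV (fun _ => Iff.rfl) hd hσ hσ'
  refine ⟨hcomp, hodd, hp, ⟨?_, ?_⟩, hpb, ?_, ?_⟩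
  · exact isSmoothForm_iff.2 fun s => smoothFormAt_restrictedPrimitive hS' (isSmoothForm_iff.1 hθ _)
  · intro s _
    exact contact_at hS' hb' hV' hmem hd (isSmoothForm_iff.1 hθ _) (hfib s)
      (by have := hpos s; intro h0; linarith)
  · obtain ⟨C, hC⟩ := exists_metric_comparison hb hg hF
    refine ⟨√(8 * (k - m) * max C 0), fun s => Real.sqrt_le_sqrt ?_⟩
    have hkm : 0 ≤ k - m := by linarith [hm' (μ (proj I s.1)), hkV (μ (proj I s.1))]
    refine dual_le_of_apply_le (hgp.pos s) (by positivity) fun v => ?_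
    have e1 : cov (restrictedPrimitive I θ (liftedEnergySurface I μ h V k)) s v =
        fib s.1 (dval I s v).1 + cov θ (proj I s.1) (dval I s v).1 := by
      rw [cov_apply]; exact restrictedPrimitive_apply θ s v
    have e2 := primitive_sq_le hb' ((hmem s.1).1 s.2) ((hr (proj I s.1)).trans hrk.le) (dval I s v).1
    have e3 := hC (energyProj I μ h V k s) (md (𝓡 d) (𝓡 d) (energyProj I μ h V k) s v)
    rw [hFp] at e3
    change (cov (restrictedPrimitive I θ (liftedEnergySurface I μ h V k)) s v) ^ 2 ≤ _ *
      bil g.inner (energyProj I μ h V k s) (md (𝓡 d) (𝓡 d) (energyProj I μ h V k) s v)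
        (md (𝓡 d) (𝓡 d) (energyProj I μ h V k) s v)
    rw [e1]
    refine e2.trans ?_
    have e4 := bilin_nonneg (hg.pos (energyProj I μ h V k s))
      (md (𝓡 d) (𝓡 d) (energyProj I μ h V k) s v)
    have e5 := bilin_nonneg (hb'.pos (proj I s.1)) (dval I s v).1
    rw [mul_assoc]
    have e6 : bil (pullbackMetric I μ h.inner) (proj I s.1) (dval I s v).1 (dval I s v).1 ≤
        max C 0 * bil g.inner (energyProj I μ h V k s) (md (𝓡 d) (𝓡 d) (energyProj I μ h V k) s v)
        (md (𝓡 d) (𝓡 d) (energyProj I μ h V k) s v) :=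
      le_trans e3 (mul_le_mul_of_nonneg_right (le_max_left _ _) e4)
    have e7 : 0 ≤ k - V (μ (proj I s.1)) := by linarith [hkV (μ (proj I s.1))]
    have e8 := hm' (μ (proj I s.1))
    rw [mul_assoc, mul_assoc]
    exact mul_le_mul_of_nonneg_left (mul_le_mul (by simp only [Function.comp_apply]; linarith) e6 e5 hkm)
      (by norm_num)
  · obtain ⟨C, hC⟩ := exists_metric_comparison_ker hb hg hF hodd.1 fun s v hv hv0 => by
      have hs : fib s.1 ≠ 0 := fib_ne_zero_of_lt (b := h.inner) s.2 (hkV _)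
      obtain ⟨e, he, -, hker⟩ := exists_characteristic hS hb hV (fun _ => Iff.rfl) hd σ s hs
      obtain ⟨c, rfl⟩ := (hker v).1 hv
      rw [md_proj_val hS, map_smul, Prod.smul_fst, he, smul_neg, neg_eq_zero] at hv0
      rcases smul_eq_zero.1 hv0 with h0 | h0
      · rw [h0, zero_smul]
      · exact absurd h0 (sharp_ne_zero hb hs)
    have hkr : 0 < k - r := by linarith
    set D := √(max C 0 * (2 * (k - m))) with hD
    refine ⟨(k - r) / (D + 1), by positivity, fun s v hv hker => ?_⟩
    obtain ⟨e, he, he0, hke⟩ := exists_characteristic hS' hb' hV' hmem hd (extD I θ) s (hfib s)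
    have hker' : ∀ w, frm (restrictedTwisted I (extD I θ) (liftedEnergySurface I μ h V k)) s
        ![v, w] = 0 := fun w => by
      have h1 : frm (extD (𝓡 d) (restrictedPrimitive I θ (liftedEnergySurface I μ h V k))) s = _ :=
        extD_restrictedPrimitive hS' (isSmoothForm_iff.1 hθ _)
      have h2 := hker w
      change frm (extD (𝓡 d) (restrictedPrimitive I θ (liftedEnergySurface I μ h V k))) s ![v, w] = 0 at h2
      rw [h1] at h2
      exact h2
    obtain ⟨t, rfl⟩ := (hke v).1 hker'
    have ht : t ≠ 0 := by rintro rfl; exact hv (zero_smul _ _)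
    have hα : |frm (restrictedPrimitive I θ (liftedEnergySurface I μ h V k)) s ![t • e]| =
        |t| * |fib s.1 (sharp (pullbackMetric I μ h.inner) s.1) +
        cov θ (proj I s.1) (sharp (pullbackMetric I μ h.inner) s.1)| := by
      rw [restrictedPrimitive_apply, map_smul, Prod.smul_fst, he, map_smul, map_smul, map_neg,
        map_neg, ← smul_add, smul_eq_mul, abs_mul, ← neg_add, abs_neg]
    have hpv : ∀ w, frm (restrictedTwisted I σ (energySurface I h V k)) (energyProj I μ h V k s)
        ![md (𝓡 d) (𝓡 d) (energyProj I μ h V k) s (t • e), w] = 0 := fun w => by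
      have h1 : frm (pullbackForm (𝓡 d) (𝓡 d) (energyProj I μ h V k) (restrictedTwisted I σ _)) s
          ![t • e, (md (𝓡 d) (𝓡 d) (energyProj I μ h V k) s).inverse w] = 0 := by
        rw [hpb]
        exact hker ((md (𝓡 d) (𝓡 d) (energyProj I μ h V k) s).inverse w)
      refine Eq.trans ?_ h1
      change _ = frm (restrictedTwisted I σ _) (energyProj I μ h V k s) _
      refine congrArg _ (funext fun i => ?_)
      fin_cases i
      · rfl
      · exact (md_inverse_apply hp.isLocalDiffeomorph s w).1.symm
    have e3 := hC _ _ hpv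
    rw [hFp] at e3
    have e4 : bil (pullbackMetric I μ h.inner) (proj I s.1) (dval I s (t • e)).1 (dval I s (t • e)).1
        = t ^ 2 * (2 * (k - V (μ (proj I s.1)))) := by
      rw [map_smul, Prod.smul_fst, he, smul_neg]
      simp only [map_neg, map_smul, _root_.neg_apply, _root_.smul_apply, smul_eq_mul]
      rw [bil_sharp hb', fib_sharp_eq ((hmem s.1).1 s.2)]
      simp only [Function.comp_apply]; ring
    have e5 : vectorNorm (𝓡 d) (pullbackMetric (𝓡 d) (energyProj I μ h V k) g.inner s) (t • e) ≤
        D * |t| := by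
      rw [hD, ← Real.sqrt_sq_eq_abs, ← Real.sqrt_mul' _ (sq_nonneg t)]
      refine Real.sqrt_le_sqrt (le_trans e3 ?_)
      have e6 : bil h.inner (proj I (energyProj I μ h V k s).1)
        (md I I μ (proj I s.1) (dval I s (t • e)).1) (md I I μ (proj I s.1) (dval I s (t • e)).1) =
        t ^ 2 * (2 * (k - V (μ (proj I s.1)))) := e4
      rw [e6]
      have e7 : 0 ≤ k - V (μ (proj I s.1)) := by linarith [hkV (μ (proj I s.1))]
      have e8 := hm' (μ (proj I s.1))
      calc C * (t ^ 2 * (2 * (k - V (μ (proj I s.1)))))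
          ≤ max C 0 * (t ^ 2 * (2 * (k - m))) := by
            gcongr
            exact le_max_left _ _
        _ = _ := by ring
    have e9 : 0 < |t| := abs_pos.2 ht
    have hD0 : 0 ≤ D := Real.sqrt_nonneg _
    change _ < |frm (restrictedPrimitive I θ (liftedEnergySurface I μ h V k)) s ![t • e]|
    rw [hα]
    have e10 := (hpos s).trans (le_abs_self _)
    calc (k - r) / (D + 1) * vectorNorm (𝓡 d) (pullbackMetric (𝓡 d) (energyProj I μ h V k) g.inner s) (t • e)
        ≤ (k - r) / (D + 1) * (D * |t|) := mul_le_mul_of_nonneg_left e5 (by positivity)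
      _ < (k - r) / (D + 1) * ((D + 1) * |t|) := by
          apply mul_lt_mul_of_pos_left _ (by positivity)
          nlinarith
      _ = |t| * (k - r) := by field_simp
      _ ≤ _ := mul_le_mul_of_nonneg_left e10 e9.le

end VirtuallyContact

section SomewhereContact

variable {E : Type*} [NormedAddCommGroup E] [NormedSpace ℝ E] [FiniteDimensional ℝ E]
  {H : Type*} [TopologicalSpace H] {I : ModelWithCorners ℝ E H} [I.Boundaryless]
  {Q : Type*} [TopologicalSpace Q] [ChartedSpace H Q] [IsManifold I ∞ Q]
  {Q' : Type*} [TopologicalSpace Q'] [ChartedSpace H Q'] [IsManifold I ∞ Q'] {d : ℕ}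

theorem exists_smul_energy {b : ∀ x : Q, TangentSpace I x →L[ℝ] TangentSpace I x →L[ℝ] ℝ}
    {V : Q → ℝ} (hb : IsMetric I b) {q : Q} {k : ℝ} (hk : V q < k) {p : E →L[ℝ] ℝ} (hp : p ≠ 0) :
    ∃ t : ℝ, 0 < t ∧ 1 / 2 * (t • p) ((bil b q).inverse (t • p)) + V q = k := by
  have h1 := dual_pos (hb.pos q) hp
  refine ⟨√(2 * (k - V q) / p ((bil b q).inverse p)), Real.sqrt_pos.2 (div_pos (by linarith) h1), ?_⟩
  rw [map_smul, map_smul, _root_.smul_apply, smul_eq_mul, smul_eq_mul, ← mul_assoc (√_),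
    Real.mul_self_sqrt (div_pos (by linarith) h1).le]
  field_simp
  ring

theorem isSomewhereContact_energyProj [Nontrivial E]
    (hd : Module.finrank ℝ (E × (E →L[ℝ] ℝ)) = d + 1)
    (h : RiemMetric I Q) {μ : Q' → Q} (hμ : IsSmoothCovering I μ)
    {V : Q → ℝ} (hV : ContMDiff I 𝓘(ℝ, ℝ) ∞ V) {θ : DiffForm I Q' 1}
    {U : Set Q} (hU : IsOpen U) (hne : U.Nonempty) (hθU : ∀ x, μ x ∈ U → θ x = 0)
    {k : ℝ} (hk : ∀ q, V q < k)
    [ChartedSpace (EuclideanSpace ℝ (Fin d)) (energySurface I h V k)]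
    [ChartedSpace (EuclideanSpace ℝ (Fin d)) (liftedEnergySurface I μ h V k)]
    (hS : IsSubmanifoldStructure (I.prod 𝓘(ℝ, E →L[ℝ] ℝ)) d (energySurface I h V k))
    (hS' : IsSubmanifoldStructure (I.prod 𝓘(ℝ, E →L[ℝ] ℝ)) d (liftedEnergySurface I μ h V k)) :
    IsSomewhereContact (𝓡 d) (energyProj I μ h V k)
      (restrictedPrimitive I θ (liftedEnergySurface I μ h V k)) := by
  have hb := isMetric_inner h
  refine ⟨{s | proj I s.1 ∈ U}, hU.preimage (contMDiff_proj.continuous.comp continuous_subtype_val),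
    ?_, restrictedPrimitive I 0 _, ⟨fun s _ => smoothFormAt_restrictedPrimitive hS
      (smoothFormAt_zero _), fun s _ => ?_⟩, fun s hs => ?_⟩
  · obtain ⟨q, hq⟩ := hne
    obtain ⟨v, hv⟩ := exists_ne (0 : E)
    obtain ⟨p, hp⟩ := SeparatingDual.exists_ne_zero (R := ℝ) hv
    obtain ⟨t, -, ht⟩ := exists_smul_energy hb (hk q) (p := p) (by rintro rfl; exact hp rfl)
    exact ⟨⟨⟨q, t • p⟩, ht⟩, hq⟩
  · have hs : fib s.1 ≠ 0 := fib_ne_zero_of_lt (b := h.inner) s.2 (hk _)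
    refine contact_at hS hb hV (fun _ => Iff.rfl) hd (smoothFormAt_zero _) hs ?_
    have h1 := dual_pos (hb.pos (proj I s.1)) hs
    have h2 : cov (0 : DiffForm I Q 1) (proj I s.1) (sharp h.inner s.1) = 0 := rfl
    rw [h2, add_zero]
    exact h1.ne'
  · rw [pullback_restrictedPrimitive hS hS' hμ]
    refine oneForm_ext (E := EuclideanSpace ℝ (Fin d)) fun v => ?_
    refine (restrictedPrimitive_apply _ s v).trans
      (Eq.trans ?_ (restrictedPrimitive_apply θ s v).symm)
    have h1 : cov θ (proj I s.1) (dval I s v).1 = 0 := by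
      rw [cov_apply, frm, hθU _ hs]; rfl
    rw [h1]; rfl

end SomewhereContact

section Differential

variable {E : Type*} [NormedAddCommGroup E] [NormedSpace ℝ E] [FiniteDimensional ℝ E]
  {H : Type*} [TopologicalSpace H] {I : ModelWithCorners ℝ E H} [I.Boundaryless]
  {M : Type*} [TopologicalSpace M] [ChartedSpace H M] [IsManifold I ∞ M]

variable (I) in
/-- A function as a 0-form. -/
def zeroForm (F : M → ℝ) : DiffForm I M 0 := fun x =>
  ContinuousAlternatingMap.constOfIsEmpty ℝ (TangentSpace I x) (Fin 0) (F x)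

variable (I) in
/-- The differential of a function, as a 1-form. -/
def differential (F : M → ℝ) : DiffForm I M 1 := extD I (zeroForm I F)

theorem inChart_zeroForm (F : M → ℝ) (x : M) : inChart I (zeroForm I F) x =
    fun y => ContinuousAlternatingMap.constOfIsEmpty ℝ E (Fin 0) (F ((extChartAt I x).symm y)) := by
  funext y
  ext v
  rfl

theorem smoothFormAt_zeroForm {F : M → ℝ} {x : M} (hF : ContMDiffAt I 𝓘(ℝ, ℝ) ∞ F x) :
    SmoothFormAt I (zeroForm I F) x := by
  rw [SmoothFormAt, inChart_zeroForm]
  have h1 : ContDiffAt ℝ ∞ (fun y => F ((extChartAt I x).symm y)) (extChartAt I x x) := by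
    refine ContMDiffAt.contDiffAt ?_
    exact hF.comp_of_eq (contMDiffAt_chart_symm (mem_extChartAt_target x)) (extChartAt_to_inv x)
  exact (ContinuousAlternatingMap.constOfIsEmptyLIE ℝ E ℝ (Fin 0)).toContinuousLinearEquiv.contDiff.contDiffAt.comp
    _ h1

theorem smoothFormAt_differential {F : M → ℝ} (hF : ContMDiff I 𝓘(ℝ, ℝ) ∞ F) (x : M) :
    SmoothFormAt I (differential I F) x :=
  SmoothFormAt.extD (.of_forall fun q => smoothFormAt_zeroForm (hF q))

theorem extD_differential {F : M → ℝ} (hF : ContMDiff I 𝓘(ℝ, ℝ) ∞ F) (x : M) :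
    extD I (differential I F) x = 0 :=
  extD_extD (.of_forall fun q => smoothFormAt_zeroForm (hF q))

theorem cov_differential {F : M → ℝ} {x : M} (hF : MDifferentiableAt I 𝓘(ℝ, ℝ) F x) :
    cov (differential I F) x = md I 𝓘(ℝ, ℝ) F x := by
  have h1 : @Eq (E [⋀^Fin 1]→L[ℝ] ℝ) (differential I F x) _ := extD_apply_self (zeroForm I F) x
  rw [inChart_zeroForm, extDeriv_constOfIsEmpty] at h1
  have h2 : cov (differential I F) x =
      fderiv ℝ (fun y => F ((extChartAt I x).symm y)) (extChartAt I x x) := by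
    refine (congrArg (ContinuousAlternatingMap.ofSubsingleton ℝ E ℝ (0 : Fin 1)).symm h1).trans ?_
    simp
  rw [h2, ← md_eq_fderiv]
  have hc : MDifferentiableAt 𝓘(ℝ, E) I (extChartAt I x).symm (extChartAt I x x) :=
    (contMDiffAt_chart_symm (mem_extChartAt_target x)).mdifferentiableAt (by simp)
  have h3 := md_comp (x := extChartAt I x x) (f := (extChartAt I x).symm) (g := F)
    (by rwa [extChartAt_to_inv]) hc
  refine h3.trans ?_
  have h4 : md 𝓘(ℝ, E) I (extChartAt I x).symm (extChartAt I x x) = .id ℝ E :=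
    mfderiv_chart_symm_self x
  rw [h4, extChartAt_to_inv]
  exact ContinuousLinearMap.comp_id _

theorem form_eq_of_cov_eq {η ζ : DiffForm I M 1} {x : M} (h : cov η x = cov ζ x) : η x = ζ x := by
  refine oneForm_ext (E := E) fun v => ?_
  have h1 := cov_apply η x v
  rw [h, cov_apply] at h1
  exact h1.symm

theorem md_mul {a c : M → ℝ} {x : M} (ha : MDifferentiableAt I 𝓘(ℝ, ℝ) a x)
    (hc : MDifferentiableAt I 𝓘(ℝ, ℝ) c x) :
    md I 𝓘(ℝ, ℝ) (fun y => a y * c y) x =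
      a x • md I 𝓘(ℝ, ℝ) c x + c x • md I 𝓘(ℝ, ℝ) a x :=
  (HasMFDerivAt.mul ha.hasMFDerivAt hc.hasMFDerivAt).mfderiv

theorem fderiv_cov_symm {η : DiffForm 𝓘(ℝ, E) E 1} {y : E} (hη : SmoothFormAt 𝓘(ℝ, E) η y)
    (hd : extD 𝓘(ℝ, E) η y = 0) :
    ContDiffAt ℝ ∞ (fun z : E => cov η z) y ∧
      ∀ v w, fderiv ℝ (fun z : E => cov η z) y v w = fderiv ℝ (fun z : E => cov η z) y w v := by
  have h1 : ContDiffAt ℝ ∞ (fun z : E => frm η z) y := by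
    have := hη
    rw [SmoothFormAt, inChart_vectorSpace] at this
    exact this
  have h2 : ContDiffAt ℝ ∞ (fun z : E => cov η z) y :=
    (ContinuousAlternatingMap.ofSubsingletonLIE (𝕜 := ℝ) (E := E) (F := ℝ)
      (0 : Fin 1)).symm.toContinuousLinearEquiv.contDiff.contDiffAt.comp y h1
  refine ⟨h2, fun v w => ?_⟩
  have h3 : extDeriv (fun z : E => frm η z) y = 0 := (extD_vectorSpace η y).symm.trans hd
  have h4 := extDeriv_two_apply (h1.differentiableAt (by simp)) v w
  have h5 : ∀ v : E, (fun z : E => frm η z ![v]) = fun z => cov η z v := fun v =>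
    funext fun z => (cov_apply η z v).symm
  rw [h3, h5, h5] at h4
  have h6 : ∀ v w, fderiv ℝ (fun z => cov η z w) y v = fderiv ℝ (fun z : E => cov η z) y v w :=
    fun v w => by
      rw [fderiv_clm_apply (h2.differentiableAt (by simp)) (by fun_prop)]
      simp
  rw [h6, h6] at h4
  exact (sub_eq_zero.1 h4.symm)

theorem contDiffOn_of_hasFDerivAt {s : Set E} (hso : IsOpen s) {f : E → ℝ} {A : E → E →L[ℝ] ℝ}
    (hA : ∀ y ∈ s, ContDiffAt ℝ ∞ A y) (hf : ∀ y ∈ s, HasFDerivAt f (A y) y) :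
    ContDiffOn ℝ ∞ f s := by
  rw [contDiffOn_infty_iff_fderiv_of_isOpen hso]
  refine ⟨fun y hy => (hf y hy).differentiableAt.differentiableWithinAt, fun y hy => ?_⟩
  exact ((hA y hy).contDiffWithinAt).congr (fun z hz => (hf z hz).fderiv) (hf y hy).fderiv

theorem exists_primitive_of_convex {η : DiffForm 𝓘(ℝ, E) E 1} {s : Set E} (hs : Convex ℝ s)
    (hso : IsOpen s) (hη : ∀ y ∈ s, SmoothFormAt 𝓘(ℝ, E) η y)
    (hd : ∀ y ∈ s, extD 𝓘(ℝ, E) η y = 0) :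
    ∃ f : E → ℝ, ContDiffOn ℝ ∞ f s ∧ ∀ y ∈ s, HasFDerivAt f (cov η y) y := by
  have h1 := fun y hy => fderiv_cov_symm (hη y hy) (hd y hy)
  obtain ⟨f, hf⟩ := Convex.exists_forall_hasFDerivAt_of_fderiv_symmetric
    (hω := show DifferentiableOn ℝ (fun z : E => cov η z) s from fun y hy => ((h1 y hy).1.differentiableAt (by simp)).differentiableWithinAt)
    hs hso (fun y hy => (h1 y hy).2)
  exact ⟨f, contDiffOn_of_hasFDerivAt hso (fun y hy => (h1 y hy).1) hf, hf⟩

end Differential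

section Sections

variable {E : Type*} [NormedAddCommGroup E] [NormedSpace ℝ E]
  {H : Type*} [TopologicalSpace H] {I : ModelWithCorners ℝ E H}
  {Q : Type*} [TopologicalSpace Q] [ChartedSpace H Q]
  {Q' : Type*} [TopologicalSpace Q'] [ChartedSpace H Q']

/-- The local sections of a smooth covering over an evenly covered set. -/
theorem exists_sections {μ : Q' → Q} (hμ : IsSmoothCovering I μ) (q₀ : Q) :
    ∃ (W : Set Q) (s : μ ⁻¹' {q₀} → Q → Q') (idx : Q' → μ ⁻¹' {q₀}), IsOpen W ∧ q₀ ∈ W ∧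
      (∀ i, ∀ q ∈ W, μ (s i q) = q ∧ idx (s i q) = i) ∧ (∀ x, μ x ∈ W → s (idx x) (μ x) = x) ∧
      (∀ i, ∀ q ∈ W, ContMDiffAt I I ∞ (s i) q) ∧
      ∀ x, μ x ∈ W → ∀ᶠ y in 𝓝 x, idx y = idx x := by
  classical
  obtain ⟨x₀, hx₀⟩ := hμ.surjective q₀
  obtain ⟨hdisc, W, hqW, hW, hW', T, hT⟩ := hμ.isCoveringMap q₀
  let s : μ ⁻¹' {q₀} → Q → Q' := fun i q => if h : q ∈ W then T.symm (⟨q, h⟩, i) else x₀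
  let idx : Q' → μ ⁻¹' {q₀} := fun x => if h : μ x ∈ W then (T ⟨x, h⟩).2 else ⟨x₀, hx₀⟩
  have hs : ∀ i q (h : q ∈ W), s i q = T.symm (⟨q, h⟩, i) := fun i q h => dif_pos h
  have hidx : ∀ x (h : μ x ∈ W), idx x = (T ⟨x, h⟩).2 := fun x h => dif_pos h
  have h1 : ∀ i q, q ∈ W → μ (s i q) = q := fun i q h => by
    rw [hs i q h, ← hT, T.apply_symm_apply]
  have hcont : ∀ i, ContinuousOn (s i) W := fun i => by
    rw [continuousOn_iff_continuous_domRestrict]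
    have : W.domRestrict (s i) = fun q : W => (T.symm (q, i)).1 := funext fun q => hs i q q.2
    rw [this]
    exact continuous_subtype_val.comp (T.symm.continuous.comp (continuous_id.prodMk continuous_const))
  refine ⟨W, s, idx, hW, hqW, fun i q h => ⟨h1 i q h, ?_⟩, fun x hx => ?_, fun i q hq => ?_,
    fun x hx => ?_⟩
  · rw [hidx _ (by rw [h1 i q h]; exact h)]
    have : (⟨s i q, by rw [mem_preimage, h1 i q h]; exact h⟩ : μ ⁻¹' W) = T.symm (⟨q, h⟩, i) :=
      Subtype.ext (hs i q h)
    rw [this, T.apply_symm_apply]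
  · rw [hs _ _ hx, hidx x hx]
    have : (⟨μ x, hx⟩, (T ⟨x, hx⟩).2) = T ⟨x, hx⟩ := Prod.ext (Subtype.ext (hT ⟨x, hx⟩).symm) rfl
    rw [this, T.symm_apply_apply]
  · obtain ⟨Φ, hΦ, he⟩ := hμ.isLocalDiffeomorph (s i q)
    have hev : s i =ᶠ[𝓝 q] Φ.symm := by
      have hc : ContinuousAt (s i) q := (hcont i).continuousAt (hW.mem_nhds hq)
      filter_upwards [hc.eventually (Φ.open_source.mem_nhds hΦ), hW.mem_nhds hq] with y hy hyW
      have h3 : Φ (s i y) = y := (he hy).symm.trans (h1 i y hyW)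
      exact (Φ.left_inv hy).symm.trans (congrArg Φ.symm h3)
    have hq' : q ∈ Φ.target := by
      have h3 : Φ (s i q) = q := (he hΦ).symm.trans (h1 i q hq)
      rw [← h3]; exact Φ.map_source hΦ
    exact (Φ.symm.contMDiffOn.contMDiffAt (Φ.open_target.mem_nhds hq')).congr_of_eventuallyEq hev
  · have hc : ContinuousOn idx (μ ⁻¹' W) := by
      rw [continuousOn_iff_continuous_domRestrict]
      have : (μ ⁻¹' W).domRestrict idx = fun x : μ ⁻¹' W => (T x).2 := funext fun x => hidx x x.2
      rw [this]
      exact continuous_snd.comp T.continuous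
    exact (hc.continuousAt (hW'.mem_nhds hx)).eventually
      ((isOpen_discrete {idx x}).mem_nhds rfl)

end Sections

section Bounded

variable {E : Type*} [NormedAddCommGroup E] [NormedSpace ℝ E] [FiniteDimensional ℝ E]
  {H : Type*} [TopologicalSpace H] {I : ModelWithCorners ℝ E H} [I.Boundaryless]
  {Q : Type*} [TopologicalSpace Q] [ChartedSpace H Q] [IsManifold I ∞ Q]
  {b : ∀ x : Q, TangentSpace I x →L[ℝ] TangentSpace I x →L[ℝ] ℝ}

theorem isBoundedForm_iff (hb : IsMetric I b) {θ : DiffForm I Q 1} : IsBoundedForm I b θ ↔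
    ∃ C, 0 ≤ C ∧ ∀ x v, (cov θ x v) ^ 2 ≤ C * bil b x v v := by
  constructor
  · rintro ⟨C, hC⟩
    refine ⟨C ^ 2, sq_nonneg C, fun x v => (dual_apply_sq_le (hb.pos x) (hb.symm x) _ v).trans ?_⟩
    refine mul_le_mul_of_nonneg_right ?_ (bilin_nonneg (hb.pos x) v)
    exact (Real.sqrt_le_left ((Real.sqrt_nonneg _).trans (hC x))).1 (hC x)
  · rintro ⟨C, hC, h⟩
    exact ⟨√C, fun x => Real.sqrt_le_sqrt (dual_le_of_apply_le (hb.pos x) hC (h x))⟩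

/-- The differential of a smooth function on a compact manifold is bounded. -/
theorem exists_differential_bound [CompactSpace Q] (hb : IsMetric I b) {χ : Q → ℝ}
    (hχ : ContMDiff I 𝓘(ℝ, ℝ) ∞ χ) :
    ∃ C, ∀ x v, (md I 𝓘(ℝ, ℝ) χ x v) ^ 2 ≤ C * bil b x v v := by
  let m : ∀ x : ℝ, TangentSpace 𝓘(ℝ, ℝ) x →L[ℝ] TangentSpace 𝓘(ℝ, ℝ) x →L[ℝ] ℝ :=
    fun _ => ContinuousLinearMap.mul ℝ ℝ
  have hm : IsMetric 𝓘(ℝ, ℝ) m := by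
    refine ⟨fun x v w => mul_comm v w, fun x v hv => mul_self_pos.2 hv, fun x => ?_⟩
    have h1 : gram 𝓘(ℝ, ℝ) m (extChartAt 𝓘(ℝ, ℝ) x).symm = fun _ => ContinuousLinearMap.mul ℝ ℝ := by
      have h0 : ((extChartAt 𝓘(ℝ, ℝ) x).symm : ℝ → ℝ) = id := by
        rw [extChartAt_model_space_eq_id]; rfl
      rw [h0]
      funext y
      refine ContinuousLinearMap.ext fun v => ContinuousLinearMap.ext fun w => ?_
      rw [gram_apply, md_id]
      rfl
    rw [h1]
    exact contDiffOn_const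
  obtain ⟨C, hC⟩ := exists_metric_comparison hm hb hχ
  refine ⟨C, fun x v => le_trans (le_of_eq ?_) (hC x v)⟩
  exact sq _

end Bounded

section Correction

variable {E : Type*} [NormedAddCommGroup E] [NormedSpace ℝ E] [FiniteDimensional ℝ E]
  {H : Type*} [TopologicalSpace H] {I : ModelWithCorners ℝ E H} [I.Boundaryless]
  {Q : Type*} [TopologicalSpace Q] [ChartedSpace H Q] [IsManifold I ∞ Q]
  {Q' : Type*} [TopologicalSpace Q'] [ChartedSpace H Q'] [IsManifold I ∞ Q']

/-- Near every point of the open set `V`, a bounded form that is closed over `V` has a bounded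
primitive. -/
theorem exists_local_primitive {b : ∀ x : Q, TangentSpace I x →L[ℝ] TangentSpace I x →L[ℝ] ℝ}
    (hb : IsMetric I b) {μ : Q' → Q} (hμ : IsSmoothCovering I μ)
    {V : Set Q} (hV : IsOpen V) {q₀ : Q} (hq₀ : q₀ ∈ V) {θ : DiffForm I Q' 1}
    (hθ : IsSmoothForm I θ) (hθV : ∀ x, μ x ∈ V → extD I θ x = 0)
    (hθb : IsBoundedForm I (pullbackMetric I μ b) θ) :
    ∃ (B : Set Q) (f : Q' → ℝ) (K : ℝ), IsOpen B ∧ q₀ ∈ B ∧ B ⊆ V ∧ (∀ x, |f x| ≤ K) ∧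
      ∀ x, μ x ∈ B → ContMDiffAt I 𝓘(ℝ, ℝ) ∞ f x ∧ md I 𝓘(ℝ, ℝ) f x = cov θ x := by
  classical
  have hl := hμ.isLocalDiffeomorph
  obtain ⟨C₀, hC₀, hθb⟩ := (isBoundedForm_iff (isMetric_pullback hb hl)).1 hθb
  obtain ⟨W, s, idx, hW, hqW, hs1, hs2, hs3, hs4⟩ := exists_sections hμ q₀
  set φ := extChartAt I q₀
  set y₀ := φ q₀
  have ht := extChartAt_target_mem_nhds (I := I) q₀
  obtain ⟨C₁, hC₁, hbd⟩ := exists_upper_bound hb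
    (contMDiffAt_chart_symm (I := I) (mem_extChartAt_target q₀))
  have hVW : ∀ᶠ y in 𝓝 y₀, φ.symm y ∈ V ∩ W := by
    refine (continuousAt_extChartAt_symm q₀).eventually ?_
    rw [extChartAt_to_inv]
    exact (hV.inter hW).mem_nhds ⟨hq₀, hqW⟩
  obtain ⟨r, hr, hball⟩ := Metric.eventually_nhds_iff_ball.1 ((eventually_mem_set.2 ht).and (hVW.and hbd))
  set D := Metric.ball y₀ r
  set σ := fun i => s i ∘ φ.symm
  have hσ : ∀ i, ∀ y ∈ D, ContMDiffAt 𝓘(ℝ, E) I ∞ (σ i) y := fun i y hy =>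
    (hs3 i _ (hball y hy).2.1.2).comp y (contMDiffAt_chart_symm (hball y hy).1)
  have hθs := isSmoothForm_iff.1 hθ
  have hmμ : ∀ x, MDifferentiableAt I I μ x := fun x => hl.contMDiff.mdifferentiableAt (by simp)
  have hμσ : ∀ i, ∀ y ∈ D, μ (σ i y) = φ.symm y := fun i y hy => (hs1 i _ (hball y hy).2.1.2).1
  choose g hg1 hg2 using fun i => exists_primitive_of_convex (convex_ball y₀ r) Metric.isOpen_ball
    (η := pullbackForm 𝓘(ℝ, E) I (σ i) θ) (fun y hy => (hθs _).pullback (hσ i y hy))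
    (fun y hy => by
      rw [extD_pullbackForm (hσ i y hy) (hθs _)]
      unfold pullbackForm
      rw [hθV _ (by rw [hμσ i y hy]; exact (hball y hy).2.1.1)]
      rfl)
  have hcov : ∀ i y, cov (pullbackForm 𝓘(ℝ, E) I (σ i) θ) y =
      (cov θ (σ i y)).comp (md 𝓘(ℝ, E) I (σ i) y) := fun i y => rfl
  have hgb : ∀ i, ∀ y ∈ D, |g i y - g i y₀| ≤ √(C₀ * C₁) * r := fun i y hy => by
    have hn : ∀ z ∈ D, ‖cov (pullbackForm 𝓘(ℝ, E) I (σ i) θ) z‖ ≤ √(C₀ * C₁) := fun z hz => by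
      refine ContinuousLinearMap.opNorm_le_bound _ (Real.sqrt_nonneg _) fun v => ?_
      have h1 := hθb (σ i z) (md 𝓘(ℝ, E) I (σ i) z v)
      have h2 : bil (pullbackMetric I μ b) (σ i z) (md 𝓘(ℝ, E) I (σ i) z v)
          (md 𝓘(ℝ, E) I (σ i) z v) = gram I b φ.symm z v v := by
        have h3 := md_comp (hmμ (σ i z)) ((hσ i z hz).mdifferentiableAt (by simp))
        have h4 : μ ∘ σ i =ᶠ[𝓝 z] φ.symm := by
          filter_upwards [Metric.isOpen_ball.mem_nhds hz] with w hw using hμσ i w hw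
        rw [md_congr h4] at h3
        rw [gram_apply, h3, ← hμσ i z hz]
        rfl
      rw [h2] at h1
      have h5 := (hball z hz).2.2 v
      rw [hcov, Real.norm_eq_abs]
      have h6 : (cov θ (σ i z) (md 𝓘(ℝ, E) I (σ i) z v)) ^ 2 ≤ (√(C₀ * C₁) * ‖v‖) ^ 2 := by
        rw [mul_pow, Real.sq_sqrt (by positivity), mul_assoc]
        exact h1.trans (mul_le_mul_of_nonneg_left h5 hC₀)
      exact abs_le_of_sq_le_sq h6 (by positivity)
    have h1 := (convex_ball y₀ r).norm_image_sub_le_of_norm_hasFDerivWithin_le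
      (fun z hz => (hg2 i z hz).hasFDerivWithinAt) hn (Metric.mem_ball_self hr) hy
    refine h1.trans (mul_le_mul_of_nonneg_left ?_ (Real.sqrt_nonneg _))
    rw [← dist_eq_norm]; exact (Metric.mem_ball.1 hy).le
  let B : Set Q := φ.source ∩ φ ⁻¹' D
  have hB : IsOpen B := (continuousOn_extChartAt q₀).isOpen_inter_preimage
    (isOpen_extChartAt_source q₀) Metric.isOpen_ball
  have hBVW : ∀ q ∈ B, q ∈ V ∩ W := fun q hq => by
    have h1 := (hball _ hq.2).2.1
    rwa [φ.left_inv hq.1] at h1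
  let f : Q' → ℝ := fun x => if μ x ∈ B then g (idx x) (φ (μ x)) - g (idx x) y₀ else 0
  have hf : ∀ x, μ x ∈ B → f =ᶠ[𝓝 x] fun y => g (idx x) (φ (μ y)) - g (idx x) y₀ := fun x hx => by
    filter_upwards [hs4 x (hBVW _ hx).2, hl.contMDiff.continuous.continuousAt.eventually
      (hB.mem_nhds hx)] with y h1 h2
    have h3 : μ y ∈ B := h2
    simp only [f, if_pos h3, h1]
  refine ⟨B, f, √(C₀ * C₁) * r, hB, ⟨mem_extChartAt_source q₀, Metric.mem_ball_self hr⟩,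
    fun q hq => (hBVW q hq).1, fun x => ?_, fun x hx => ?_⟩
  · by_cases hx : μ x ∈ B
    · simp only [f, if_pos hx]
      exact hgb _ _ hx.2
    · simp only [f, if_neg hx, abs_zero]
      positivity
  · have hφμ : ContMDiffAt I 𝓘(ℝ, E) ∞ (fun y => φ (μ y)) x :=
      (contMDiffAt_chart hx.1).comp x (hl.contMDiff x)
    have hgx : ContDiffAt ℝ ∞ (fun z => g (idx x) z - g (idx x) y₀) (φ (μ x)) :=
      ((hg1 (idx x)).contDiffAt (Metric.isOpen_ball.mem_nhds hx.2)).sub contDiffAt_const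
    refine ⟨(ContMDiffAt.comp (g := fun z => g (idx x) z - g (idx x) y₀)
      (f := fun y => φ (μ y)) x hgx.contMDiffAt hφμ).congr_of_eventuallyEq (hf x hx), ?_⟩
    rw [md_congr (hf x hx)]
    have h1 := md_comp (x := x) (f := fun y => φ (μ y)) (g := fun z => g (idx x) z - g (idx x) y₀)
      (hgx.contMDiffAt.mdifferentiableAt (by simp)) (hφμ.mdifferentiableAt (by simp))
    refine h1.trans ?_
    rw [md_eq_fderiv, ((hg2 (idx x) _ hx.2).sub_const _).fderiv, hcov]
    have h2 := md_comp (x := x) (f := fun y => φ (μ y)) (g := σ (idx x))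
      ((hσ _ _ hx.2).mdifferentiableAt (by simp)) (hφμ.mdifferentiableAt (by simp))
    have hσx : ∀ y, μ y ∈ B → idx y = idx x → σ (idx x) (φ (μ y)) = y := fun y hy hi => by
      have h3 := hs2 y (hBVW _ hy).2
      change s (idx x) (φ.symm (φ (μ y))) = y
      rw [φ.left_inv hy.1, ← hi, h3]
    have h3 : σ (idx x) ∘ (fun y => φ (μ y)) =ᶠ[𝓝 x] id := by
      filter_upwards [hs4 x (hBVW _ hx).2, hl.contMDiff.continuous.continuousAt.eventually
        (hB.mem_nhds hx)] with y h1 h2 using hσx y h2 h1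
    rw [md_congr h3, md_id] at h2
    rw [ContinuousLinearMap.comp_assoc, ← h2, hσx x hx rfl]
    rfl

end Correction

section Cutoff

variable {E : Type*} [NormedAddCommGroup E] [NormedSpace ℝ E] [FiniteDimensional ℝ E]
  {H : Type*} [TopologicalSpace H] {I : ModelWithCorners ℝ E H} [I.Boundaryless]
  {Q : Type*} [TopologicalSpace Q] [ChartedSpace H Q] [IsManifold I ∞ Q]
  {Q' : Type*} [TopologicalSpace Q'] [ChartedSpace H Q'] [IsManifold I ∞ Q']

/-- A smooth cut-off function supported in the open set `B` that is one near `q₀`. -/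
theorem exists_cutoff [T2Space Q] {B : Set Q} (hB : IsOpen B) {q₀ : Q} (hq₀ : q₀ ∈ B) :
    ∃ χ : Q → ℝ, ContMDiff I 𝓘(ℝ, ℝ) ∞ χ ∧ (∀ q, χ q ∈ Icc (0 : ℝ) 1) ∧ tsupport χ ⊆ B ∧
      χ =ᶠ[𝓝 q₀] 1 := by
  obtain ⟨χ, -, hχ⟩ := (SmoothBumpFunction.nhds_basis_tsupport (I := I) q₀).mem_iff.1 (hB.mem_nhds hq₀)
  exact ⟨χ, χ.contMDiff, fun q => χ.mem_Icc, hχ, χ.eventuallyEq_one⟩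

theorem md_eq_zero_of_eventually {F : Q' → ℝ} {x : Q'} (h : F =ᶠ[𝓝 x] fun _ => 0) :
    md I 𝓘(ℝ, ℝ) F x = 0 := by
  rw [md_congr h]; exact mfderiv_const

/-- A bounded primitive can be made to vanish over a small open set. -/
theorem exists_vanishing_primitive [CompactSpace Q] [T2Space Q]
    {b : ∀ x : Q, TangentSpace I x →L[ℝ] TangentSpace I x →L[ℝ] ℝ}
    (hb : IsMetric I b) {μ : Q' → Q} (hμ : IsSmoothCovering I μ)
    {V : Set Q} (hV : IsOpen V) (hne : V.Nonempty) {θ : DiffForm I Q' 1}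
    (hθ : IsSmoothForm I θ) (hθV : ∀ x, μ x ∈ V → extD I θ x = 0)
    (hθb : IsBoundedForm I (pullbackMetric I μ b) θ) :
    ∃ (U : Set Q) (θ' : DiffForm I Q' 1), IsOpen U ∧ U.Nonempty ∧ closure U ⊆ V ∧
      IsSmoothForm I θ' ∧ extD I θ' = extD I θ ∧ IsBoundedForm I (pullbackMetric I μ b) θ' ∧
      (∀ x, μ x ∉ V → θ' x = θ x) ∧ ∀ x, μ x ∈ U → θ' x = 0 := by
  obtain ⟨q₀, hq₀⟩ := hne
  have hl := hμ.isLocalDiffeomorph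
  have hb' := isMetric_pullback hb hl
  obtain ⟨B, f, K, hB, hqB, hBV, hfK, hf⟩ := exists_local_primitive hb hμ hV hq₀ hθ hθV hθb
  obtain ⟨χ, hχ, hχ01, hχB, hχ1⟩ := exists_cutoff (I := I) hB hqB
  obtain ⟨C₀, hC₀, hθb⟩ := (isBoundedForm_iff hb').1 hθb
  obtain ⟨C₁, hC₁⟩ := exists_differential_bound hb hχ
  have hχμ : ContMDiff I 𝓘(ℝ, ℝ) ∞ fun x => χ (μ x) := hχ.comp hl.contMDiff
  set F : Q' → ℝ := fun x => χ (μ x) * f x with hFdef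
  have hout : ∀ x, μ x ∉ B → F =ᶠ[𝓝 x] fun _ => 0 := fun x hx => by
    have h1 : ∀ᶠ q in 𝓝 (μ x), q ∉ tsupport χ :=
      (isClosed_tsupport χ).isOpen_compl.mem_nhds fun h => hx (hχB h)
    filter_upwards [hl.contMDiff.continuous.continuousAt.eventually h1] with y hy
    simp only [hFdef, image_eq_zero_of_notMem_tsupport hy, zero_mul]
  have hF : ContMDiff I 𝓘(ℝ, ℝ) ∞ F := fun x => by
    by_cases hx : μ x ∈ B
    · exact (hχμ x).mul (hf x hx).1
    · exact contMDiffAt_const.congr_of_eventuallyEq (hout x hx)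
  have hFx : ∀ x, cov (differential I F) x = md I 𝓘(ℝ, ℝ) F x := fun x =>
    cov_differential (hF.mdifferentiableAt (by simp))
  have hcov : ∀ x, cov (θ - differential I F) x = cov θ x - md I 𝓘(ℝ, ℝ) F x := fun x => by
    rw [← hFx]; rfl
  have hθs := isSmoothForm_iff.1 hθ
  have hFs := smoothFormAt_differential hF
  have hχ1' : ∀ q ∈ interior {q | χ q = 1}, q ∈ B := fun q hq =>
    have h2 : q ∈ {q | χ q = 1} := interior_subset hq
    hχB (subset_tsupport χ (by
      rw [Function.mem_support, show χ q = 1 from h2]; exact one_ne_zero))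
  refine ⟨interior {q | χ q = 1}, θ - differential I F, isOpen_interior,
    ⟨q₀, mem_interior_iff_mem_nhds.2 hχ1⟩, ?_, isSmoothForm_iff.2 fun x => (hθs x).sub (hFs x),
    funext fun x => ?_, (isBoundedForm_iff hb').2
      ⟨2 * (C₀ + K ^ 2 * max C₁ 0), by positivity, fun x v => ?_⟩, fun x hx => ?_, fun x hx => ?_⟩
  · have h1 : IsClosed {q | χ q = 1} := isClosed_eq hχ.continuous continuous_const
    intro q hq
    have h2 : χ q = 1 := closure_minimal interior_subset h1 hq
    exact hBV (hχB (subset_tsupport χ (by rw [Function.mem_support, h2]; exact one_ne_zero)))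
  · rw [extD_sub (hθs x) (hFs x), extD_differential hF x, sub_zero]
  · rw [hcov]
    have h0 := bilin_nonneg (hb'.pos x) v
    have h4 : 0 ≤ K ^ 2 * max C₁ 0 * bil (pullbackMetric I μ b) x v v := by positivity
    by_cases hx : μ x ∈ B
    · have h1 : md I 𝓘(ℝ, ℝ) F x = χ (μ x) • cov θ x +
          f x • (md I 𝓘(ℝ, ℝ) χ (μ x)).comp (md I I μ x) := by
        have h2 := md_mul (hχμ.mdifferentiableAt (by simp) (x := x))
          ((hf x hx).1.mdifferentiableAt (by simp))
        rw [(hf x hx).2] at h2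
        have h3 := md_comp (x := x) (f := μ) (g := χ) (hχ.mdifferentiableAt (by simp))
          (hl.contMDiff.mdifferentiableAt (by simp))
        rw [← h3]
        exact h2
      have h2 : (cov θ x - md I 𝓘(ℝ, ℝ) F x) v = (1 - χ (μ x)) * cov θ x v -
          f x * md I 𝓘(ℝ, ℝ) χ (μ x) (md I I μ x v) := by
        rw [h1]
        simp only [_root_.sub_apply, _root_.add_apply, _root_.smul_apply, smul_eq_mul,
          ContinuousLinearMap.comp_apply]
        ring
      rw [h2]
      have h5 := hC₁ (μ x) (md I I μ x v)
      have h6 : bil (pullbackMetric I μ b) x v v = bil b (μ x) (md I I μ x v) (md I I μ x v) := rfl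
      rw [← h6] at h5
      have h7 := hθb x v
      set z := cov θ x v
      set w := md I 𝓘(ℝ, ℝ) χ (μ x) (md I I μ x v)
      set N := bil (pullbackMetric I μ b) x v v
      have h8 : ((1 - χ (μ x)) * z) ^ 2 ≤ C₀ * N := by
        obtain ⟨e1, e2⟩ := hχ01 (μ x)
        rw [mul_pow]
        have e3 : (1 - χ (μ x)) ^ 2 ≤ 1 := by nlinarith
        exact (mul_le_of_le_one_left (sq_nonneg z) e3).trans h7
      have h9 : (f x * w) ^ 2 ≤ K ^ 2 * (max C₁ 0 * N) := by
        rw [mul_pow]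
        have e1 : f x ^ 2 ≤ K ^ 2 := sq_le_sq' (abs_le.1 (hfK x)).1 (abs_le.1 (hfK x)).2
        have e2 : w ^ 2 ≤ max C₁ 0 * N :=
          h5.trans (mul_le_mul_of_nonneg_right (le_max_left _ _) h0)
        exact mul_le_mul e1 e2 (sq_nonneg _) (sq_nonneg _)
      nlinarith [sq_nonneg ((1 - χ (μ x)) * z + f x * w)]
    · rw [md_eq_zero_of_eventually (hout x hx), sub_zero]
      have := hθb x v
      have h5 : 0 ≤ C₀ * bil (pullbackMetric I μ b) x v v := mul_nonneg hC₀ h0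
      nlinarith
  · refine form_eq_of_cov_eq ?_
    rw [hcov, md_eq_zero_of_eventually (hout x fun h => hx (hBV h)), sub_zero]
  · have hxB := hχ1' _ hx
    have h1 : F =ᶠ[𝓝 x] f := by
      have h2 : ∀ᶠ q in 𝓝 (μ x), χ q = 1 := mem_interior_iff_mem_nhds.1 hx
      filter_upwards [hl.contMDiff.continuous.continuousAt.eventually h2] with y hy
      simp only [hFdef, hy, one_mul]
    have h3 : cov (θ - differential I F) x = cov (0 : DiffForm I Q' 1) x := by
      rw [hcov, md_congr h1, (hf x hxB).2, sub_self]
      rfl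
    exact form_eq_of_cov_eq h3

theorem bddAbove_energy_toSection [CompactSpace Q] (h : RiemMetric I Q) {μ : Q' → Q}
    (hμ : IsSmoothCovering I μ) {V : Q → ℝ} (hV : ContMDiff I 𝓘(ℝ, ℝ) ∞ V) {θ : DiffForm I Q' 1}
    (hθ : IsBoundedForm I (pullbackMetric I μ h.inner) θ) :
    BddAbove (range fun x => liftedHamiltonian I μ h V (toSection I θ x)) := by
  have hb' := isMetric_pullback (isMetric_inner h) hμ.isLocalDiffeomorph
  obtain ⟨C, hC, hθ⟩ := (isBoundedForm_iff hb').1 hθ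
  obtain ⟨m, hm⟩ := (isCompact_range hV.continuous).bddAbove
  refine ⟨1 / 2 * C + m, ?_⟩
  rintro _ ⟨x, rfl⟩
  simp only [liftedHamiltonian_eq_energy h V hμ.isLocalDiffeomorph, energy_toSection]
  have h1 := dual_le_of_apply_le (hb'.pos x) hC (hθ x)
  have h2 : V (μ x) ≤ m := hm (mem_range_self _)
  simp only [Function.comp_apply]
  linarith

end Cutoff

section Poincare

variable {E F : Type*} [NormedAddCommGroup E] [NormedSpace ℝ E]
  [NormedAddCommGroup F] [NormedSpace ℝ F]

/-- The Poincaré lemma on open star-shaped sets. -/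
theorem exists_primitive_of_starConvex {A : E → E →L[ℝ] ℝ} {s : Set E} {a : E}
    (hs : StarConvex ℝ a s) (hso : IsOpen s) (hA : DifferentiableOn ℝ A s)
    (hsymm : ∀ y ∈ s, ∀ v w, fderiv ℝ A y v w = fderiv ℝ A y w v) :
    ∃ f : E → ℝ, ∀ y ∈ s, HasFDerivAt f (A y) y := by
  refine ⟨fun y => curveIntegral A (.segment a y), fun y hy => ?_⟩
  have hK : IsCompact (segment ℝ a y) := by
    rw [segment_eq_image_lineMap]
    exact isCompact_Icc.image (by fun_prop)
  obtain ⟨δ, hδ, hsub⟩ := hK.exists_thickening_subset_open hso (hs.segment_subset hy)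
  have hself := Metric.self_subset_thickening hδ (segment ℝ a y)
  have ho : IsOpen (Metric.thickening δ (segment ℝ a y)) := Metric.isOpen_thickening
  have h1 := ((convex_segment a y).thickening δ).hasFDerivWithinAt_curveIntegral_segment_of_hasFDerivWithinAt_symmetric
    (dω := fderiv ℝ A)
    (fun x hx => ((hA x (hsub hx)).differentiableAt (hso.mem_nhds (hsub hx))).hasFDerivAt.hasFDerivWithinAt)
    (fun x hx v _ w _ => hsymm x (hsub hx) v w)
    (hself (left_mem_segment ℝ a y)) (hself (right_mem_segment ℝ a y))
  exact h1.hasFDerivAt (ho.mem_nhds (hself (right_mem_segment ℝ a y)))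

/-- The complement of the closed ray through `p`. -/
def rayCompl (p : F) : Set F := ((fun t : ℝ => t • p) '' Ici 0)ᶜ

theorem mem_rayCompl {p v : F} : v ∈ rayCompl p ↔ ∀ t : ℝ, 0 ≤ t → v ≠ t • p := by
  simp only [rayCompl, mem_compl_iff, mem_image, mem_Ici, not_exists, not_and]
  exact ⟨fun h t ht e => h t ht e.symm, fun h t ht e => h t ht e.symm⟩

theorem isOpen_rayCompl {p : F} (hp : p ≠ 0) : IsOpen (rayCompl p) :=
  ((isClosedEmbedding_smul_left hp).isClosedMap _ isClosed_Ici).isOpen_compl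

theorem neg_mem_rayCompl {p : F} (hp : p ≠ 0) : -p ∈ rayCompl p :=
  mem_rayCompl.2 fun t ht h => by
    have h1 : (1 + t) • p = 0 := by rw [add_smul, one_smul, ← h]; simp
    rcases smul_eq_zero.1 h1 with h2 | h2
    · linarith
    · exact hp h2

theorem starConvex_rayCompl {p : F} (hp : p ≠ 0) : StarConvex ℝ (-p) (rayCompl p) := by
  intro v hv a b ha hb hab
  refine mem_rayCompl.2 fun t ht h => ?_
  rcases hb.eq_or_lt with rfl | hb
  · rw [add_zero] at hab
    subst hab
    exact mem_rayCompl.1 (neg_mem_rayCompl hp) t ht (by simpa using h)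
  · refine mem_rayCompl.1 hv ((t + a) / b) (by positivity) ?_
    have h1 : b • v = (t + a) • p := by
      rw [add_smul, ← h]; simp
    rw [div_eq_inv_mul, mul_smul, ← h1, smul_smul, inv_mul_cancel₀ hb.ne', one_smul]

theorem rayCompl_inter {p : F} : rayCompl p ∩ rayCompl (-p) = ((ℝ ∙ p : Submodule ℝ F) : Set F)ᶜ := by
  ext v
  simp only [mem_inter_iff, mem_rayCompl, mem_compl_iff, SetLike.mem_coe,
    Submodule.mem_span_singleton, not_exists]
  constructor
  · rintro ⟨h1, h2⟩ t rfl
    rcases le_total 0 t with h | h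
    · exact h1 t h rfl
    · exact h2 (-t) (by linarith) (by simp)
  · intro h
    exact ⟨fun t _ e => h t e.symm, fun t _ e => h (-t) (by rw [e]; simp)⟩

theorem rayCompl_union {p v : F} (hv : v ≠ 0) : v ∈ rayCompl p ∨ v ∈ rayCompl (-p) := by
  by_contra! h
  simp only [mem_rayCompl, not_forall, not_not] at h
  obtain ⟨⟨t, ht, h1⟩, ⟨r, hr, h2⟩⟩ := h
  have h3 : (t + r) • p = 0 := by
    rw [add_smul, ← h1, h2]; simp
  rcases smul_eq_zero.1 h3 with h4 | h4
  · have : t = 0 := by linarith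
    exact hv (by rw [h1, this, zero_smul])
  · exact hv (by rw [h1, h4, smul_zero])

theorem zero_notMem_rayCompl (p : F) : (0 : F) ∉ rayCompl p := fun h =>
  mem_rayCompl.1 h 0 le_rfl (zero_smul _ _).symm

/-- The Poincaré lemma on the product of a convex set and a punctured space of dimension at
least 3. -/
theorem exists_primitive_punctured [FiniteDimensional ℝ F] (hF : 3 ≤ Module.finrank ℝ F)
    {A : E × F → E × F →L[ℝ] ℝ} {D : Set E} (hD : Convex ℝ D) (hDo : IsOpen D) (hne : D.Nonempty)
    (hA : ∀ z ∈ D ×ˢ ({0}ᶜ : Set F), DifferentiableAt ℝ A z)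
    (hsymm : ∀ z ∈ D ×ˢ ({0}ᶜ : Set F), ∀ v w, fderiv ℝ A z v w = fderiv ℝ A z w v) :
    ∃ f : E × F → ℝ, ∀ z ∈ D ×ˢ ({0}ᶜ : Set F), HasFDerivAt f (A z) z := by
  classical
  obtain ⟨x₀, hx₀⟩ := hne
  have : Nontrivial F := Module.nontrivial_of_finrank_pos (R := ℝ) (by omega)
  obtain ⟨p, hp⟩ := exists_ne (0 : F)
  have key : ∀ p : F, p ≠ 0 → ∃ f : E × F → ℝ, ∀ z ∈ D ×ˢ rayCompl p, HasFDerivAt f (A z) z := by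
    intro p hp
    have hsub : ∀ z ∈ D ×ˢ rayCompl p, z ∈ D ×ˢ ({0}ᶜ : Set F) := fun z hz =>
      ⟨hz.1, fun h => zero_notMem_rayCompl p (by rw [← show z.2 = 0 from h]; exact hz.2)⟩
    refine exists_primitive_of_starConvex (a := (x₀, -p)) ?_ (hDo.prod (isOpen_rayCompl hp))
      (fun z hz => (hA z (hsub z hz)).differentiableWithinAt)
      (fun z hz => hsymm z (hsub z hz))
    exact (hD hx₀).prod (starConvex_rayCompl hp)
  obtain ⟨f, hf⟩ := key p hp
  obtain ⟨g, hg⟩ := key (-p) (neg_ne_zero.2 hp)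
  have hcon : IsPreconnected (D ×ˢ (rayCompl p ∩ rayCompl (-p))) := by
    refine hD.isPreconnected.prod ?_
    rw [rayCompl_inter]
    refine (isPathConnected_compl_of_one_lt_codim ?_).isConnected.isPreconnected
    rw [← Module.finrank_eq_rank]
    have h1 := Submodule.finrank_quotient_add_finrank (ℝ ∙ p : Submodule ℝ F)
    rw [finrank_span_singleton hp] at h1
    exact_mod_cast (show 1 < Module.finrank ℝ (F ⧸ (ℝ ∙ p : Submodule ℝ F)) by omega)
  have ho : IsOpen (D ×ˢ (rayCompl p ∩ rayCompl (-p))) :=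
    hDo.prod ((isOpen_rayCompl hp).inter (isOpen_rayCompl (neg_ne_zero.2 hp)))
  have hder : ∀ z ∈ D ×ˢ (rayCompl p ∩ rayCompl (-p)), HasFDerivAt (fun z => f z - g z) 0 z :=
    fun z hz => by
      have := (hf z ⟨hz.1, hz.2.1⟩).sub (hg z ⟨hz.1, hz.2.2⟩)
      rwa [sub_self] at this
  obtain ⟨c, hc⟩ : ∃ c, ∀ z ∈ D ×ˢ (rayCompl p ∩ rayCompl (-p)), f z - g z = c :=
    ho.exists_is_const_of_fderiv_eq_zero hcon
      (fun z hz => (hder z hz).differentiableAt.differentiableWithinAt)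
      (fun z hz => (hder z hz).fderiv)
  refine ⟨fun z => if z.2 ∈ rayCompl p then f z else g z + c, fun z hz => ?_⟩
  by_cases h : z.2 ∈ rayCompl p
  · refine (hf z ⟨hz.1, h⟩).congr_of_eventuallyEq ?_
    filter_upwards [(hDo.prod (isOpen_rayCompl hp)).mem_nhds ⟨hz.1, h⟩] with y hy
    rw [if_pos hy.2]
  · have h' : z.2 ∈ rayCompl (-p) := (rayCompl_union hz.2).resolve_left h
    refine ((hg z ⟨hz.1, h'⟩).add_const c).congr_of_eventuallyEq ?_
    filter_upwards [(hDo.prod (isOpen_rayCompl (neg_ne_zero.2 hp))).mem_nhds ⟨hz.1, h'⟩] with y hy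
    by_cases h2 : y.2 ∈ rayCompl p
    · rw [if_pos h2, ← hc y ⟨hy.1, h2, hy.2⟩]; ring
    · rw [if_neg h2]

end Poincare

section Radial

variable {E : Type*} [NormedAddCommGroup E] [NormedSpace ℝ E] [FiniteDimensional ℝ E]
  {H : Type*} [TopologicalSpace H] {I : ModelWithCorners ℝ E H} [I.Boundaryless]
  {Q : Type*} [TopologicalSpace Q] [ChartedSpace H Q] [IsManifold I ∞ Q]
  {G : Type*} [NormedAddCommGroup G] [NormedSpace ℝ G] [FiniteDimensional ℝ G]
  {H₁ : Type*} [TopologicalSpace H₁] {J : ModelWithCorners ℝ G H₁} [J.Boundaryless]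
  {S : Type*} [TopologicalSpace S] [ChartedSpace H₁ S] [IsManifold J ∞ S]
  {F : Type*} [NormedAddCommGroup F] [NormedSpace ℝ F] [FiniteDimensional ℝ F]

theorem frm_pullback {k : ℕ} (f : S → Q) (η : DiffForm I Q k) (x : S) :
    frm (pullbackForm J I f η) x = (frm η (f x)).compContinuousLinearMap (md J I f x) := rfl

theorem frm_pullback_comp {G₂ H₂ N : Type*} [NormedAddCommGroup G₂] [NormedSpace ℝ G₂]
    [TopologicalSpace H₂] {K : ModelWithCorners ℝ G₂ H₂} [TopologicalSpace N] [ChartedSpace H₂ N]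
    {k : ℕ} {f : N → S} {g : S → Q} {φ : N → Q} {x : N} (η : DiffForm I Q k)
    (hg : MDifferentiableAt J I g (f x)) (hf : MDifferentiableAt K J f x)
    (h : g ∘ f =ᶠ[𝓝 x] φ) :
    frm (pullbackForm K J f (pullbackForm J I g η)) x = frm (pullbackForm K I φ η) x := by
  have h1 := md_comp hg hf
  rw [md_congr h] at h1
  have h2 : frm (pullbackForm K J f (pullbackForm J I g η)) x =
      (frm η (g (f x))).compContinuousLinearMap ((md J I g (f x)).comp (md K J f x)) := rfl
  rw [h2, ← h1, show g (f x) = φ x from h.self_of_nhds]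
  rfl

variable (I J) in
/-- A local parametrization of a fibre bundle `τ : S → Q` by a chart of `Q` and the rays of a
vector space. -/
structure IsRadialChart (τ : S → Q) (q₀ : Q) (R : E × F → S) (C : S → F) : Prop where
  proj_map : ∀ z : E × F, z.1 ∈ (extChartAt I q₀).target → z.2 ≠ 0 →
    τ (R z) = (extChartAt I q₀).symm z.1
  contMDiffAt_map : ∀ z : E × F, z.1 ∈ (extChartAt I q₀).target → z.2 ≠ 0 →
    ContMDiffAt 𝓘(ℝ, E × F) J ∞ R z
  coord_ne_zero : ∀ s, τ s ∈ (extChartAt I q₀).source → C s ≠ 0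
  contMDiffAt_coord : ∀ s, τ s ∈ (extChartAt I q₀).source → ContMDiffAt J 𝓘(ℝ, F) ∞ C s
  map_coord : ∀ s, τ s ∈ (extChartAt I q₀).source → R (extChartAt I q₀ (τ s), C s) = s

variable {τ : S → Q} {q₀ : Q} {R : E × F → S} {C : S → F}

theorem IsRadialChart.eventually_proj (hR : IsRadialChart I J τ q₀ R C) {z : E × F}
    (h1 : z.1 ∈ (extChartAt I q₀).target) (h2 : z.2 ≠ 0) :
    τ ∘ R =ᶠ[𝓝 z] fun z => (extChartAt I q₀).symm z.1 := by
  have ho : IsOpen ((extChartAt I q₀).target ×ˢ ({0}ᶜ : Set F)) :=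
    (isOpen_extChartAt_target q₀).prod isOpen_compl_singleton
  filter_upwards [ho.mem_nhds ⟨h1, h2⟩] with w hw using hR.proj_map w hw.1 hw.2

/-- A form on the total space of a punctured vector bundle whose derivative comes from the base
is, locally over the base, a form from the base up to a differential. -/
theorem exists_local_potential (hτ : ContMDiff J I ∞ τ) (hR : IsRadialChart I J τ q₀ R C)
    (hF : 3 ≤ Module.finrank ℝ F) {Γ : DiffForm J S 1} (hΓ : IsSmoothForm J Γ)
    {σ : DiffForm I Q 2} (hσ : IsSmoothForm I σ) (hd : extD J Γ = pullbackForm J I τ σ) :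
    ∃ (B : Set Q) (ζ : DiffForm I Q 1) (g : S → ℝ), IsOpen B ∧ q₀ ∈ B ∧
      (∀ q ∈ B, SmoothFormAt I ζ q ∧ extD I ζ q = σ q) ∧
      ∀ s, τ s ∈ B → ContMDiffAt J 𝓘(ℝ, ℝ) ∞ g s ∧
        md J 𝓘(ℝ, ℝ) g s = cov Γ s - (cov ζ (τ s)).comp (md J I τ s) := by
  have : Nontrivial F := Module.nontrivial_of_finrank_pos (R := ℝ) (by omega)
  obtain ⟨p₀, hp₀⟩ := exists_ne (0 : F)
  have hΓs := isSmoothForm_iff.1 hΓ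
  have hσs := isSmoothForm_iff.1 hσ
  have hmτ : ∀ s, MDifferentiableAt J I τ s := fun s => hτ.mdifferentiableAt (by simp)
  obtain ⟨r, hr, hball⟩ := Metric.mem_nhds_iff.1 (extChartAt_target_mem_nhds (I := I) q₀)
  set φ := extChartAt I q₀
  set D := Metric.ball (φ q₀) r
  have hDo : IsOpen D := Metric.isOpen_ball
  -- the restriction to a local section
  let sec : E → S := fun x => R (x, p₀)
  have hsec : ∀ x ∈ D, ContMDiffAt 𝓘(ℝ, E) J ∞ sec x := fun x hx =>
    ContMDiffAt.comp (g := R) (f := fun x : E => (x, p₀)) x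
      (hR.contMDiffAt_map (x, p₀) (hball hx) hp₀)
      (contDiff_id.prodMk contDiff_const).contMDiff.contMDiffAt
  have hφs : ∀ x ∈ D, ContMDiffAt 𝓘(ℝ, E) I ∞ φ.symm x := fun x hx =>
    contMDiffAt_chart_symm (hball hx)
  have hτsec : ∀ x ∈ D, τ ∘ sec =ᶠ[𝓝 x] φ.symm := fun x hx => by
    filter_upwards [hDo.mem_nhds hx] with y hy using hR.proj_map (y, p₀) (hball hy) hp₀
  set ζE : DiffForm 𝓘(ℝ, E) E 1 := pullbackForm 𝓘(ℝ, E) J sec Γ with hζE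
  have hζEs : ∀ x ∈ D, SmoothFormAt 𝓘(ℝ, E) ζE x := fun x hx => (hΓs _).pullback (hsec x hx)
  have hζEd : ∀ x ∈ D, frm (extD 𝓘(ℝ, E) ζE) x = frm (pullbackForm 𝓘(ℝ, E) I φ.symm σ) x :=
    fun x hx => by
      refine (extD_pullbackForm (hsec x hx) (hΓs _)).trans ?_
      rw [hd]
      exact frm_pullback_comp σ (hmτ _) ((hsec x hx).mdifferentiableAt (by simp)) (hτsec x hx)
  let B : Set Q := φ.source ∩ φ ⁻¹' D
  have hB : IsOpen B := (continuousOn_extChartAt q₀).isOpen_inter_preimage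
    (isOpen_extChartAt_source q₀) hDo
  have hφ : ∀ q ∈ B, ContMDiffAt I 𝓘(ℝ, E) ∞ φ q := fun q hq => contMDiffAt_chart hq.1
  -- the remaining closed form
  let fst : E × F → E := Prod.fst
  have hfst : ∀ z, ContMDiffAt 𝓘(ℝ, E × F) 𝓘(ℝ, E) ∞ fst z := fun z =>
    contDiff_fst.contMDiff.contMDiffAt
  set κ : DiffForm 𝓘(ℝ, E × F) (E × F) 1 :=
    pullbackForm 𝓘(ℝ, E × F) J R Γ - pullbackForm 𝓘(ℝ, E × F) 𝓘(ℝ, E) fst ζE with hκ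
  have hκs : ∀ z ∈ D ×ˢ ({0}ᶜ : Set F), SmoothFormAt 𝓘(ℝ, E × F) κ z ∧
      extD 𝓘(ℝ, E × F) κ z = 0 := fun z hz => by
    have hRz := hR.contMDiffAt_map z (hball hz.1) hz.2
    have s1 := (hΓs (R z)).pullback hRz
    have s2 := (hζEs z.1 hz.1).pullback (hfst z)
    refine ⟨s1.sub s2, (extD_sub s1 s2).trans ?_⟩
    rw [extD_pullbackForm hRz (hΓs _), extD_pullbackForm (hfst z) (hζEs z.1 hz.1), sub_eq_zero, hd]
    have e1 := frm_pullback_comp (φ := φ.symm ∘ fst) σ (hmτ _) (hRz.mdifferentiableAt (by simp))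
      (hR.eventually_proj (hball hz.1) hz.2)
    have e2 := frm_pullback_comp (f := fst) (g := φ.symm) (φ := φ.symm ∘ fst) σ
      ((hφs z.1 hz.1).mdifferentiableAt (by simp)) ((hfst z).mdifferentiableAt (by simp)) .rfl
    refine e1.trans (e2.symm.trans ?_)
    rw [frm_pullback, ← hζEd z.1 hz.1]
    rfl
  have hκd := fun z hz => fderiv_cov_symm (hκs z hz).1 (hκs z hz).2
  obtain ⟨g, hg⟩ := exists_primitive_punctured hF (A := fun z => cov κ z) (convex_ball (φ q₀) r) hDo
    ⟨_, Metric.mem_ball_self hr⟩ (fun z hz => (hκd z hz).1.differentiableAt (by simp))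
    (fun z hz => (hκd z hz).2)
  have hgs := contDiffOn_of_hasFDerivAt (hDo.prod isOpen_compl_singleton)
    (fun z hz => (hκd z hz).1) hg
  refine ⟨B, pullbackForm I 𝓘(ℝ, E) φ ζE, fun s => g (φ (τ s), C s), hB,
    ⟨mem_extChartAt_source q₀, Metric.mem_ball_self hr⟩, fun q hq => ⟨(hζEs _ hq.2).pullback (hφ q hq), ?_⟩,
    fun s hs => ?_⟩
  · refine (extD_pullbackForm (hφ q hq) (hζEs _ hq.2)).trans ?_
    have e1 : frm (pullbackForm I 𝓘(ℝ, E) φ (extD 𝓘(ℝ, E) ζE)) q =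
        frm (pullbackForm I 𝓘(ℝ, E) φ (pullbackForm 𝓘(ℝ, E) I φ.symm σ)) q := by
      rw [frm_pullback, hζEd _ hq.2]; rfl
    refine e1.trans ((frm_pullback_comp (φ := id) σ ((hφs _ hq.2).mdifferentiableAt (by simp))
      ((hφ q hq).mdifferentiableAt (by simp)) ?_).trans ?_)
    · filter_upwards [hB.mem_nhds hq] with y hy using φ.left_inv hy.1
    · rw [frm_pullback, md_id]
      ext v; rfl
  · have hz : (φ (τ s), C s) ∈ D ×ˢ ({0}ᶜ : Set F) := ⟨hs.2, hR.coord_ne_zero s hs.1⟩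
    have hφτ : ContMDiffAt J 𝓘(ℝ, E) ∞ (fun s => φ (τ s)) s := (hφ _ hs).comp s (hτ s)
    have hC := hR.contMDiffAt_coord s hs.1
    have hT : ContMDiffAt J 𝓘(ℝ, E × F) ∞ (fun s => (φ (τ s), C s)) s := hφτ.prodMk_space hC
    have hgz := hgs.contDiffAt ((hDo.prod isOpen_compl_singleton).mem_nhds hz)
    have hmT := hT.mdifferentiableAt (by simp)
    refine ⟨ContMDiffAt.comp (g := g) (f := fun s => (φ (τ s), C s)) s hgz.contMDiffAt hT, ?_⟩
    have h1 := md_comp (g := g) (f := fun s => (φ (τ s), C s)) (x := s)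
      (hgz.contMDiffAt.mdifferentiableAt (by simp)) hmT
    refine h1.trans ?_
    rw [md_eq_fderiv, (hg _ hz).fderiv]
    have h2 : cov κ (φ (τ s), C s) = (cov Γ (R (φ (τ s), C s))).comp
        (md 𝓘(ℝ, E × F) J R (φ (τ s), C s)) - (cov ζE (φ (τ s))).comp
        (md 𝓘(ℝ, E × F) 𝓘(ℝ, E) fst (φ (τ s), C s)) := rfl
    have hRz := hR.contMDiffAt_map _ (hball hz.1) hz.2
    have h3 := md_comp (g := R) (f := fun s => (φ (τ s), C s)) (x := s)
      (hRz.mdifferentiableAt (by simp)) hmT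
    have h4 : R ∘ (fun s => (φ (τ s), C s)) =ᶠ[𝓝 s] id := by
      filter_upwards [hτ.continuous.continuousAt.eventually (hB.mem_nhds hs)] with t ht
      exact hR.map_coord t (mem_of_mem_inter_left ht)
    rw [md_congr h4, md_id] at h3
    have h5 := md_comp (g := fst) (f := fun s => (φ (τ s), C s)) (x := s)
      ((hfst _).mdifferentiableAt (by simp)) hmT
    have h6 := md_comp (g := φ) (f := τ) (x := s) ((hφ _ hs).mdifferentiableAt (by simp)) (hmτ s)
    have h7 : cov (pullbackForm I 𝓘(ℝ, E) φ ζE) (τ s) =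
        (cov ζE (φ (τ s))).comp (md I 𝓘(ℝ, E) φ (τ s)) := rfl
    rw [h2, ContinuousLinearMap.sub_comp, ContinuousLinearMap.comp_assoc,
      ContinuousLinearMap.comp_assoc, ← h3, hR.map_coord s hs.1, h7,
      ContinuousLinearMap.comp_assoc, ← h6, ContinuousLinearMap.comp_id]
    exact congrArg (fun A : G →L[ℝ] E => cov Γ s - (cov ζE (φ (τ s))).comp A) h5.symm

/-- A function on the total space of a punctured vector bundle whose differential comes from the
base is a function on the base. -/
theorem contMDiffAt_descend (hR : IsRadialChart I J τ q₀ R C)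
    (hF : 2 ≤ Module.finrank ℝ F) {f : S → ℝ} {κ : DiffForm I Q 1} (hτ : ContMDiff J I ∞ τ)
    (hf : ∀ᶠ q in 𝓝 q₀, ∀ s, τ s = q → ContMDiffAt J 𝓘(ℝ, ℝ) ∞ f s ∧
      md J 𝓘(ℝ, ℝ) f s = (cov κ (τ s)).comp (md J I τ s))
    {u : Q → S} (hu : ∀ q, τ (u q) = q) :
    ContMDiffAt I 𝓘(ℝ, ℝ) ∞ (f ∘ u) q₀ ∧ md I 𝓘(ℝ, ℝ) (f ∘ u) q₀ = cov κ q₀ := by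
  have : Nontrivial F := Module.nontrivial_of_finrank_pos (R := ℝ) (by omega)
  obtain ⟨p₀, hp₀⟩ := exists_ne (0 : F)
  set φ := extChartAt I q₀
  have hmap : ∀ q ∈ φ.source, ∀ p : F, p ≠ 0 → τ (R (φ q, p)) = q := fun q hq p hp => by
    rw [hR.proj_map _ (φ.map_source hq) hp]; exact φ.left_inv hq
  have hcon : IsPreconnected ({0}ᶜ : Set F) :=
    (isPathConnected_compl_singleton_of_one_lt_rank (by
      rw [← Module.finrank_eq_rank]; exact_mod_cast hF) 0).isConnected.isPreconnected
  -- `f` is constant on the fibres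
  have hev : f ∘ u =ᶠ[𝓝 q₀] fun q => f (R (φ q, p₀)) := by
    filter_upwards [hf, extChartAt_source_mem_nhds (I := I) q₀] with q hq hqs
    have hder : ∀ p ∈ ({0}ᶜ : Set F), HasFDerivAt (fun p => f (R (φ q, p))) (0 : F →L[ℝ] ℝ) p := by
      intro p hp
      have hRp := hR.contMDiffAt_map (φ q, p) (φ.map_source hqs) hp
      have hRm : MDifferentiableAt 𝓘(ℝ, F) J (fun p : F => R (φ q, p)) p :=
        MDifferentiableAt.comp (g := R) (f := fun p : F => (φ q, p)) p (hRp.mdifferentiableAt (by simp))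
          ((contDiff_const.prodMk contDiff_id).contMDiff.mdifferentiableAt one_ne_zero)
      obtain ⟨h1, h2⟩ := hq _ (hmap q hqs p hp)
      have h3 := md_comp (g := f) (f := fun p : F => R (φ q, p)) (x := p)
        (h1.mdifferentiableAt (by simp)) hRm
      have h4 := md_comp (g := τ) (f := fun p : F => R (φ q, p)) (x := p)
        (hτ.mdifferentiableAt (by simp)) hRm
      have h5 : τ ∘ (fun p : F => R (φ q, p)) =ᶠ[𝓝 p] fun _ => q := by
        filter_upwards [isOpen_compl_singleton.mem_nhds hp] with w hw using hmap q hqs w hw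
      have h6 : md 𝓘(ℝ, F) I (fun _ : F => q) p = 0 := mfderiv_const
      rw [md_congr h5, h6] at h4
      rw [h2, ContinuousLinearMap.comp_assoc, ← h4, ContinuousLinearMap.comp_zero, md_eq_fderiv] at h3
      have h7 : DifferentiableAt ℝ (fun p => f (R (φ q, p))) p :=
        ((h1.mdifferentiableAt (by simp)).comp p hRm).differentiableAt
      have h8 := h7.hasFDerivAt
      rwa [show fderiv ℝ (fun p => f (R (φ q, p))) p = 0 from h3] at h8
    obtain ⟨c, hc⟩ := isOpen_compl_singleton.exists_is_const_of_fderiv_eq_zero hcon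
      (fun p hp => (hder p hp).differentiableAt.differentiableWithinAt)
      (fun p hp => (hder p hp).fderiv)
    have hus : τ (u q) ∈ φ.source := by rw [hu]; exact hqs
    have h1 := hc (C (u q)) (hR.coord_ne_zero _ hus)
    have h2 := hR.map_coord _ hus
    rw [hu] at h2
    simp only [Function.comp_apply]
    rw [hc p₀ hp₀, ← h1, h2]
  have hq₀ := mem_extChartAt_source (I := I) q₀
  have hT : ContMDiffAt I 𝓘(ℝ, E × F) ∞ (fun q => (φ q, p₀)) q₀ :=
    (contMDiffAt_chart hq₀).prodMk_space contMDiffAt_const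
  have hRT : ContMDiffAt I J ∞ (fun q => R (φ q, p₀)) q₀ :=
    ContMDiffAt.comp (g := R) (f := fun q => (φ q, p₀)) q₀
      (hR.contMDiffAt_map (φ q₀, p₀) (φ.map_source hq₀) hp₀) hT
  obtain ⟨h1, h2⟩ := hf.self_of_nhds _ (hmap q₀ hq₀ p₀ hp₀)
  refine ⟨(ContMDiffAt.comp (g := f) (f := fun q => R (φ q, p₀)) q₀ h1 hRT).congr_of_eventuallyEq hev, ?_⟩
  have h3 := md_comp (g := f) (f := fun q => R (φ q, p₀)) (x := q₀)
    (h1.mdifferentiableAt (by simp)) (hRT.mdifferentiableAt (by simp))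
  have h4 := md_comp (g := τ) (f := fun q => R (φ q, p₀)) (x := q₀)
    (hτ.mdifferentiableAt (by simp)) (hRT.mdifferentiableAt (by simp))
  have h5 : τ ∘ (fun q => R (φ q, p₀)) =ᶠ[𝓝 q₀] id := by
    filter_upwards [extChartAt_source_mem_nhds (I := I) q₀] with q hq using hmap q hq p₀ hp₀
  rw [md_congr h5, md_id] at h4
  rw [h2, ContinuousLinearMap.comp_assoc, ← h4, hmap q₀ hq₀ p₀ hp₀] at h3
  rw [md_congr hev]
  exact h3

end Radial

section Gluing

variable {E : Type*} [NormedAddCommGroup E] [NormedSpace ℝ E] [FiniteDimensional ℝ E]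
  {H : Type*} [TopologicalSpace H] {I : ModelWithCorners ℝ E H} [I.Boundaryless]
  {Q : Type*} [TopologicalSpace Q] [ChartedSpace H Q] [IsManifold I ∞ Q]

theorem md_sum {ι : Type*} (t : Finset ι) {f : ι → Q → ℝ} {x : Q}
    (hf : ∀ i ∈ t, MDifferentiableAt I 𝓘(ℝ, ℝ) (f i) x) :
    MDifferentiableAt I 𝓘(ℝ, ℝ) (fun y => ∑ i ∈ t, f i y) x ∧
      md I 𝓘(ℝ, ℝ) (fun y => ∑ i ∈ t, f i y) x = ∑ i ∈ t, md I 𝓘(ℝ, ℝ) (f i) x := by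
  classical
  induction t using Finset.induction_on with
  | empty => exact ⟨mdifferentiableAt_const, mfderiv_const⟩
  | insert i t hi ih =>
    obtain ⟨h1, h2⟩ := ih fun j hj => hf j (Finset.mem_insert_of_mem hj)
    have h3 := hf i (Finset.mem_insert_self i t)
    simp only [Finset.sum_insert hi]
    refine ⟨h3.add h1, ?_⟩
    rw [← h2]
    exact mfderiv_add h3 h1

/-- A 2-form with compatible local primitives is exact. -/
theorem isExactForm_of_local [T2Space Q] [CompactSpace Q] {σ : DiffForm I Q 2} (B : Q → Set Q)
    (ζ : Q → DiffForm I Q 1) (g : Q → Q → ℝ) (hB : ∀ i, IsOpen (B i)) (hBi : ∀ i, i ∈ B i)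
    (hζ : ∀ i, ∀ q ∈ B i, SmoothFormAt I (ζ i) q ∧ extD I (ζ i) q = σ q)
    (hg : ∀ i j, ∀ q ∈ B i ∩ B j, ContMDiffAt I 𝓘(ℝ, ℝ) ∞ (fun x => g i x - g j x) q ∧
      md I 𝓘(ℝ, ℝ) (fun x => g i x - g j x) q = cov (ζ j) q - cov (ζ i) q) :
    IsExactForm I σ := by
  classical
  obtain ⟨t, -, ht⟩ := isCompact_univ.elim_nhds_subcover B fun i _ => (hB i).mem_nhds (hBi i)
  obtain ⟨ρ, hρ⟩ := SmoothPartitionOfUnity.exists_isSubordinate I isClosed_univ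
    (fun i : t => B i) (fun i => hB i) (by
      intro x hx
      obtain ⟨i, hi, hxi⟩ := mem_iUnion₂.1 (ht hx)
      exact mem_iUnion.2 ⟨⟨i, hi⟩, hxi⟩)
  have hsum : ∀ x, ∑ k, ρ k x = 1 := fun x => by
    rw [← finsum_eq_sum_of_fintype]; exact ρ.sum_eq_one (mem_univ x)
  have hρs : ∀ k x, ContMDiffAt I 𝓘(ℝ, ℝ) ∞ (ρ k) x := fun k x => (ρ k).contMDiff x
  have hρm : ∀ k x, MDifferentiableAt I 𝓘(ℝ, ℝ) (ρ k) x := fun k x =>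
    (hρs k x).mdifferentiableAt (by simp)
  have hmd0 : ∀ x, ∑ k, md I 𝓘(ℝ, ℝ) (ρ k) x = 0 := fun x => by
    have h1 := (md_sum (x := x) Finset.univ (f := fun k => ρ k) fun k _ => hρm k x).2
    rw [← h1]
    simp only [hsum]
    exact mfderiv_const
  have hout : ∀ (k : t) (x : Q), x ∉ B k → ρ k =ᶠ[𝓝 x] fun _ => 0 := fun k x hx => by
    have h1 : x ∈ (tsupport (ρ k))ᶜ := fun h => hx (hρ k h)
    filter_upwards [(isClosed_tsupport _).isOpen_compl.mem_nhds h1] with y hy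
    exact image_eq_zero_of_notMem_tsupport hy
  let c : Q → E →L[ℝ] ℝ := fun x =>
    ∑ k : t, ρ k x • cov (ζ k) x - ∑ k : t, g k x • md I 𝓘(ℝ, ℝ) (ρ k) x
  let θ : DiffForm I Q 1 := fun x => ofCovector I (c x)
  have hθ : ∀ x, cov θ x = c x := fun x =>
    (ContinuousAlternatingMap.ofSubsingleton ℝ E ℝ (0 : Fin 1)).symm_apply_apply (c x)
  let f : Q → Q → ℝ := fun i y => ∑ k : t, ρ k y * (g k y - g i y)
  have hterm : ∀ i, ∀ x ∈ B i, ∀ k : t, ContMDiffAt I 𝓘(ℝ, ℝ) ∞ (fun y => ρ k y * (g k y - g i y)) x ∧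
      md I 𝓘(ℝ, ℝ) (fun y => ρ k y * (g k y - g i y)) x =
        ρ k x • (cov (ζ i) x - cov (ζ k) x) + (g k x - g i x) • md I 𝓘(ℝ, ℝ) (ρ k) x := by
    intro i x hx k
    by_cases hk : x ∈ B k
    · obtain ⟨h1, h2⟩ := hg k i x ⟨hk, hx⟩
      refine ⟨(hρs k x).mul h1, ?_⟩
      rw [← h2]
      exact md_mul (hρm k x) (h1.mdifferentiableAt (by simp))
    · have h1 := hout k x hk
      have h2 : (fun y => ρ k y * (g k y - g i y)) =ᶠ[𝓝 x] fun _ => 0 := by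
        filter_upwards [h1] with y hy
        rw [hy, zero_mul]
      refine ⟨contMDiffAt_const.congr_of_eventuallyEq h2, ?_⟩
      have h3 : md I 𝓘(ℝ, ℝ) (ρ k) x = 0 := md_eq_zero_of_eventually h1
      rw [md_eq_zero_of_eventually h2, h3, h1.self_of_nhds, zero_smul, smul_zero, add_zero]
  have hfs : ∀ i, ∀ x ∈ B i, ContMDiffAt I 𝓘(ℝ, ℝ) ∞ (f i) x := fun i x hx =>
    ContMDiffAt.sum fun k _ => (hterm i x hx k).1
  have hloc : ∀ i, ∀ x ∈ B i, θ x = (ζ i - differential I (f i)) x := fun i x hx => by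
    refine form_eq_of_cov_eq ?_
    have h1 : cov (ζ i - differential I (f i)) x = cov (ζ i) x - cov (differential I (f i)) x := rfl
    have h2 := (md_sum (x := x) Finset.univ (f := fun (k : t) y => ρ k y * (g k y - g i y))
      fun k _ => (hterm i x hx k).1.mdifferentiableAt (by simp)).2
    rw [hθ, h1, cov_differential ((hfs i x hx).mdifferentiableAt (by simp)), h2]
    have h3 : ∀ k : t, md I 𝓘(ℝ, ℝ) (fun y => ρ k y * (g k y - g i y)) x =
        ρ k x • cov (ζ i) x - ρ k x • cov (ζ k) x + (g k x • md I 𝓘(ℝ, ℝ) (ρ k) x -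
          g i x • md I 𝓘(ℝ, ℝ) (ρ k) x) := fun k => by
      rw [(hterm i x hx k).2, smul_sub, sub_smul]
    simp only [h3, Finset.sum_add_distrib, Finset.sum_sub_distrib, ← Finset.sum_smul,
      ← Finset.smul_sum, hsum, hmd0, one_smul, smul_zero, c]
    abel
  have hev : ∀ i, ∀ x ∈ B i, ∀ᶠ y in 𝓝 x, θ y = (ζ i - differential I (f i)) y := fun i x hx => by
    filter_upwards [(hB i).mem_nhds hx] with y hy using hloc i y hy
  have hz : ∀ i, ∀ x ∈ B i, ∀ᶠ y in 𝓝 x, SmoothFormAt I (zeroForm I (f i)) y := fun i x hx => by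
    filter_upwards [(hB i).mem_nhds hx] with y hy using smoothFormAt_zeroForm (hfs i y hy)
  refine ⟨θ, isSmoothForm_iff.2 fun x => ?_, funext fun x => ?_⟩
  · exact ((hζ x x (hBi x)).1.sub (SmoothFormAt.extD (hz x x (hBi x)))).congr (hev x x (hBi x))
  · have hdiff : SmoothFormAt I (differential I (f x)) x := SmoothFormAt.extD (hz x x (hBi x))
    rw [extD_congr (hev x x (hBi x)), extD_sub (hζ x x (hBi x)).1 hdiff, (hζ x x (hBi x)).2]
    have h1 : extD I (differential I (f x)) x = 0 := extD_extD (hz x x (hBi x))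
    exact (congrArg (fun A => σ x - A) h1).trans (sub_zero _)

end Gluing

section Radial

variable {E : Type*} [NormedAddCommGroup E] [NormedSpace ℝ E] [FiniteDimensional ℝ E]
  {H : Type*} [TopologicalSpace H] {I : ModelWithCorners ℝ E H} [I.Boundaryless]
  {Q : Type*} [TopologicalSpace Q] [ChartedSpace H Q] [IsManifold I ∞ Q]
  {G : Type*} [NormedAddCommGroup G] [NormedSpace ℝ G] [FiniteDimensional ℝ G]
  {H₁ : Type*} [TopologicalSpace H₁] {J : ModelWithCorners ℝ G H₁} [J.Boundaryless]
  {S : Type*} [TopologicalSpace S] [ChartedSpace H₁ S] [IsManifold J ∞ S]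
  {F : Type*} [NormedAddCommGroup F] [NormedSpace ℝ F] [FiniteDimensional ℝ F]

/-- The pull-back of a form to the total space of a punctured vector bundle of rank at least 3 is
exact only if the form is exact. -/
theorem isExactForm_of_pullback [T2Space Q] [CompactSpace Q] {τ : S → Q} (hτ : ContMDiff J I ∞ τ)
    (hR : ∀ q, ∃ (R : E × F → S) (C : S → F), IsRadialChart I J τ q R C)
    (hF : 3 ≤ Module.finrank ℝ F) {Γ : DiffForm J S 1} (hΓ : IsSmoothForm J Γ)
    {σ : DiffForm I Q 2} (hσ : IsSmoothForm I σ) (hd : extD J Γ = pullbackForm J I τ σ) :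
    IsExactForm I σ := by
  have : Nontrivial F := Module.nontrivial_of_finrank_pos (R := ℝ) (by omega)
  obtain ⟨p₀, hp₀⟩ := exists_ne (0 : F)
  choose R C hR using hR
  choose B ζ g hB hBi hζ hg using fun q => exists_local_potential hτ (hR q) hF hΓ hσ hd
  let u : Q → S := fun q => R q (extChartAt I q q, p₀)
  have hu : ∀ q, τ (u q) = q := fun q => by
    rw [(hR q).proj_map _ (mem_extChartAt_target q) hp₀]
    exact extChartAt_to_inv q
  refine isExactForm_of_local B ζ (fun i => g i ∘ u) hB hBi hζ fun i j q hq => ?_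
  refine contMDiffAt_descend (f := fun s => g i s - g j s) (κ := ζ j - ζ i) (hR q) (by omega) hτ ?_ hu
  filter_upwards [((hB i).inter (hB j)).mem_nhds hq] with x hx s hs
  subst hs
  obtain ⟨h1, h2⟩ := hg i s hx.1
  obtain ⟨h3, h4⟩ := hg j s hx.2
  refine ⟨h1.sub h3, ?_⟩
  have h5 : md J 𝓘(ℝ, ℝ) (fun s => g i s - g j s) s = md J 𝓘(ℝ, ℝ) (g i) s - md J 𝓘(ℝ, ℝ) (g j) s :=
    mfderiv_sub (h1.mdifferentiableAt (by simp)) (h3.mdifferentiableAt (by simp))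
  have h6 : cov (ζ j - ζ i) (τ s) = cov (ζ j) (τ s) - cov (ζ i) (τ s) := rfl
  rw [h5, h2, h4, h6, ContinuousLinearMap.sub_comp]
  abel

end Radial

section EnergyRadial

variable {E : Type*} [NormedAddCommGroup E] [NormedSpace ℝ E] [FiniteDimensional ℝ E]
  {H : Type*} [TopologicalSpace H] {I : ModelWithCorners ℝ E H} [I.Boundaryless]
  {Q : Type*} [TopologicalSpace Q] [ChartedSpace H Q] [IsManifold I ∞ Q]
  {b : ∀ x : Q, TangentSpace I x →L[ℝ] TangentSpace I x →L[ℝ] ℝ} {V : Q → ℝ}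
  {d : ℕ} {S : Set (Cotangent I Q)}

variable (I b) in
/-- The factor that scales a coordinate covector to the energy `k`. -/
def energyScale (V : Q → ℝ) (k : ℝ) (q₀ : Q) (z : E × (E →L[ℝ] ℝ)) : ℝ :=
  √(2 * (k - V ((extChartAt I q₀).symm z.1)) /
    z.2 ((gram I b (extChartAt I q₀).symm z.1).inverse z.2))

theorem energy_cotMk_smul (hb : IsMetric I b) {k : ℝ} (hk : ∀ q, V q < k) {q₀ : Q}
    {z : E × (E →L[ℝ] ℝ)} (hz : z.1 ∈ (extChartAt I q₀).target) (hz0 : z.2 ≠ 0) :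
    energy I b V (cotMk I q₀ (z.1, energyScale I b V k q₀ z • z.2)) = k := by
  have h1 := dual_pos (gram_pos hb hz) hz0
  have h2 := hk ((extChartAt I q₀).symm z.1)
  rw [energy_cotMk hb V (z := (z.1, energyScale I b V k q₀ z • z.2)) hz]
  simp only [map_smul, _root_.smul_apply, smul_eq_mul]
  rw [← mul_assoc (energyScale I b V k q₀ z), energyScale,
    Real.mul_self_sqrt (div_pos (by linarith) h1).le]
  field_simp
  ring

theorem contDiffAt_energyScale (hb : IsMetric I b) (hV : ContMDiff I 𝓘(ℝ, ℝ) ∞ V) {k : ℝ}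
    (hk : ∀ q, V q < k) {q₀ : Q} {z : E × (E →L[ℝ] ℝ)} (hz : z.1 ∈ (extChartAt I q₀).target)
    (hz0 : z.2 ≠ 0) : ContDiffAt ℝ ∞ (energyScale I b V k q₀) z := by
  have h1 := dual_pos (gram_pos hb hz) hz0
  have h2 := hk ((extChartAt I q₀).symm z.1)
  have h3 : ContDiffAt ℝ ∞ (fun z : E × (E →L[ℝ] ℝ) => V ((extChartAt I q₀).symm z.1)) z :=
    (((hV _).comp z.1 (contMDiffAt_chart_symm hz)).contDiffAt).comp z contDiffAt_fst
  have h4 : ContDiffAt ℝ ∞ (fun z : E × (E →L[ℝ] ℝ) =>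
      z.2 ((gram I b (extChartAt I q₀).symm z.1).inverse z.2)) z := by
    have h5 := (contDiffAt_const (c := (2 : ℝ))).mul ((contDiffAt_energy_coord hb hV hz).sub h3)
    refine h5.congr_of_eventuallyEq (Eventually.of_forall fun z => ?_)
    simp only []
    ring
  exact ((contDiffAt_const.mul (contDiffAt_const.sub h3)).div h4 h1.ne').sqrt
    (div_pos (by linarith) h1).ne'

variable [ChartedSpace (EuclideanSpace ℝ (Fin d)) S]

theorem exists_isRadialChart [Nontrivial E] (hb : IsMetric I b) (hV : ContMDiff I 𝓘(ℝ, ℝ) ∞ V)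
    {k : ℝ} (hk : ∀ q, V q < k)
    (hS : IsSubmanifoldStructure (I.prod 𝓘(ℝ, E →L[ℝ] ℝ)) d S)
    (hSk : ∀ u, u ∈ S ↔ energy I b V u = k) (q₀ : Q) :
    ∃ (R : E × (E →L[ℝ] ℝ) → S) (C : S → E →L[ℝ] ℝ),
      IsRadialChart I (𝓡 d) (fun s : S => proj I s.1) q₀ R C := by
  classical
  obtain ⟨v, hv⟩ := exists_ne (0 : E)
  obtain ⟨p₀, hp₀⟩ := SeparatingDual.exists_ne_zero (R := ℝ) hv
  have hp₀' : p₀ ≠ 0 := fun h => hp₀ (by rw [h]; rfl)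
  let m : E × (E →L[ℝ] ℝ) → Cotangent I Q := fun z =>
    cotMk I q₀ (z.1, energyScale I b V k q₀ z • z.2)
  have hm : ∀ z : E × (E →L[ℝ] ℝ), z.1 ∈ (extChartAt I q₀).target → z.2 ≠ 0 → m z ∈ S :=
    fun z hz hz0 => (hSk _).2 (energy_cotMk_smul hb hk hz hz0)
  let s₀ : S := ⟨m (extChartAt I q₀ q₀, p₀), hm _ (mem_extChartAt_target q₀) hp₀'⟩
  let R : E × (E →L[ℝ] ℝ) → S := fun z => if h : m z ∈ S then ⟨m z, h⟩ else s₀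
  have hR : ∀ z : E × (E →L[ℝ] ℝ), z.1 ∈ (extChartAt I q₀).target → z.2 ≠ 0 →
      (R z : Cotangent I Q) = m z := fun z hz hz0 => by simp only [R, dif_pos (hm z hz hz0)]
  have hC : ∀ s : S, proj I s.1 ∈ (extChartAt I q₀).source → (cotCoord I q₀ s.1).2 ≠ 0 := by
    intro s hs h0
    have h1 := (hSk _).1 s.2
    rw [← cotMk_cotCoord hs, energy_cotMk hb V ((extChartAt I q₀).map_source hs), h0,
      _root_.zero_apply, mul_zero, zero_add] at h1
    exact (hk _).ne h1
  refine ⟨R, fun s => (cotCoord I q₀ s.1).2, fun z hz hz0 => ?_, fun z hz hz0 => ?_, hC,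
    fun s hs => ?_, fun s hs => ?_⟩
  · exact congrArg (proj I) (hR z hz hz0)
  · rw [hS.contMDiffAt_iff]
    have h1 : ContDiffAt ℝ ∞ (fun z : E × (E →L[ℝ] ℝ) =>
        (z.1, energyScale I b V k q₀ z • z.2)) z :=
      contDiffAt_fst.prodMk ((contDiffAt_energyScale hb hV hk hz hz0).smul contDiffAt_snd)
    have h2 : ContMDiffAt 𝓘(ℝ, E × (E →L[ℝ] ℝ)) (I.prod 𝓘(ℝ, E →L[ℝ] ℝ)) ∞ m z :=
      ContMDiffAt.comp z (contMDiffAt_cotMk (I := I) (q₀ := q₀)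
        (z := (z.1, energyScale I b V k q₀ z • z.2)) hz) h1.contMDiffAt
    refine h2.congr_of_eventuallyEq ?_
    have h3 : ∀ᶠ y : E × (E →L[ℝ] ℝ) in 𝓝 z, y.1 ∈ (extChartAt I q₀).target :=
      continuousAt_fst.eventually ((isOpen_extChartAt_target q₀).mem_nhds hz)
    have h4 : ∀ᶠ y : E × (E →L[ℝ] ℝ) in 𝓝 z, y.2 ≠ 0 :=
      continuousAt_snd.eventually (isOpen_ne.mem_nhds hz0)
    filter_upwards [h3, h4] with y hy hy0 using hR y hy hy0
  · have h1 := (contMDiffAt_cotCoord (I := I) hs).comp s (hS.contMDiff s)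
    exact (contDiffAt_snd (𝕜 := ℝ) (n := ∞) (p := cotCoord I q₀ s.1)).contMDiffAt.comp s h1
  · have h2 : (cotCoord I q₀ s.1).1 ∈ (extChartAt I q₀).target := (extChartAt I q₀).map_source hs
    refine Subtype.ext ((hR _ h2 (hC s hs)).trans ?_)
    have h3 := dual_pos (gram_pos hb h2) (hC s hs)
    have h4 := (hSk _).1 s.2
    rw [← cotMk_cotCoord hs, energy_cotMk hb V h2] at h4
    have h5 : energyScale I b V k q₀ (cotCoord I q₀ s.1) = 1 := by
      rw [energyScale, Real.sqrt_eq_one, div_eq_one_iff_eq h3.ne']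
      linarith
    change cotMk I q₀ ((cotCoord I q₀ s.1).1, energyScale I b V k q₀ (cotCoord I q₀ s.1) •
      (cotCoord I q₀ s.1).2) = s.1
    rw [h5, one_smul]
    exact cotMk_cotCoord hs

theorem isExactForm_of_restrictedTwisted [T2Space Q] [CompactSpace Q] (hb : IsMetric I b)
    (hV : ContMDiff I 𝓘(ℝ, ℝ) ∞ V) {k : ℝ} (hk : ∀ q, V q < k)
    (hS : IsSubmanifoldStructure (I.prod 𝓘(ℝ, E →L[ℝ] ℝ)) d S)
    (hSk : ∀ u, u ∈ S ↔ energy I b V u = k) (hE : 3 ≤ Module.finrank ℝ E)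
    {σ : DiffForm I Q 2} (hσ : IsSmoothForm I σ)
    (hex : IsExactForm (𝓡 d) (restrictedTwisted I σ S)) : IsExactForm I σ := by
  have := hS.isManifold
  have : Nontrivial E := Module.nontrivial_of_finrank_pos (R := ℝ) (by omega)
  have hF : 3 ≤ Module.finrank ℝ (E →L[ℝ] ℝ) := by
    rw [← LinearMap.toContinuousLinearMap.finrank_eq]
    exact hE.trans_eq (Subspace.dual_finrank_eq (K := ℝ) (V := E)).symm
  obtain ⟨β, hβ, hd⟩ := hex
  have h0 : ∀ s : S, SmoothFormAt (𝓡 d) (restrictedPrimitive I 0 S) s := fun s =>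
    smoothFormAt_restrictedPrimitive hS (smoothFormAt_zero (I := I) (proj I s.1))
  have hβ' := isSmoothForm_iff.1 hβ
  refine isExactForm_of_pullback (J := 𝓡 d) (τ := fun s : S => proj I s.1)
    (contMDiff_proj.comp hS.contMDiff) (exists_isRadialChart hb hV hk hS hSk) hF
    (Γ := β - restrictedPrimitive I 0 S) (isSmoothForm_iff.2 fun s => (hβ' s).sub (h0 s)) hσ
    (funext fun s => ?_)
  rw [extD_sub (hβ' s) (h0 s), hd,
    extD_restrictedPrimitive hS (smoothFormAt_zero (I := I) (proj I s.1)), extD_zero]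
  refine twoForm_ext (E := EuclideanSpace ℝ (Fin d)) fun v w => ?_
  have h1 := restrictedTwisted_apply (I := I) σ s v w
  have h2 := restrictedTwisted_apply (I := I) (0 : DiffForm I Q 2) s v w
  have h3 : frm (pullbackForm (𝓡 d) I (fun s : S => proj I s.1) σ) s ![v, w] =
      frm σ (proj I s.1) ![(dval I s v).1, (dval I s w).1] := by
    rw [frm_pullback]
    change frm σ (proj I s.1) _ = _
    congr 1
    funext i
    fin_cases i
    exacts [md_proj_val hS s v, md_proj_val hS s w]
  have h4 : frm (0 : DiffForm I Q 2) (proj I s.1) ![(dval I s v).1, (dval I s w).1] = 0 := rfl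
  refine Eq.trans ?_ h3.symm
  refine (congrArg₂ (fun a b : ℝ => a - b) h1 h2).trans ?_
  rw [twist, twist, h4]
  ring

end EnergyRadial

end Magnetic

end

theorem mainTheorem6 (n : ℕ) (hn : 2 ≤ n)
    -- the closed Riemannian manifold `(Q, h)`
    {Q : Type*} [TopologicalSpace Q] [ChartedSpace (EuclideanSpace ℝ (Fin n)) Q]
    [IsManifold (𝓡 n) ∞ Q] [T2Space Q] [CompactSpace Q] [ConnectedSpace Q]
    (h : RiemMetric (𝓡 n) Q)
    -- the universal covering `μ : Q' → Q`
    {Q' : Type*} [TopologicalSpace Q'] [ChartedSpace (EuclideanSpace ℝ (Fin n)) Q']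
    [IsManifold (𝓡 n) ∞ Q'] [T2Space Q'] [SecondCountableTopology Q'] [SimplyConnectedSpace Q']
    (μ : Q' → Q) (hμ : IsSmoothCovering (𝓡 n) μ)
    -- the potential and the magnetic form
    (pot : Q → ℝ) (hpot : ContMDiff (𝓡 n) 𝓘(ℝ, ℝ) ∞ pot)
    (σ : DiffForm (𝓡 n) Q 2) (hσ : IsSmoothForm (𝓡 n) σ) (hσ_closed : extD (𝓡 n) σ = 0)
    -- the open set on which the magnetic form vanishes
    (V : Set Q) (hV : IsOpen V) (hV_nonempty : V.Nonempty) (hσV : ∀ q ∈ V, σ q = 0)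
    -- the bounded primitive
    (θ : DiffForm (𝓡 n) Q' 1) (hθ : IsSmoothForm (𝓡 n) θ)
    (hθ_prim : extD (𝓡 n) θ = pullbackForm (𝓡 n) (𝓡 n) μ σ)
    (hθ_bdd : IsBoundedForm (𝓡 n) (pullbackMetric (𝓡 n) μ h.inner) θ) :
    ∃ (U : Set Q) (θ' : DiffForm (𝓡 n) Q' 1),
      IsOpen U ∧ U.Nonempty ∧ closure U ⊆ V ∧
      IsSmoothForm (𝓡 n) θ' ∧
      extD (𝓡 n) θ' = pullbackForm (𝓡 n) (𝓡 n) μ σ ∧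
      IsBoundedForm (𝓡 n) (pullbackMetric (𝓡 n) μ h.inner) θ' ∧
      (∀ x, μ x ∉ V → θ' x = θ x) ∧
      (∀ x, μ x ∈ U → θ' x = 0) ∧
      BddAbove (Set.range fun x => liftedHamiltonian (𝓡 n) μ h pot (toSection (𝓡 n) θ' x)) ∧
      ∀ k : ℝ, (⨆ x, liftedHamiltonian (𝓡 n) μ h pot (toSection (𝓡 n) θ' x)) < k →
        -- `M = {H = k}` and `M' = {H ∘ T^*μ = k}` are submanifolds of dimension `2n - 1`
        IsSubmanifold ((𝓡 n).prod 𝓘(ℝ, EuclideanSpace ℝ (Fin n) →L[ℝ] ℝ)) (2 * n - 1)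
          (energySurface (𝓡 n) h pot k) ∧
        IsSubmanifold ((𝓡 n).prod 𝓘(ℝ, EuclideanSpace ℝ (Fin n) →L[ℝ] ℝ)) (2 * n - 1)
          (liftedEnergySurface (𝓡 n) μ h pot k) ∧
        -- and, with their submanifold structures,
        ∀ [ChartedSpace (EuclideanSpace ℝ (Fin (2 * n - 1))) (energySurface (𝓡 n) h pot k)]
          [ChartedSpace (EuclideanSpace ℝ (Fin (2 * n - 1))) (liftedEnergySurface (𝓡 n) μ h pot k)]
          [IsManifold (𝓡 (2 * n - 1)) ∞ (energySurface (𝓡 n) h pot k)],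
          IsSubmanifoldStructure ((𝓡 n).prod 𝓘(ℝ, EuclideanSpace ℝ (Fin n) →L[ℝ] ℝ)) (2 * n - 1)
            (energySurface (𝓡 n) h pot k) →
          IsSubmanifoldStructure ((𝓡 n).prod 𝓘(ℝ, EuclideanSpace ℝ (Fin n) →L[ℝ] ℝ)) (2 * n - 1)
            (liftedEnergySurface (𝓡 n) μ h pot k) →
          (∀ g : RiemMetric (𝓡 (2 * n - 1)) (energySurface (𝓡 n) h pot k),
            IsVirtuallyContact (𝓡 (2 * n - 1)) (energyProj (𝓡 n) μ h pot k)
              (restrictedPrimitive (𝓡 n) θ' (liftedEnergySurface (𝓡 n) μ h pot k))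
              (restrictedTwisted (𝓡 n) σ (energySurface (𝓡 n) h pot k)) g) ∧
          IsSomewhereContact (𝓡 (2 * n - 1)) (energyProj (𝓡 n) μ h pot k)
            (restrictedPrimitive (𝓡 n) θ' (liftedEnergySurface (𝓡 n) μ h pot k)) ∧
          (3 ≤ n → ¬ IsExactForm (𝓡 n) σ →
            ¬ IsExactForm (𝓡 (2 * n - 1))
              (restrictedTwisted (𝓡 n) σ (energySurface (𝓡 n) h pot k))) := by
  have hE : Module.finrank ℝ (EuclideanSpace ℝ (Fin n)) = n := finrank_euclideanSpace_fin
  have hE' : Module.finrank ℝ (EuclideanSpace ℝ (Fin n) →L[ℝ] ℝ) = n := by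
    rw [← LinearMap.toContinuousLinearMap.finrank_eq]
    exact (Subspace.dual_finrank_eq (K := ℝ) (V := EuclideanSpace ℝ (Fin n))).trans hE
  have hd : Module.finrank ℝ (EuclideanSpace ℝ (Fin n) × (EuclideanSpace ℝ (Fin n) →L[ℝ] ℝ)) =
      2 * n - 1 + 1 := by
    rw [Module.finrank_prod, hE, hE']
    omega
  have : Nontrivial (EuclideanSpace ℝ (Fin n)) :=
    Module.nontrivial_of_finrank_pos (R := ℝ) (by omega)
  have hb := isMetric_inner h
  have hl := hμ.isLocalDiffeomorph
  have hθV : ∀ x, μ x ∈ V → extD (𝓡 n) θ x = 0 := fun x hx => by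
    rw [hθ_prim]
    exact congrArg (fun A : EuclideanSpace ℝ (Fin n) [⋀^Fin 2]→L[ℝ] ℝ =>
      A.compContinuousLinearMap (mfderiv (𝓡 n) (𝓡 n) μ x)) (hσV _ hx)
  obtain ⟨U, θ', hU, hUne, hUV, hθ', hθ'd, hθ'b, hθ'θ, hθ'U⟩ :=
    exists_vanishing_primitive hb hμ hV hV_nonempty hθ hθV hθ_bdd
  have hbdd := bddAbove_energy_toSection h hμ hpot hθ'b
  refine ⟨U, θ', hU, hUne, hUV, hθ', hθ'd.trans hθ_prim, hθ'b, hθ'θ, hθ'U, hbdd, fun k hk => ?_⟩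
  have hr := fun x => le_ciSup hbdd x
  have hb' := isMetric_pullback hb hl
  have hkQ : ∀ q, pot q < k := fun q => by
    obtain ⟨x, rfl⟩ := hμ.surjective q
    refine lt_of_le_of_lt ?_ ((hr x).trans_lt hk)
    have h1 : liftedHamiltonian (𝓡 n) μ h pot (toSection (𝓡 n) θ' x) =
        1 / 2 * cov θ' x ((bil (pullbackMetric (𝓡 n) μ h.inner) x).inverse (cov θ' x)) +
          pot (μ x) := by
      rw [liftedHamiltonian_eq_energy h pot hl, energy_toSection]
      rfl
    have h2 : 0 ≤ cov θ' x ((bil (pullbackMetric (𝓡 n) μ h.inner) x).inverse (cov θ' x)) := by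
      rcases eq_or_ne (cov θ' x) 0 with h0 | h0
      · simp [h0]
      · exact (dual_pos (hb'.pos x) h0).le
    simp only [h1]
    linarith
  refine ⟨isSubmanifold_energy hb hpot hkQ hd, ?_, fun {_ _ _} hS hS' => ⟨fun g => ?_, ?_, ?_⟩⟩
  · have h1 : liftedEnergySurface (𝓡 n) μ h pot k =
        {u | energy (𝓡 n) (pullbackMetric (𝓡 n) μ h.inner) (pot ∘ μ) u = k} :=
      Set.ext (mem_liftedEnergySurface_iff h pot hμ)
    rw [h1]
    exact isSubmanifold_energy hb' (hpot.comp hl.contMDiff) (fun x => hkQ (μ x)) hd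
  · exact isVirtuallyContact_energyProj hd h hμ hpot hσ hσ_closed hθ' (hθ'd.trans hθ_prim) hk hr
      hS hS' g
  · exact isSomewhereContact_energyProj hd h hμ hpot hU hUne hθ'U hkQ hS hS'
  · exact fun hn3 hex hex' => hex (isExactForm_of_restrictedTwisted hb hpot hkQ hS
      (fun _ => Iff.rfl) (hE.symm ▸ hn3) hσ hex')
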